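/- Let $W:[0,1]^2\to[0,1]$ be a graphon, i.e. a symmetric measurable function, and assume that $W$ is Lipschitz continuous. Let $T_W$ be the integral operator $(T_Wf)(x)=\int_0^1W(x,y)f(y)\,\mathrm dy$ on $L^2([0,1])$, and let $\lambda_1(W)\ge\lambda_2(W)\ge\cdots\ge0$ be its positive eigenvalues, repeated according to multiplicity and continued by zeros if there are only finitely many of them. Assume that $\lambda_1(W)>\lambda_2(W)$, and let $\phi_1$ be an eigenfunction of $T_W$ with eigenvalue $\lambda_1(W)$ and $\int_0^1\phi_1^2=1$. Let $U_1,U_2,\dots$ be independent and uniformly distributed on $[0,1]$. For each $n\ge1$ let $\boldsymbol W_n$ be the $n\times n$ matrix with entries $W(U_i,U_j)$ for $i\ne j$ and zeros on the diagonal, and let $\boldsymbol A_n$ be the adjacency matrix (symmetric, entries in $\{0,1\}$, zero diagonal) of a random simple graph on $\{1,\dots,n\}$ such that, conditionally on $U_1,\dots,U_n$, the entries $\boldsymbol A_n(i,j)$, $1\le i<j\le n$, are independent and Bernoulli distributed with parameters $W(U_i,U_j)$. Let $\lambda_1(\cdot)$ of a symmetric matrix denote its largest eigenvalue. Then there is a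 measurable set $\mathcal A$ of sequences in $[0,1]$ with $\mathbb P\big((U_1,U_2,\dots)\in\mathcal A\big)=1$ such that, for every $(u_1,u_2,\dots)\in\mathcal A$, as $n\to\infty$, the conditional law of $\lambda_1(\boldsymbol A_n)-\lambda_1(\boldsymbol W_n)$ given $(U_1,\dots,U_n)=(u_1,\dots,u_n)$ converges weakly to the normal distribution $\mathcal N(\alpha,\sigma^2)$, where $$\alpha=\frac1{\lambda_1(W)}\int_{[0,1]^2}\frac{\phi_1^2(x)+\phi_1^2(y)}2\,W(x,y)\,(1-W(x,y))\,\mathrm dx\,\mathrm dy,$$ $$\sigma^2=2\int_{[0,1]^2}\phi_1^2(x)\,\phi_1^2(y)\,W(x,y)\,(1-W(x,y))\,\mathrm dx\,\mathrm dy.$$ Here the conditional laws are given by a regular conditional distribution for each $n$, and a normal distribution of variance $0$ is a point mass. -/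

import Mathlib

open MeasureTheory ProbabilityTheory Filter Topology
open scoped NNReal ENNReal unitInterval

noncomputable section

/-- A graphon: a symmetric measurable function `[0,1]² → [0,1]`. -/
structure Graphon where
  toFun : I → I → ℝ
  measurable' : Measurable (Function.uncurry toFun)
  symm' : ∀ x y, toFun x y = toFun y x
  nonneg' : ∀ x y, 0 ≤ toFun x y
  le_one' : ∀ x y, toFun x y ≤ 1

namespace Graphon

instance : CoeFun Graphon (fun _ => I → I → ℝ) := ⟨Graphon.toFun⟩

/-- The real Hilbert space `L²([0,1])`, with Lebesgue measure. -/
abbrev L2 : Type := Lp ℝ 2 (volume : Measure I)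

theorem integrable_L2 (f : L2) : Integrable (f : I → ℝ) volume :=
  (Lp.memLp f).integrable (by norm_num)

theorem integrable_mul_L2 (W : Graphon) (f : L2) (x : I) :
    Integrable (fun y => W x y * f y) volume := by
  refine (integrable_L2 f).bdd_mul (c := 1) ?_ (Eventually.of_forall fun y => ?_)
  · exact (W.measurable'.comp measurable_prodMk_left).aestronglyMeasurable
  · rw [Real.norm_eq_abs, abs_of_nonneg (W.nonneg' x y)]
    exact W.le_one' x y

theorem memLp_integral (W : Graphon) (f : L2) :
    MemLp (fun x => ∫ y, W x y * f y) 2 (volume : Measure I) := by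
  refine MemLp.of_bound (C := ∫ y, ‖f y‖) ?_ (Eventually.of_forall fun x => ?_)
  · have h : AEStronglyMeasurable (fun p : I × I => W p.1 p.2 * f p.2) (volume.prod volume) :=
      W.measurable'.aestronglyMeasurable.mul (Lp.aestronglyMeasurable f).comp_snd
    exact h.integral_prod_right'
  · refine (norm_integral_le_integral_norm _).trans ?_
    refine integral_mono (W.integrable_mul_L2 f x).norm (integrable_L2 f).norm fun y => ?_
    simp only [norm_mul]
    have h : ‖W x y‖ ≤ 1 := by
      rw [Real.norm_eq_abs, abs_of_nonneg (W.nonneg' x y)]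
      exact W.le_one' x y
    exact mul_le_of_le_one_left (norm_nonneg _) h

/-- The integral operator `(T_W f)(x) = ∫ W(x,y) f(y) dy` on `L²([0,1])`. -/
def integralOperator (W : Graphon) : L2 →ₗ[ℝ] L2 where
  toFun f := (W.memLp_integral f).toLp _
  map_add' f g := by
    rw [← MemLp.toLp_add, MemLp.toLp_eq_toLp_iff]
    refine Eventually.of_forall fun x => ?_
    simp only [Pi.add_apply]
    rw [← integral_add (W.integrable_mul_L2 f x) (W.integrable_mul_L2 g x)]
    refine integral_congr_ae ?_
    filter_upwards [Lp.coeFn_add f g] with y hy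
    rw [hy, Pi.add_apply, mul_add]
  map_smul' c f := by
    rw [RingHom.id_apply, ← MemLp.toLp_const_smul, MemLp.toLp_eq_toLp_iff]
    refine Eventually.of_forall fun x => ?_
    simp only [Pi.smul_apply, smul_eq_mul]
    rw [← integral_const_mul]
    refine integral_congr_ae ?_
    filter_upwards [Lp.coeFn_smul c f] with y hy
    rw [hy, Pi.smul_apply, smul_eq_mul, mul_left_comm]

/-- For `k ≥ 1`, the `k`-th term `λ_k(W)` of the non-increasing enumeration
`λ_1(W) ≥ λ_2(W) ≥ ⋯ ≥ 0` of the positive eigenvalues of `T_W`, repeated according to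
multiplicity and continued by zeros if there are only finitely many of them: the largest `t` such
that `T_W` has `k` orthonormal eigenfunctions with eigenvalues at least `t`, and `0` if there is no
such `t > 0`. -/
def posEigenvalue (W : Graphon) (k : ℕ) : ℝ :=
  sSup ({0} ∪ {t : ℝ | 0 < t ∧ ∃ e : Fin k → L2, Orthonormal ℝ e ∧
    ∀ i, ∃ μ : ℝ, t ≤ μ ∧ W.integralOperator (e i) = μ • e i})

/-- `W` is Lipschitz continuous on the square. -/
def IsLipschitz (W : Graphon) : Prop :=
  ∃ L : ℝ≥0, LipschitzWith L (fun p : I × I => W p.1 p.2)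

/-- The spectral gap condition `λ_1(W) > λ_2(W)`. -/
def HasSpectralGap (W : Graphon) : Prop :=
  W.posEigenvalue 2 < W.posEigenvalue 1

/-- `φ` is a normalized eigenfunction for the largest eigenvalue `λ_1(W)`. -/
def IsTopEigenfunction (W : Graphon) (φ : L2) : Prop :=
  ‖φ‖ = 1 ∧ W.integralOperator φ = W.posEigenvalue 1 • φ

/-- The limiting mean
`α = λ_1(W)⁻¹ ∫∫ (φ(x)² + φ(y)²)/2 ⬝ W(x,y) (1 - W(x,y)) dx dy`. -/
def limitMean (W : Graphon) (φ : L2) : ℝ :=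
  (1 / W.posEigenvalue 1) *
    ∫ p : I × I, ((φ p.1) ^ 2 + (φ p.2) ^ 2) / 2 * (W p.1 p.2 * (1 - W p.1 p.2))

/-- The limiting variance `σ² = 2 ∫∫ φ(x)² φ(y)² W(x,y) (1 - W(x,y)) dx dy`. -/
def limitVariance (W : Graphon) (φ : L2) : ℝ :=
  2 * ∫ p : I × I, (φ p.1) ^ 2 * (φ p.2) ^ 2 * (W p.1 p.2 * (1 - W p.1 p.2))

theorem limitVariance_nonneg (W : Graphon) (φ : L2) : 0 ≤ W.limitVariance φ := by
  refine mul_nonneg zero_le_two (integral_nonneg fun p => ?_)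
  have h1 := W.nonneg' p.1 p.2
  have h2 := sub_nonneg.2 (W.le_one' p.1 p.2)
  positivity

/-- The connectivity probability matrix `(W(x_i, x_j) 1_{i ≠ j})`; there are no self-loops. -/
def connectivityMatrix (W : Graphon) {n : ℕ} (x : Fin n → I) : Matrix (Fin n) (Fin n) ℝ :=
  Matrix.of fun i j => if i = j then 0 else W (x i) (x j)

open Classical in
/-- The probability that the random graph on `n` vertices in which the pairs `i < j` are joined
independently, with probabilities `W(x_i, x_j)`, equals `H`. -/
def graphProb (W : Graphon) {n : ℕ} (x : Fin n → I) (H : SimpleGraph (Fin n)) : ℝ :=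
  ∏ i : Fin n, ∏ j ∈ Finset.Ioi i,
    if H.Adj i j then W (x i) (x j) else 1 - W (x i) (x j)

end Graphon

/-- The first `n` terms of a sequence of points of `[0,1]`. -/
def firstTerms (n : ℕ) (u : ℕ → I) : Fin n → I := fun i => u i

/-- The largest eigenvalue of a real symmetric `n × n` matrix (`n ≥ 1`). -/
def topEigenvalue {n : ℕ} (M : Matrix (Fin n) (Fin n) ℝ) : ℝ := sSup (spectrum ℝ M)

open Classical in
/-- The adjacency matrix of a simple graph on `n` vertices. -/
def adjacencyMatrix {n : ℕ} (H : SimpleGraph (Fin n)) : Matrix (Fin n) (Fin n) ℝ :=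
  H.adjMatrix ℝ

/-- The `W`-random graph model on a probability space `(Ω, P)`: the `U i` are independent and
uniform on `[0,1]`, and for every `n`, conditionally on the first `n` of them, the edges of the
graph `G n` are independent, `i < j` being joined with probability `W(U_i, U_j)`. Nothing is
assumed on the joint law of the graphs `G n` for different `n`. -/
structure IsWRandomGraph {Ω : Type*} [MeasurableSpace Ω] (P : Measure Ω) (W : Graphon)
    (U : ℕ → Ω → I) (G : (n : ℕ) → Ω → SimpleGraph (Fin n)) : Prop where
  measurable_U : ∀ i, Measurable (U i)
  uniform_U : ∀ i, P.map (U i) = (volume : Measure I)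
  indep_U : iIndepFun U P
  measurable_G : ∀ n, Measurable (G n)
  condLaw_G : ∀ (n : ℕ) (H : SimpleGraph (Fin n)),
    P⟦G n ⁻¹' {H} | MeasurableSpace.comap (fun ω => firstTerms n (fun i => U i ω)) inferInstance⟧
      =ᵐ[P] fun ω => W.graphProb (firstTerms n (fun i => U i ω)) H

/-- The difference `λ_1(A_n) - λ_1(W_n)` of the largest eigenvalues of the adjacency matrix and of
the connectivity probability matrix. -/
def eigenvalueDifference {Ω : Type*} (W : Graphon) (U : ℕ → Ω → I)
    (G : (n : ℕ) → Ω → SimpleGraph (Fin n)) (n : ℕ) (ω : Ω) : ℝ :=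
  topEigenvalue (adjacencyMatrix (G n ω)) -
    topEigenvalue (W.connectivityMatrix (firstTerms n (fun i => U i ω)))

/-- The (regular) conditional law of `λ_1(A_n) - λ_1(W_n)` given `U_1, …, U_n`, as a function of the
values of `U_1, …, U_n`. -/
def conditionalLaw {Ω : Type*} [MeasurableSpace Ω] (P : Measure Ω) [IsProbabilityMeasure P]
    (W : Graphon) (U : ℕ → Ω → I) (G : (n : ℕ) → Ω → SimpleGraph (Fin n)) (n : ℕ)
    (x : Fin n → I) : ProbabilityMeasure ℝ :=
  ⟨condDistrib (eigenvalueDifference W U G n) (fun ω => firstTerms n (fun i => U i ω)) P x,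
    inferInstance⟩

/-- The normal distribution with mean `m` and variance `v ≥ 0`, as a probability measure. -/
def normalLaw (m : ℝ) (v : ℝ) (hv : 0 ≤ v) : ProbabilityMeasure ℝ :=
  ⟨gaussianReal m ⟨v, hv⟩, instIsProbabilityMeasureGaussianReal m ⟨v, hv⟩⟩

end

/-! Fix the labels and write `A_n = W_n + E`, where `E` has independent centred entries above the
diagonal. Let `v` be the unit top eigenvector of `W_n`, with eigenvalue `l`. Pairing the eigenvalue
equation of `A_n` with `v` and with `E v` gives `λ_1(A_n) - l ≈ ⟨v, E v⟩ + ‖E v‖² / l`, with the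
explicit remainder of `abs_eigenvalue_sub_expansion_le`. Both `l` and the spectral gap are of order
`n`, and `‖E v‖` is at most of order `√n`. The remainder vanishes in probability because `‖E‖ =
o(n)` and because `‖W_n E v‖` is `O(n)`; the crude bound `‖W_n‖ ‖E v‖`, of order `n^{3/2}`, would
leave an error of order one.

The term `⟨v, E v⟩` is a sum of independent centred edge variables with coefficients `2 v_i v_j =
O(1/n)`, since eigenvectors for eigenvalues of order `n` are delocalized. It is asymptotically
Gaussian by a Lindeberg comparison of characteristic functions
(`norm_quadraticForm_charFun_sub_le`). The term `‖E v‖² / l` concentrates at its mean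
(`graphMean_noiseImageSq_sub_le`) and produces the shift `α`. The moment bounds rest on the
orthogonality of products of edge noises over different sets of edges (`graphMean_prod_mul_prod`).

The labels enter only through their equidistribution, which is almost sure by the strong law.
Eigenvectors of `W_n` with eigenvalue at least `c n` extend to uniformly Lipschitz functions, whose
limit points are orthonormal eigenfunctions of `T_W`. Hence the second eigenvalue is eventually
below `c n` for every `c > λ_2(W)` (`eventually_exists_gap`). Conversely, the sampled eigenfunction
is an approximate eigenvector of `W_n`, and the gap forces `l / n → λ_1(W)` and aligns `v` with the
sample (`exists_top_eigenvectors_asymptotics`). Mean and variance then become double averages over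
the labels, which converge to the integrals.

For almost every label vector the conditional law is the explicit finite mixture
`Graphon.statisticKernel`, and convergence of characteristic functions yields weak convergence. -/

noncomputable section

/-! ### Second order perturbation of a simple top eigenvalue. -/

section Perturbation

variable {F : Type*} [NormedAddCommGroup F] [InnerProductSpace ℝ F]

/-- The component orthogonal to `v` of a unit eigenvector of `W + E` is controlled by `E v`. -/
theorem norm_orthogonal_component_le {W E : F →ₗ[ℝ] F}
    {v z : F} (hv : ‖v‖ = 1) (hz : ‖z‖ = 1) {l L g ε : ℝ} (hWv : W v = l • v)
    (hgap : ∀ y, inner ℝ v y = 0 → inner ℝ y (W y) ≤ (l - g) * ‖y‖ ^ 2)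
    (hEop : ∀ y, ‖E y‖ ≤ ε * ‖y‖) (hLz : W z + E z = L • z) (hL : l - ε ≤ L) (hε : 4 * ε ≤ g) :
    g * ‖z - (inner ℝ v z : ℝ) • v‖ ≤ 2 * ‖E v‖ := by
  set c : ℝ := inner ℝ v z with hc
  set y := z - c • v with hy
  have hvv : inner ℝ v v = (1 : ℝ) := by rw [real_inner_self_eq_norm_sq, hv]; norm_num
  have hvy : inner ℝ v y = (0 : ℝ) := by
    rw [hy, inner_sub_right, inner_smul_right, hvv, ← hc]; ring
  have hzy : z = c • v + y := by rw [hy]; abel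
  have hc1 : |c| ≤ 1 := by
    have := abs_real_inner_le_norm v z
    rwa [hv, hz, one_mul] at this
  -- Pair the eigenvalue equation with `y`. Here `L ≥ l - ε`, while on the complement of `v` the
  -- form of `W` is at most `l - g` and that of `E` at most `ε`, so a margin `g - 2ε ≥ g / 2`
  -- remains.
  have h1 : inner ℝ (W z + E z) y = L * ‖y‖ ^ 2 := by
    rw [hLz, inner_smul_left, hzy, inner_add_left, inner_smul_left, hvy,
      real_inner_self_eq_norm_sq]
    simp
  have h2 : inner ℝ (W z + E z) y = c * inner ℝ (E v) y + inner ℝ y (W y) + inner ℝ (E y) y := by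
    rw [inner_add_left]
    have hWz : W z = c • l • v + W y := by
      conv_lhs => rw [hzy]
      rw [map_add, map_smul, hWv]
    have hEz : E z = c • E v + E y := by
      conv_lhs => rw [hzy]
      rw [map_add, map_smul]
    rw [hWz, hEz, inner_add_left, inner_add_left, inner_smul_left,
      inner_smul_left, inner_smul_left, hvy, real_inner_comm y (W y)]
    simp; ring
  have h3 : |c * inner ℝ (E v) y| ≤ ‖E v‖ * ‖y‖ := by
    rw [abs_mul]
    calc |c| * |inner ℝ (E v) y| ≤ 1 * (‖E v‖ * ‖y‖) :=
          mul_le_mul hc1 (abs_real_inner_le_norm _ _) (abs_nonneg _) zero_le_one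
      _ = _ := one_mul _
  have h4 : inner ℝ (E y) y ≤ ε * ‖y‖ ^ 2 := by
    calc inner ℝ (E y) y ≤ ‖E y‖ * ‖y‖ := real_inner_le_norm _ _
      _ ≤ (ε * ‖y‖) * ‖y‖ := mul_le_mul_of_nonneg_right (hEop y) (norm_nonneg _)
      _ = _ := by ring
  have h5 := hgap y hvy
  have h6 : (g - 2 * ε) * ‖y‖ ^ 2 ≤ ‖E v‖ * ‖y‖ := by
    nlinarith [le_abs_self (c * inner ℝ (E v) y), sq_nonneg ‖y‖]
  rcases (norm_nonneg y).eq_or_lt with h0 | h0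
  · rw [← h0]; simp
  · have h7 : (g - 2 * ε) * ‖y‖ ≤ ‖E v‖ := by
      refine le_of_mul_le_mul_right ?_ h0
      linarith [h6, show (g - 2 * ε) * ‖y‖ ^ 2 = (g - 2 * ε) * ‖y‖ * ‖y‖ by ring]
    nlinarith

/-- Second order expansion of the largest eigenvalue of `W + E`, with an explicit remainder. -/
theorem abs_eigenvalue_sub_expansion_le {W E : F →ₗ[ℝ] F} (hW : W.IsSymmetric)
    (hE : E.IsSymmetric) {v z : F} (hv : ‖v‖ = 1) (hz : ‖z‖ = 1) {l L g ε : ℝ}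
    (hWv : W v = l • v) (hgap : ∀ y, inner ℝ v y = 0 → inner ℝ y (W y) ≤ (l - g) * ‖y‖ ^ 2)
    (hEop : ∀ y, ‖E y‖ ≤ ε * ‖y‖) (hLz : W z + E z = L • z) (hL : l - ε ≤ L) (hε : 4 * ε ≤ g)
    (hg : 0 < g) (hl : 0 < l) (hεl : 4 * ε ≤ l) :
    |L - l - (inner ℝ v (E v) + ‖E v‖ ^ 2 / l)| ≤
      2 * ((‖W (E v)‖ + ε * ‖E v‖) / l * (2 * ‖E v‖ / g) +
        |inner ℝ v (E v) + ‖E v‖ ^ 2 / l| * (‖E v‖ / l)) := by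
  have hy0 := norm_orthogonal_component_le hv hz hWv hgap hEop hLz hL hε
  set c : ℝ := inner ℝ v z with hc
  set y := z - c • v with hy
  set e := E v with he
  set S : ℝ := inner ℝ v e + ‖e‖ ^ 2 / l with hS
  have hvv : inner ℝ v v = (1 : ℝ) := by rw [real_inner_self_eq_norm_sq, hv]; norm_num
  have hvy : inner ℝ v y = (0 : ℝ) := by
    rw [hy, inner_sub_right, inner_smul_right, hvv, ← hc]; ring
  have hzy : z = c • v + y := by rw [hy]; abel
  have heε : ‖e‖ ≤ ε := by simpa [hv] using hEop v
  have hyle : ‖y‖ ≤ 2 * ‖e‖ / g := by rw [le_div_iff₀ hg]; linarith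
  have hyhalf : ‖y‖ ≤ 1 / 2 := by
    refine hyle.trans ?_
    rw [div_le_iff₀ hg]; linarith
  have hcsq : c ^ 2 + ‖y‖ ^ 2 = 1 := by
    have h : ‖z‖ ^ 2 = c ^ 2 + ‖y‖ ^ 2 := by
      rw [← real_inner_self_eq_norm_sq, hzy, inner_add_left, inner_add_right, inner_add_right,
        inner_smul_left, inner_smul_left, inner_smul_right, inner_smul_right, hvv, hvy,
        real_inner_comm v y, hvy, real_inner_self_eq_norm_sq]
      simp; ring
    rw [← h, hz]; norm_num
  have hc34 : 3 / 4 ≤ |c| := by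
    have h1 : |c| ^ 2 = c ^ 2 := sq_abs c
    nlinarith [abs_nonneg c, norm_nonneg y]
  -- This vector satisfies `⟨r, v⟩ = S` exactly: `W` contributes the first order term and `E` the
  -- second.
  set r := (1 / l) • (W e + E e) with hr
  have hev : inner ℝ (W e + E e) v = l * S := by
    rw [inner_add_left, hW e v, hWv, hE e v, ← he, inner_smul_right, real_inner_self_eq_norm_sq,
      hS, real_inner_comm v e]
    field_simp
  have hrv : inner ℝ r v = S := by
    rw [hr, inner_smul_left, hev]
    simp; field_simp
  -- Pairing the eigenvalue equation with `v` gives `(L - l) c = ⟨e, z⟩`, and with `e` gives `⟨r, z⟩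
  -- = L ⟨e, z⟩ / l`. Adding `(L - l) ⟨e, z⟩ / l` to the first yields the second, so the expansion
  -- is an identity up to `⟨r, y⟩` and `S ⟨e, z⟩ / l`.
  have hkey : (L - l) * (c + inner ℝ e z / l) = c * S + inner ℝ r y := by
    have h1 : inner ℝ r z = c * S + inner ℝ r y := by
      nth_rw 1 [hzy]
      rw [inner_add_right, inner_smul_right, hrv]
    rw [← h1]
    have h2 : inner ℝ (W v + E v) z = L * c := by
      rw [inner_add_left, hW v z, hE v z, ← inner_add_right, hLz, inner_smul_right]
    have h3 : inner ℝ (W e + E e) z = L * inner ℝ e z := by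
      rw [inner_add_left, hW e z, hE e z, ← inner_add_right, hLz, inner_smul_right]
    have h4 : inner ℝ (W v + E v) z = l * c + inner ℝ e z := by
      rw [inner_add_left, hWv, inner_smul_left]; simp [hc, he]
    rw [hr, inner_smul_left, h3]
    have h5 : L * c = l * c + inner ℝ e z := h2.symm.trans h4
    simp only [conj_trivial]
    field_simp
    linear_combination l * h5
  have hez : |inner ℝ e z / l| ≤ ‖e‖ / l := by
    rw [abs_div, abs_of_pos hl]
    gcongr
    simpa [hz] using abs_real_inner_le_norm e z
  have hel : ‖e‖ / l ≤ 1 / 4 := by rw [div_le_iff₀ hl]; linarith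
  have hrn : ‖r‖ ≤ (‖W e‖ + ε * ‖e‖) / l := by
    rw [hr, norm_smul, Real.norm_eq_abs, abs_of_pos (by positivity), div_mul_eq_mul_div, one_mul]
    gcongr
    exact (norm_add_le _ _).trans (by gcongr; exact hEop e)
  have hry : |inner ℝ r y| ≤ (‖W e‖ + ε * ‖e‖) / l * (2 * ‖e‖ / g) :=
    (abs_real_inner_le_norm r y).trans (mul_le_mul hrn hyle (norm_nonneg _)
      ((norm_nonneg _).trans hrn))
  have hmain : (L - l - S) * (c + inner ℝ e z / l) = inner ℝ r y - S * (inner ℝ e z / l) := by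
    linear_combination hkey
  -- The bound is `3/4 - 1/4`; dividing by this factor produces the leading `2` of the remainder.
  have hlow : 1 / 2 ≤ |c + inner ℝ e z / l| := by
    have := abs_sub_abs_le_abs_sub c (-(inner ℝ e z / l))
    rw [sub_neg_eq_add, abs_neg] at this
    linarith
  have hup : |L - l - S| * |c + inner ℝ e z / l| ≤
      (‖W e‖ + ε * ‖e‖) / l * (2 * ‖e‖ / g) + |S| * (‖e‖ / l) := by
    rw [← abs_mul, hmain]
    refine (abs_sub _ _).trans ?_
    rw [abs_mul]
    gcongr
  nlinarith [abs_nonneg (L - l - S)]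

/-- The two largest eigenvalues of a symmetric operator and their variational bounds. -/
theorem LinearMap.IsSymmetric.exists_two_top_eigenvectors [FiniteDimensional ℝ F] {T : F →ₗ[ℝ] F}
    (hT : T.IsSymmetric) (hF : 2 ≤ Module.finrank ℝ F) :
    ∃ (e : Fin 2 → F) (m : Fin 2 → ℝ), Orthonormal ℝ e ∧ (∀ i, T (e i) = m i • e i) ∧ m 1 ≤ m 0 ∧
      (∀ y, inner ℝ y (T y) ≤ m 0 * ‖y‖ ^ 2) ∧
      ∀ y, inner ℝ (e 0) y = 0 → inner ℝ y (T y) ≤ m 1 * ‖y‖ ^ 2 := by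
  set n := Module.finrank ℝ F with hn
  -- This eigenbasis is ordered by decreasing eigenvalue, so the indices `0` and `1` carry the two
  -- largest ones.
  set b := hT.eigenvectorBasis hn.symm
  set m := hT.eigenvalues hn.symm with hm
  let ι : Fin 2 → Fin n := Fin.castLE hF
  have hinj : Function.Injective ι := Fin.castLE_injective hF
  have hsum : ∀ y, inner ℝ y (T y) = ∑ i, m i * (b.repr y i) ^ 2 := fun y => by
    rw [← b.repr.inner_map_map y (T y), PiLp.inner_apply]
    refine Finset.sum_congr rfl fun i _ => ?_
    have h := hT.eigenvectorBasis_apply_self_apply hn.symm y i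
    simp only [RCLike.inner_apply, conj_trivial]
    rw [h]
    change m i * b.repr y i * b.repr y i = m i * b.repr y i ^ 2
    ring
  have hnorm : ∀ y, ‖y‖ ^ 2 = ∑ i, (b.repr y i) ^ 2 := fun y => by
    rw [← b.repr.norm_map y, EuclideanSpace.real_norm_sq_eq]
  refine ⟨b ∘ ι, m ∘ ι, b.orthonormal.comp ι hinj, fun i => ?_, ?_, fun y => ?_, fun y hy => ?_⟩
  · exact hT.apply_eigenvectorBasis hn.symm (ι i)
  · exact hT.eigenvalues_antitone hn.symm (by simp [ι, Fin.le_def])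
  · rw [hsum, hnorm, Finset.mul_sum]
    refine Finset.sum_le_sum fun i _ => mul_le_mul_of_nonneg_right ?_ (sq_nonneg _)
    exact hT.eigenvalues_antitone hn.symm (by simp [ι, Fin.le_def])
  · rw [hsum, hnorm, Finset.mul_sum]
    refine Finset.sum_le_sum fun i _ => ?_
    by_cases hi : i = ι 0
    · have : b.repr y i = 0 := by rw [b.repr_apply_apply, hi]; exact hy
      rw [this]; simp
    · refine mul_le_mul_of_nonneg_right ?_ (sq_nonneg _)
      refine hT.eigenvalues_antitone hn.symm ?_
      simp only [ι, Fin.le_def, Fin.ext_iff, Fin.val_castLE] at hi ⊢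
      simp at hi ⊢; omega

end Perturbation

/-! ### The top eigenvalue of a symmetric matrix. -/

section TopEigenvalue

variable {n : ℕ} {M : Matrix (Fin n) (Fin n) ℝ}

/-- Every eigenvalue is a value of the Rayleigh quotient, so an eigenvalue that bounds this quotient
is the greatest element of the spectrum. -/
theorem topEigenvalue_eq {v : EuclideanSpace ℝ (Fin n)} (hv : v ≠ 0) {m : ℝ}
    (hMv : M.toEuclideanLin v = m • v)
    (hle : ∀ y, inner ℝ y (M.toEuclideanLin y) ≤ m * ‖y‖ ^ 2) : topEigenvalue M = m := by
  have hmem : m ∈ spectrum ℝ M := by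
    rw [← Matrix.spectrum_toLpLin 2, ← Module.End.hasEigenvalue_iff_mem_spectrum]
    exact Module.End.hasEigenvalue_of_hasEigenvector
      ⟨Module.End.mem_eigenspace_iff.2 hMv, hv⟩
  refine IsGreatest.csSup_eq ⟨hmem, fun k hk => ?_⟩
  rw [← Matrix.spectrum_toLpLin 2, ← Module.End.hasEigenvalue_iff_mem_spectrum] at hk
  obtain ⟨w, hw, hw0⟩ := hk.exists_hasEigenvector
  rw [Module.End.mem_eigenspace_iff] at hw
  have h := hle w
  rw [hw, inner_smul_right, real_inner_self_eq_norm_sq] at h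
  exact le_of_mul_le_mul_right h (by positivity)

theorem exists_top_eigenvector (hM : M.IsHermitian) (hn : 2 ≤ n) :
    ∃ v : EuclideanSpace ℝ (Fin n), ‖v‖ = 1 ∧ M.toEuclideanLin v = topEigenvalue M • v ∧
      ∀ y, inner ℝ y (M.toEuclideanLin y) ≤ topEigenvalue M * ‖y‖ ^ 2 := by
  obtain ⟨e, m, he, hm, -, h0, -⟩ := (Matrix.isSymmetric_toEuclideanLin_iff.2 hM)
    |>.exists_two_top_eigenvectors (by simpa using hn)
  have hne : e 0 ≠ 0 := he.ne_zero 0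
  have := topEigenvalue_eq hne (hm 0) h0
  rw [this]
  exact ⟨e 0, he.1 0, hm 0, h0⟩

end TopEigenvalue

/-! ### Moments of independent edges, as finite sums over graphs. -/

section BernoulliGraph

variable {V : Type*} [Fintype V] [DecidableEq V]

/-- The possible edges of a simple graph on `V`. -/
def possibleEdges (V : Type*) [Fintype V] [DecidableEq V] : Finset (Sym2 V) :=
  Finset.univ.filter fun e => ¬ e.IsDiag

theorem mem_possibleEdges {e : Sym2 V} : e ∈ possibleEdges V ↔ ¬ e.IsDiag := by
  simp [possibleEdges]

-- Graphs correspond to subsets of the possible edges, so this is the expansion of a product of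
-- binomials. It is the algebraic form of the independence of the edges.
open Classical in
theorem sum_simpleGraph_prod {R : Type*} [CommRing R] (a b : Sym2 V → R) :
    ∑ H : SimpleGraph V, ∏ e ∈ possibleEdges V, (if e ∈ H.edgeSet then a e else b e) =
      ∏ e ∈ possibleEdges V, (a e + b e) := by
  rw [Finset.prod_add]
  refine Finset.sum_bij' (fun H _ => (possibleEdges V).filter (· ∈ H.edgeSet))
    (fun t _ => SimpleGraph.fromEdgeSet (t : Set (Sym2 V))) ?_ ?_ ?_ ?_ ?_
  · intro H _
    simp
  · intro t _
    simp
  · intro H _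
    ext i j
    simp only [SimpleGraph.fromEdgeSet_adj, Finset.coe_filter, mem_possibleEdges, Set.mem_ofPred_eq,
      SimpleGraph.mem_edgeSet, Sym2.mk_isDiag_iff]
    exact ⟨fun h => h.1.2, fun h => ⟨⟨h.ne, h⟩, h.ne⟩⟩
  · intro t ht
    rw [Finset.mem_powerset] at ht
    ext e
    simp only [Finset.mem_filter, mem_possibleEdges, SimpleGraph.edgeSet_fromEdgeSet, Set.mem_sdiff,
      Finset.mem_coe]
    constructor
    · exact fun h => h.2.1
    · intro h
      have := mem_possibleEdges.1 (ht h)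
      exact ⟨this, h, by simpa using this⟩
  · intro H _
    rw [Finset.prod_ite]
    congr 1
    refine Finset.prod_congr ?_ fun _ _ => rfl
    ext e; simp; tauto

open Classical in
/-- The probability of `H` when the edges are independent with probabilities `p`. -/
def bernoulliWeight (p : Sym2 V → ℝ) (H : SimpleGraph V) : ℝ :=
  ∏ e ∈ possibleEdges V, if e ∈ H.edgeSet then p e else 1 - p e

/-- Expectation with respect to a random graph with independent edges. -/
def graphMean (p : Sym2 V → ℝ) (f : SimpleGraph V → ℝ) : ℝ := ∑ H, bernoulliWeight p H * f H

open Classical in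
/-- The centred indicator of an edge. -/
def edgeNoise (p : Sym2 V → ℝ) (H : SimpleGraph V) (e : Sym2 V) : ℝ :=
  (if e ∈ H.edgeSet then 1 else 0) - p e

variable {p : Sym2 V → ℝ}

theorem bernoulliWeight_nonneg (hp : ∀ e, p e ∈ Set.Icc (0 : ℝ) 1) (H : SimpleGraph V) :
    0 ≤ bernoulliWeight p H := by
  refine Finset.prod_nonneg fun e _ => ?_
  have := hp e
  split_ifs
  · exact this.1
  · linarith [this.2]

variable (p) in
theorem sum_bernoulliWeight : ∑ H, bernoulliWeight p H = 1 := by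
  unfold bernoulliWeight
  rw [sum_simpleGraph_prod]
  simp

theorem graphMean_mono (hp : ∀ e, p e ∈ Set.Icc (0 : ℝ) 1) {f g : SimpleGraph V → ℝ}
    (h : ∀ H, f H ≤ g H) : graphMean p f ≤ graphMean p g :=
  Finset.sum_le_sum fun H _ => mul_le_mul_of_nonneg_left (h H) (bernoulliWeight_nonneg hp H)

theorem graphMean_add (f g : SimpleGraph V → ℝ) :
    graphMean p (fun H => f H + g H) = graphMean p f + graphMean p g := by
  simp [graphMean, mul_add, Finset.sum_add_distrib]

theorem graphMean_const_mul (c : ℝ) (f : SimpleGraph V → ℝ) :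
    graphMean p (fun H => c * f H) = c * graphMean p f := by
  simp only [graphMean, Finset.mul_sum]
  exact Finset.sum_congr rfl fun _ _ => by ring

theorem graphMean_const (c : ℝ) : graphMean p (fun _ => c) = c := by
  simp [graphMean, ← Finset.sum_mul, sum_bernoulliWeight]

theorem graphMean_sum {ι : Type*} (s : Finset ι) (f : ι → SimpleGraph V → ℝ) :
    graphMean p (fun H => ∑ i ∈ s, f i H) = ∑ i ∈ s, graphMean p (f i) := by
  simp only [graphMean, Finset.mul_sum]
  exact Finset.sum_comm

open Classical in
theorem graphMean_prod (a b : Sym2 V → ℝ) :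
    graphMean p (fun H => ∏ e ∈ possibleEdges V, if e ∈ H.edgeSet then a e else b e) =
      ∏ e ∈ possibleEdges V, (p e * a e + (1 - p e) * b e) := by
  unfold graphMean bernoulliWeight
  rw [← sum_simpleGraph_prod]
  refine Finset.sum_congr rfl fun H _ => ?_
  rw [← Finset.prod_mul_distrib]
  refine Finset.prod_congr rfl fun e _ => ?_
  split_ifs <;> rfl

-- If `S ≠ T`, some edge occurs in exactly one of the two products, and its factor has mean zero by
-- independence. If `S = T`, each edge contributes its variance.
open Classical in
theorem graphMean_prod_mul_prod {S T : Finset (Sym2 V)} (hS : S ⊆ possibleEdges V)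
    (hT : T ⊆ possibleEdges V) :
    graphMean p (fun H => (∏ e ∈ S, edgeNoise p H e) * ∏ e ∈ T, edgeNoise p H e) =
      if S = T then ∏ e ∈ S, p e * (1 - p e) else 0 := by
  have key : ∀ H : SimpleGraph V, (∏ e ∈ S, edgeNoise p H e) * ∏ e ∈ T, edgeNoise p H e =
      ∏ e ∈ possibleEdges V, if e ∈ H.edgeSet
        then (if e ∈ S then 1 - p e else 1) * (if e ∈ T then 1 - p e else 1)
        else (if e ∈ S then - p e else 1) * (if e ∈ T then - p e else 1) := by
    intro H
    have h : ∀ R ⊆ possibleEdges V, ∏ e ∈ R, edgeNoise p H e =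
        ∏ e ∈ possibleEdges V, if e ∈ R then edgeNoise p H e else 1 := fun R hR => by
      rw [Finset.prod_ite_mem, Finset.inter_eq_right.2 hR]
    rw [h S hS, h T hT, ← Finset.prod_mul_distrib]
    refine Finset.prod_congr rfl fun e _ => ?_
    unfold edgeNoise
    split_ifs <;> simp
  simp_rw [key]
  rw [graphMean_prod]
  split_ifs with hST
  · subst hST
    rw [← Finset.inter_eq_right.2 hS, ← Finset.prod_ite_mem, Finset.inter_eq_right.2 hS]
    refine Finset.prod_congr rfl fun e _ => ?_
    split_ifs <;> ring
  · obtain ⟨e, he⟩ : ∃ e, ¬ (e ∈ S ↔ e ∈ T) := by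
      by_contra! h
      exact hST (Finset.ext h)
    have hmem : e ∈ possibleEdges V := by
      by_cases h : e ∈ S
      · exact hS h
      · exact hT (by tauto)
    refine Finset.prod_eq_zero hmem ?_
    by_cases h1 : e ∈ S <;> by_cases h2 : e ∈ T <;> simp [h1, h2] at he ⊢ <;> ring

/-- By orthogonality only the diagonal terms of the expanded square survive, and each carries a
product of variances, which is at most `1`. -/
theorem graphMean_sq_sum_le (hp : ∀ e, p e ∈ Set.Icc (0 : ℝ) 1) {ι : Type*} {s : Finset ι}
    {S : ι → Finset (Sym2 V)} (hinj : Set.InjOn S s) (hS : ∀ i ∈ s, S i ⊆ possibleEdges V)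
    (c : ι → ℝ) :
    graphMean p (fun H => (∑ i ∈ s, c i * ∏ e ∈ S i, edgeNoise p H e) ^ 2) ≤
      ∑ i ∈ s, c i ^ 2 := by
  classical
  simp only [sq, Finset.sum_mul_sum]
  rw [graphMean_sum]
  refine Finset.sum_le_sum fun i hi => ?_
  rw [graphMean_sum]
  have h : ∀ j ∈ s, graphMean p (fun H => c i * (∏ e ∈ S i, edgeNoise p H e) *
      (c j * ∏ e ∈ S j, edgeNoise p H e)) =
      if j = i then c i * c j * ∏ e ∈ S i, p e * (1 - p e) else 0 := fun j hj => by
    have h1 : (fun H => c i * (∏ e ∈ S i, edgeNoise p H e) * (c j * ∏ e ∈ S j, edgeNoise p H e)) =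
        fun H => (c i * c j) * ((∏ e ∈ S i, edgeNoise p H e) * ∏ e ∈ S j, edgeNoise p H e) := by
      ext H; ring
    rw [h1, graphMean_const_mul, graphMean_prod_mul_prod (hS i hi) (hS j hj)]
    by_cases hij : j = i
    · simp [hij]
    · rw [if_neg hij, if_neg fun h => hij (hinj hj hi h.symm), mul_zero]
  rw [Finset.sum_congr rfl h, Finset.sum_ite_eq' s i, if_pos hi]
  refine mul_le_of_le_one_right (mul_self_nonneg _) (Finset.prod_le_one (fun e _ => ?_) fun e _ => ?_)
  · exact mul_nonneg (hp e).1 (by linarith [(hp e).2])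
  · nlinarith [(hp e).1, (hp e).2]

theorem abs_edgeNoise_le_one (hp : ∀ e, p e ∈ Set.Icc (0 : ℝ) 1) (H : SimpleGraph V) (e : Sym2 V) :
    |edgeNoise p H e| ≤ 1 := by
  have := hp e
  unfold edgeNoise
  rw [abs_le]
  split_ifs <;> constructor <;> linarith [this.1, this.2]

/-- The noise takes only the two values `1 - p` and `-p`, so it is a root of a quadratic. This turns
squares into a constant plus a linear term, to which the linear moment bound applies. -/
theorem edgeNoise_sq (H : SimpleGraph V) (e : Sym2 V) :
    edgeNoise p H e ^ 2 = p e * (1 - p e) + (1 - 2 * p e) * edgeNoise p H e := by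
  unfold edgeNoise
  split_ifs <;> ring

end BernoulliGraph

/-! ### Second moments of linear and quadratic forms in the noise matrix. -/

section NoiseMatrix

variable {n : ℕ} {p : Sym2 (Fin n) → ℝ}

/-- The matrix of centred edge indicators. -/
def noiseMatrix (p : Sym2 (Fin n) → ℝ) (H : SimpleGraph (Fin n)) : Matrix (Fin n) (Fin n) ℝ :=
  Matrix.of fun i j => if i = j then 0 else edgeNoise p H s(i, j)

theorem noiseMatrix_apply (H : SimpleGraph (Fin n)) (i j : Fin n) :
    noiseMatrix p H i j = if i = j then 0 else edgeNoise p H s(i, j) := rfl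

theorem noiseMatrix_symm (H : SimpleGraph (Fin n)) (i j : Fin n) :
    noiseMatrix p H i j = noiseMatrix p H j i := by
  rw [noiseMatrix_apply, noiseMatrix_apply, Sym2.eq_swap]
  simp only [eq_comm]

theorem graphMean_sq_add_le (hp : ∀ e, p e ∈ Set.Icc (0 : ℝ) 1)
    (f g : SimpleGraph (Fin n) → ℝ) :
    graphMean p (fun H => (f H + g H) ^ 2) ≤
      2 * graphMean p (fun H => f H ^ 2) + 2 * graphMean p (fun H => g H ^ 2) := by
  rw [← graphMean_const_mul, ← graphMean_const_mul, ← graphMean_add]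
  exact graphMean_mono hp fun H => by nlinarith [sq_nonneg (f H - g H)]

/-- The second moment of a linear form in the entries of the noise matrix. -/
theorem graphMean_sq_linear_le (hp : ∀ e, p e ∈ Set.Icc (0 : ℝ) 1) (a : Fin n → Fin n → ℝ) :
    graphMean p (fun H => (∑ i, ∑ j, a i j * noiseMatrix p H i j) ^ 2) ≤
      2 * ∑ i, ∑ j, a i j ^ 2 := by
  -- Each edge occurs as `(i, j)` and as `(j, i)`. Splitting by order makes the edge sets distinct
  -- within each half, at the cost of a factor `2`.
  set s1 : Finset (Fin n × Fin n) := Finset.univ.filter fun q => q.1 < q.2 with hs1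
  set s2 : Finset (Fin n × Fin n) := Finset.univ.filter fun q => q.2 < q.1 with hs2
  have hdisj : Disjoint s1 s2 := by
    rw [Finset.disjoint_filter]; intro q _ h; exact h.asymm
  let S : Fin n × Fin n → Finset (Sym2 (Fin n)) := fun q => {s(q.1, q.2)}
  have hsplit : ∀ H, ∑ i, ∑ j, a i j * noiseMatrix p H i j =
      ∑ q ∈ s1, a q.1 q.2 * ∏ e ∈ S q, edgeNoise p H e +
      ∑ q ∈ s2, a q.1 q.2 * ∏ e ∈ S q, edgeNoise p H e := fun H => by
    rw [← Finset.sum_union hdisj, ← Finset.sum_product', Finset.univ_product_univ]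
    symm
    rw [← Finset.sum_subset (Finset.subset_univ (s1 ∪ s2))]
    · refine Finset.sum_congr rfl fun q hq => ?_
      have : q.1 ≠ q.2 := by
        simp only [hs1, hs2, Finset.mem_union, Finset.mem_filter, Finset.mem_univ, true_and] at hq
        rcases hq with h | h
        exacts [h.ne, h.ne']
      simp [S, noiseMatrix_apply, this]
    · intro q _ hq
      have : q.1 = q.2 := by
        simp only [hs1, hs2, Finset.mem_union, Finset.mem_filter, Finset.mem_univ, true_and,
          not_or, not_lt] at hq
        exact le_antisymm hq.2 hq.1
      simp [noiseMatrix_apply, this]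
  simp_rw [hsplit]
  refine (graphMean_sq_add_le hp _ _).trans ?_
  rw [← mul_add]
  refine mul_le_mul_of_nonneg_left ?_ zero_le_two
  have h1 := graphMean_sq_sum_le hp (s := s1) (S := S) (fun q hq r hr h => by
    simp only [hs1, Finset.coe_filter, Finset.mem_univ, true_and, Set.mem_ofPred_eq] at hq hr
    simp only [S, Finset.singleton_inj, Sym2.eq_iff] at h
    ext1
    all_goals grind) (fun q hq => by
    simp only [hs1, Finset.mem_filter, Finset.mem_univ, true_and] at hq
    simp [S, mem_possibleEdges, hq.ne]) (fun q => a q.1 q.2)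
  have h2 := graphMean_sq_sum_le hp (s := s2) (S := S) (fun q hq r hr h => by
    simp only [hs2, Finset.coe_filter, Finset.mem_univ, true_and, Set.mem_ofPred_eq] at hq hr
    simp only [S, Finset.singleton_inj, Sym2.eq_iff] at h
    ext1
    all_goals grind) (fun q hq => by
    simp only [hs2, Finset.mem_filter, Finset.mem_univ, true_and] at hq
    simp [S, mem_possibleEdges, hq.ne']) (fun q => a q.1 q.2)
  refine (add_le_add h1 h2).trans ?_
  rw [← Finset.sum_union hdisj, ← Finset.sum_product', Finset.univ_product_univ]
  exact Finset.sum_le_sum_of_subset_of_nonneg (Finset.subset_univ _) fun _ _ _ => sq_nonneg _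

/-- The two edges of a path with centre `q.1`. -/
def pathEdges (q : Fin n × Fin n × Fin n) : Finset (Sym2 (Fin n)) :=
  {s(q.1, q.2.1), s(q.1, q.2.2)}

/-- The two edges are distinct and meet only in the centre, so they determine the centre and the
unordered pair of ends; the order assumption removes the remaining swap. -/
theorem pathEdges_inj {q r : Fin n × Fin n × Fin n} (hq : q.2.1 < q.2.2) (hr : r.2.1 < r.2.2)
    (hq1 : q.1 ≠ q.2.1) (hq2 : q.1 ≠ q.2.2) (hr1 : r.1 ≠ r.2.1) (hr2 : r.1 ≠ r.2.2)
    (h : pathEdges q = pathEdges r) : q = r := by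
  obtain ⟨i, j, k⟩ := q
  obtain ⟨i', j', k'⟩ := r
  simp only [pathEdges] at *
  have a1 : s(i, j) ∈ ({s(i', j'), s(i', k')} : Finset (Sym2 (Fin n))) := by rw [← h]; simp
  have a2 : s(i, k) ∈ ({s(i', j'), s(i', k')} : Finset (Sym2 (Fin n))) := by rw [← h]; simp
  have b1 : s(i', j') ∈ ({s(i, j), s(i, k)} : Finset (Sym2 (Fin n))) := by rw [h]; simp
  have b2 : s(i', k') ∈ ({s(i, j), s(i, k)} : Finset (Sym2 (Fin n))) := by rw [h]; simp
  simp only [Finset.mem_insert, Finset.mem_singleton, Sym2.eq_iff] at a1 a2 b1 b2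
  rw [Prod.mk.injEq, Prod.mk.injEq]
  grind

/-- The second moment of a quadratic form in pairs of adjacent entries of the noise matrix. -/
theorem graphMean_sq_path_le (hp : ∀ e, p e ∈ Set.Icc (0 : ℝ) 1)
    (a : Fin n → Fin n → Fin n → ℝ) :
    graphMean p (fun H => (∑ i, ∑ j, ∑ k,
      if j = k then 0 else a i j k * (noiseMatrix p H i j * noiseMatrix p H i k)) ^ 2) ≤
      2 * ∑ i, ∑ j, ∑ k, a i j k ^ 2 := by
  set s1 : Finset (Fin n × Fin n × Fin n) :=
    Finset.univ.filter fun q => q.2.1 < q.2.2 ∧ q.1 ≠ q.2.1 ∧ q.1 ≠ q.2.2 with hs1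
  set s2 : Finset (Fin n × Fin n × Fin n) :=
    Finset.univ.filter fun q => q.2.2 < q.2.1 ∧ q.1 ≠ q.2.1 ∧ q.1 ≠ q.2.2 with hs2
  have hdisj : Disjoint s1 s2 := by
    rw [Finset.disjoint_filter]; intro q _ h h'; exact h.1.asymm h'.1
  have hsum : ∀ f : Fin n → Fin n → Fin n → ℝ, ∑ i, ∑ j, ∑ k, f i j k =
      ∑ q : Fin n × Fin n × Fin n, f q.1 q.2.1 q.2.2 := fun f => by
    simp only [Fintype.sum_prod_type]
  have hsplit : ∀ H, (∑ i, ∑ j, ∑ k,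
      if j = k then 0 else a i j k * (noiseMatrix p H i j * noiseMatrix p H i k)) =
      ∑ q ∈ s1, a q.1 q.2.1 q.2.2 * ∏ e ∈ pathEdges q, edgeNoise p H e +
      ∑ q ∈ s2, a q.1 q.2.1 q.2.2 * ∏ e ∈ pathEdges q, edgeNoise p H e := fun H => by
    rw [← Finset.sum_union hdisj, hsum]
    symm
    rw [← Finset.sum_subset (Finset.subset_univ (s1 ∪ s2))]
    · refine Finset.sum_congr rfl fun q hq => ?_
      obtain ⟨i, j, k⟩ := q
      simp only [hs1, hs2, Finset.mem_union, Finset.mem_filter, Finset.mem_univ, true_and] at hq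
      have hjk : j ≠ k := by
        rcases hq with h | h
        exacts [h.1.ne, h.1.ne']
      have hij : i ≠ j := by tauto
      have hik : i ≠ k := by tauto
      have hne : s(i, j) ≠ s(i, k) := by
        simp only [ne_eq, Sym2.eq_iff]; grind
      simp [pathEdges, hjk, noiseMatrix_apply, hij, hik, Finset.prod_pair hne]
    · rintro ⟨i, j, k⟩ _ hq
      simp only [hs1, hs2, Finset.mem_union, Finset.mem_filter, Finset.mem_univ, true_and] at hq
      simp only [noiseMatrix_apply]
      by_cases hjk : j = k
      · simp [hjk]
      · have : i = j ∨ i = k := by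
          rcases lt_or_gt_of_ne hjk with h | h <;> tauto
        rcases this with h | h <;> simp [h]
  simp_rw [hsplit]
  refine (graphMean_sq_add_le hp _ _).trans ?_
  rw [← mul_add]
  refine mul_le_mul_of_nonneg_left ?_ zero_le_two
  have h1 := graphMean_sq_sum_le hp (s := s1) (S := pathEdges) (fun q hq r hr h => by
    simp only [hs1, Finset.coe_filter, Finset.mem_univ, true_and, Set.mem_ofPred_eq] at hq hr
    exact pathEdges_inj hq.1 hr.1 hq.2.1 hq.2.2 hr.2.1 hr.2.2 h) (fun q hq => by
    simp only [hs1, Finset.mem_filter, Finset.mem_univ, true_and] at hq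
    simp [pathEdges, Finset.insert_subset_iff, mem_possibleEdges, hq.2])
    (fun q => a q.1 q.2.1 q.2.2)
  have h2 := graphMean_sq_sum_le hp (s := s2) (S := pathEdges) (fun q hq r hr h => by
    simp only [hs2, Finset.coe_filter, Finset.mem_univ, true_and, Set.mem_ofPred_eq] at hq hr
    have h' : pathEdges (q.1, q.2.2, q.2.1) = pathEdges (r.1, r.2.2, r.2.1) := by
      simpa only [pathEdges, Finset.pair_comm] using h
    have := pathEdges_inj hq.1 hr.1 hq.2.2 hq.2.1 hr.2.2 hr.2.1 h'
    simp only [Prod.mk.injEq] at this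
    exact Prod.ext this.1 (Prod.ext this.2.2 this.2.1)) (fun q hq => by
    simp only [hs2, Finset.mem_filter, Finset.mem_univ, true_and] at hq
    simp [pathEdges, Finset.insert_subset_iff, mem_possibleEdges, hq.2])
    (fun q => a q.1 q.2.1 q.2.2)
  refine (add_le_add h1 h2).trans ?_
  rw [← Finset.sum_union hdisj, hsum]
  exact Finset.sum_le_sum_of_subset_of_nonneg (Finset.subset_univ _) fun _ _ _ => sq_nonneg _

end NoiseMatrix

section NoiseMoments

variable {n : ℕ} {p : Sym2 (Fin n) → ℝ}

/-- `∑ᵢ (∑ⱼ Nᵢⱼ vⱼ)²`, the squared length of the image of `v` under the noise matrix. -/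
def noiseImageSq (p : Sym2 (Fin n) → ℝ) (v : Fin n → ℝ) (H : SimpleGraph (Fin n)) : ℝ :=
  ∑ i, (∑ j, noiseMatrix p H i j * v j) ^ 2

/-- The expectation of `noiseImageSq`. -/
def noiseImageMean (p : Sym2 (Fin n) → ℝ) (v : Fin n → ℝ) : ℝ :=
  ∑ i, ∑ j, if i = j then 0 else p s(i, j) * (1 - p s(i, j)) * v j ^ 2

theorem graphMean_sq_quadraticForm_le (hp : ∀ e, p e ∈ Set.Icc (0 : ℝ) 1) {v : Fin n → ℝ}
    (hv : ∑ i, v i ^ 2 = 1) :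
    graphMean p (fun H => (∑ i, ∑ j, v i * v j * noiseMatrix p H i j) ^ 2) ≤ 2 := by
  refine (graphMean_sq_linear_le hp fun i j => v i * v j).trans_eq ?_
  simp only [mul_pow]
  rw [← Finset.sum_mul_sum, hv]; norm_num

/-- Each coordinate of `M N v` is one linear form in the noise with coefficients `M k i * v j`, of
total square at most `n`. The resulting order `n²` is a factor `n` better than multiplying the
Hilbert-Schmidt bound for `M` by the mean of `‖N v‖²`. -/
theorem graphMean_mul_noise_sq_le (hp : ∀ e, p e ∈ Set.Icc (0 : ℝ) 1) {v : Fin n → ℝ}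
    (hv : ∑ i, v i ^ 2 = 1) {M : Matrix (Fin n) (Fin n) ℝ} (hM : ∀ i j, M i j ^ 2 ≤ 1) :
    graphMean p (fun H => ∑ k, (∑ i, M k i * ∑ j, noiseMatrix p H i j * v j) ^ 2) ≤
      2 * (n : ℝ) ^ 2 := by
  rw [graphMean_sum]
  have h : ∀ k, graphMean p (fun H => (∑ i, M k i * ∑ j, noiseMatrix p H i j * v j) ^ 2) ≤
      2 * n := fun k => by
    have h1 := graphMean_sq_linear_le hp fun i j => M k i * v j
    have h2 : (fun H => (∑ i, M k i * ∑ j, noiseMatrix p H i j * v j) ^ 2) =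
        fun H => (∑ i, ∑ j, M k i * v j * noiseMatrix p H i j) ^ 2 := by
      ext H
      congr 1
      refine Finset.sum_congr rfl fun i _ => ?_
      rw [Finset.mul_sum]
      exact Finset.sum_congr rfl fun j _ => by ring
    rw [h2]
    refine h1.trans ?_
    simp only [mul_pow]
    rw [← Finset.sum_mul_sum, hv, mul_one]
    have : ∑ i, M k i ^ 2 ≤ ∑ _i : Fin n, (1 : ℝ) := Finset.sum_le_sum fun i _ => hM k i
    simp at this
    linarith
  refine (Finset.sum_le_sum fun k _ => h k).trans_eq ?_
  simp; ring

/-- The expected squared Hilbert-Schmidt norm of the square of the noise matrix. -/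
theorem graphMean_noise_sq_sq_le (hp : ∀ e, p e ∈ Set.Icc (0 : ℝ) 1) :
    graphMean p (fun H => ∑ i, ∑ k, (∑ j, noiseMatrix p H i j * noiseMatrix p H j k) ^ 2) ≤
      3 * (n : ℝ) ^ 3 := by
  rw [graphMean_sum]
  -- The `n` diagonal entries do not cancel and cost `n²` each; the at most `n²` off-diagonal ones
  -- cost only `2n` each by orthogonality. Both parts are of order `n³`, so the operator norm of the
  -- noise is `O(n^{3/4})` in probability, which is enough here.
  have hdiag : ∀ i, graphMean p (fun H =>
      (∑ j, noiseMatrix p H i j * noiseMatrix p H j i) ^ 2) ≤ (n : ℝ) ^ 2 := fun i => by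
    rw [← graphMean_const (p := p) ((n : ℝ) ^ 2)]
    refine graphMean_mono hp fun H => ?_
    have h1 : ∀ j, |noiseMatrix p H i j * noiseMatrix p H j i| ≤ 1 := fun j => by
      have h : ∀ i j, |noiseMatrix p H i j| ≤ 1 := fun i j => by
        rw [noiseMatrix_apply]
        split_ifs
        · simp
        · exact abs_edgeNoise_le_one hp H _
      rw [abs_mul]
      exact mul_le_one₀ (h _ _) (abs_nonneg _) (h _ _)
    have h2 : |∑ j, noiseMatrix p H i j * noiseMatrix p H j i| ≤ n := by
      refine (Finset.abs_sum_le_sum_abs _ _).trans ((Finset.sum_le_sum fun j _ => h1 j).trans_eq ?_)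
      simp
    rw [← sq_abs]
    gcongr
  have hoff : ∀ i k, i ≠ k → graphMean p (fun H =>
      (∑ j, noiseMatrix p H i j * noiseMatrix p H j k) ^ 2) ≤ 2 * n := fun i k hik => by
    -- The indicator selects the paths with ends `i` and `k`; the summation index `j` of the matrix
    -- product becomes their centre.
    have h1 := graphMean_sq_path_le hp fun (_ j l : Fin n) => if j = i ∧ l = k then (1 : ℝ) else 0
    have h2 : ∀ H c, (∑ j, ∑ l, if j = l then 0 else (if j = i ∧ l = k then (1 : ℝ) else 0) *
        (noiseMatrix p H c j * noiseMatrix p H c l)) =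
        noiseMatrix p H i c * noiseMatrix p H c k := fun H c => by
      rw [Finset.sum_eq_single i, Finset.sum_eq_single k]
      · simp [hik, noiseMatrix_symm H i c]
      · intro l _ hl; simp [hl]
      · simp
      · intro j _ hj
        exact Finset.sum_eq_zero fun l _ => by simp [hj]
      · simp
    simp_rw [h2] at h1
    refine h1.trans_eq ?_
    congr 1
    have h3 : ∀ j l : Fin n, (if j = i ∧ l = k then (1 : ℝ) else 0) ^ 2 =
        if j = i then (if l = k then 1 else 0) else 0 := fun j l => by
      split_ifs <;> simp_all
    simp [h3]
  have hrow : ∀ i, graphMean p (fun H => ∑ k,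
      (∑ j, noiseMatrix p H i j * noiseMatrix p H j k) ^ 2) ≤ 3 * (n : ℝ) ^ 2 := fun i => by
    rw [graphMean_sum, ← Finset.add_sum_erase _ _ (Finset.mem_univ i)]
    have h : ∑ k ∈ Finset.univ.erase i, graphMean p (fun H =>
        (∑ j, noiseMatrix p H i j * noiseMatrix p H j k) ^ 2) ≤
        ∑ _k ∈ Finset.univ.erase i, 2 * (n : ℝ) :=
      Finset.sum_le_sum fun k hk => hoff i k (Finset.ne_of_mem_erase hk).symm
    have h' : ∑ _k ∈ Finset.univ.erase i, 2 * (n : ℝ) ≤ ∑ _k : Fin n, 2 * (n : ℝ) :=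
      Finset.sum_le_sum_of_subset_of_nonneg (Finset.erase_subset _ _) fun _ _ _ => by positivity
    have h'' : ∑ _k : Fin n, 2 * (n : ℝ) = 2 * (n : ℝ) ^ 2 := by simp; ring
    linarith [hdiag i]
  refine (Finset.sum_le_sum fun i _ => hrow i).trans_eq ?_
  simp; ring

/-- The squared length of the image of a fixed unit vector under the noise matrix concentrates. -/
theorem graphMean_noiseImageSq_sub_le (hp : ∀ e, p e ∈ Set.Icc (0 : ℝ) 1) {v : Fin n → ℝ}
    (hv : ∑ i, v i ^ 2 = 1) :
    graphMean p (fun H => (noiseImageSq p v H - noiseImageMean p v) ^ 2) ≤ 8 * n := by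
  -- Expand the inner square: the terms `j = k` become centred linear ones through `edgeNoise_sq`,
  -- and the terms `j ≠ k` form a sum over paths.
  have hsplit : ∀ H, noiseImageSq p v H - noiseImageMean p v =
      (∑ i, ∑ j, (1 - 2 * p s(i, j)) * v j ^ 2 * noiseMatrix p H i j) +
      ∑ i, ∑ j, ∑ k, if j = k then 0 else v j * v k * (noiseMatrix p H i j * noiseMatrix p H i k) :=
    fun H => by
    unfold noiseImageSq noiseImageMean
    rw [← Finset.sum_sub_distrib, ← Finset.sum_add_distrib]
    refine Finset.sum_congr rfl fun i _ => ?_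
    rw [sq, Finset.sum_mul_sum, ← Finset.sum_sub_distrib, ← Finset.sum_add_distrib]
    refine Finset.sum_congr rfl fun j _ => ?_
    rw [← Finset.add_sum_erase _ _ (Finset.mem_univ j),
      ← Finset.add_sum_erase (a := j) _ (fun k => if j = k then 0 else _) (Finset.mem_univ j)]
    have h1 : ∑ k ∈ Finset.univ.erase j, noiseMatrix p H i j * v j * (noiseMatrix p H i k * v k) =
        ∑ k ∈ Finset.univ.erase j,
          if j = k then 0 else v j * v k * (noiseMatrix p H i j * noiseMatrix p H i k) :=
      Finset.sum_congr rfl fun k hk => by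
        rw [if_neg (Finset.ne_of_mem_erase hk).symm]; ring
    rw [h1, if_pos rfl, noiseMatrix_apply]
    split_ifs with hij
    · simp
    · linear_combination (v j ^ 2) * edgeNoise_sq (p := p) H s(i, j)
  simp_rw [hsplit]
  refine (graphMean_sq_add_le hp _ _).trans ?_
  have h1 := graphMean_sq_linear_le hp fun i j => (1 - 2 * p s(i, j)) * v j ^ 2
  have h2 := graphMean_sq_path_le hp fun (_ j k : Fin n) => v j * v k
  have hvle : ∀ j, v j ^ 2 ≤ 1 := fun j => by
    rw [← hv]
    exact Finset.single_le_sum (f := fun j => v j ^ 2) (fun _ _ => sq_nonneg _) (Finset.mem_univ j)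
  have h3 : ∑ i, ∑ j, ((1 - 2 * p s(i, j)) * v j ^ 2) ^ 2 ≤ (n : ℝ) := by
    have : ∀ i, ∑ j, ((1 - 2 * p s(i, j)) * v j ^ 2) ^ 2 ≤ 1 := fun i => by
      refine le_of_le_of_eq (Finset.sum_le_sum fun j _ => ?_) hv
      have a1 : (1 - 2 * p s(i, j)) ^ 2 ≤ 1 := by
        have := hp s(i, j)
        nlinarith [this.1, this.2]
      rw [mul_pow]
      nlinarith [sq_nonneg (v j), hvle j, mul_nonneg (sq_nonneg (v j)) (sq_nonneg (v j))]
    refine (Finset.sum_le_sum fun i _ => this i).trans_eq (by simp)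
  have h4 : ∑ _i : Fin n, ∑ j, ∑ k, (v j * v k) ^ 2 = (n : ℝ) := by
    simp only [mul_pow]
    rw [← Finset.sum_mul_sum, hv]; simp
  rw [h4] at h2
  linarith

end NoiseMoments

/-! ### Lindeberg comparison of characteristic functions. -/

/-- Replace the factors one at a time; the other factors of each telescoping term have norm at most
`1`. -/
theorem norm_prod_sub_prod_le_sum {ι : Type*} (s : Finset ι) (a b : ι → ℂ)
    (ha : ∀ i ∈ s, ‖a i‖ ≤ 1) (hb : ∀ i ∈ s, ‖b i‖ ≤ 1) :
    ‖∏ i ∈ s, a i - ∏ i ∈ s, b i‖ ≤ ∑ i ∈ s, ‖a i - b i‖ := by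
  classical
  induction s using Finset.induction_on with
  | empty => simp
  | insert i s hi ih =>
    rw [Finset.prod_insert hi, Finset.prod_insert hi, Finset.sum_insert hi]
    have ih' := ih (fun j hj => ha j (Finset.mem_insert_of_mem hj))
      (fun j hj => hb j (Finset.mem_insert_of_mem hj))
    have hbs : ‖∏ j ∈ s, b j‖ ≤ 1 := by
      rw [norm_prod]
      exact Finset.prod_le_one (fun _ _ => norm_nonneg _)
        fun j hj => hb j (Finset.mem_insert_of_mem hj)
    calc ‖a i * ∏ j ∈ s, a j - b i * ∏ j ∈ s, b j‖
        = ‖a i * (∏ j ∈ s, a j - ∏ j ∈ s, b j) + (a i - b i) * ∏ j ∈ s, b j‖ := by ring_nf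
      _ ≤ ‖a i‖ * ‖∏ j ∈ s, a j - ∏ j ∈ s, b j‖ + ‖a i - b i‖ * ‖∏ j ∈ s, b j‖ := by
          rw [← norm_mul, ← norm_mul]; exact norm_add_le _ _
      _ ≤ 1 * ∑ j ∈ s, ‖a j - b j‖ + ‖a i - b i‖ * 1 := by
          gcongr
          exact ha i (Finset.mem_insert_self _ _)
      _ = _ := by ring

theorem norm_cexp_mul_I_sub_taylor_le {x : ℝ} (hx : |x| ≤ 1) :
    ‖Complex.exp (x * Complex.I) - (1 + x * Complex.I - (x : ℂ) ^ 2 / 2)‖ ≤ |x| ^ 3 := by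
  have hn : ‖(x * Complex.I : ℂ)‖ = |x| := by simp
  have h := Complex.exp_bound (x := x * Complex.I) (by rw [hn]; exact hx) (n := 3) (by norm_num)
  rw [hn] at h
  have h2 : ∑ m ∈ Finset.range 3, (x * Complex.I : ℂ) ^ m / (m.factorial : ℂ) =
      1 + x * Complex.I - (x : ℂ) ^ 2 / 2 := by
    simp [Finset.sum_range_succ, mul_pow, Nat.factorial]
    ring
  rw [h2] at h
  refine h.trans (mul_le_of_le_one_right (by positivity) ?_)
  norm_num [Nat.factorial]

/-- The characteristic function of a centred Bernoulli variable is close to the Gaussian one. -/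
theorem norm_bernoulli_charFun_sub_le {q x : ℝ} (hq : q ∈ Set.Icc (0 : ℝ) 1) (hx : |x| ≤ 1) :
    ‖(q * Complex.exp (((x * (1 - q) : ℝ) : ℂ) * Complex.I) +
      (1 - q) * Complex.exp (((x * (0 - q) : ℝ) : ℂ) * Complex.I)) -
      (Real.exp (-(x ^ 2 * (q * (1 - q)) / 2)) : ℂ)‖ ≤ 2 * |x| ^ 3 := by
  obtain ⟨hq0, hq1⟩ := hq
  have a1 : |x * (1 - q)| ≤ |x| := by
    rw [abs_mul]
    exact mul_le_of_le_one_right (abs_nonneg _) (abs_le.2 ⟨by linarith, by linarith⟩)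
  have a2 : |x * (0 - q)| ≤ |x| := by
    rw [abs_mul]
    exact mul_le_of_le_one_right (abs_nonneg _) (abs_le.2 ⟨by linarith, by linarith⟩)
  have h1 := norm_cexp_mul_I_sub_taylor_le (a1.trans hx)
  have h2 := norm_cexp_mul_I_sub_taylor_le (a2.trans hx)
  have h1' : |x * (1 - q)| ^ 3 ≤ |x| ^ 3 := by gcongr
  have h2' : |x * (0 - q)| ^ 3 ≤ |x| ^ 3 := by gcongr
  set s := q * (1 - q) with hs
  have hs0 : 0 ≤ s := mul_nonneg hq0 (by linarith)
  have hs1 : s ≤ 1 := by nlinarith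
  have hx2 : x ^ 2 = |x| ^ 2 := (sq_abs x).symm
  have h3 : |Real.exp (-(x ^ 2 * s / 2)) - 1 - (-(x ^ 2 * s / 2))| ≤ |x| ^ 3 := by
    have hb : |-(x ^ 2 * s / 2)| ≤ |x| ^ 2 := by
      rw [abs_neg, abs_of_nonneg (by positivity), hx2]
      nlinarith [sq_nonneg |x|]
    refine (Real.abs_exp_sub_one_sub_id_le (hb.trans (pow_le_one₀ (abs_nonneg _) hx))).trans ?_
    rw [← sq_abs]
    calc |-(x ^ 2 * s / 2)| ^ 2 ≤ (|x| ^ 2) ^ 2 := by gcongr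
      _ = |x| ^ 3 * |x| := by ring
      _ ≤ |x| ^ 3 := mul_le_of_le_one_right (by positivity) hx
  have h3' : ‖(Real.exp (-(x ^ 2 * s / 2)) : ℂ) - 1 - (-((x : ℂ) ^ 2 * s / 2))‖ ≤ |x| ^ 3 := by
    rw [← Real.norm_eq_abs, ← Complex.norm_real] at h3
    exact_mod_cast h3
  have hsc : (s : ℂ) = q * (1 - q) := by rw [hs]; push_cast; ring
  set E1 := Complex.exp (((x * (1 - q) : ℝ) : ℂ) * Complex.I)
  set E2 := Complex.exp (((x * (0 - q) : ℝ) : ℂ) * Complex.I)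
  set E3 := (Real.exp (-(x ^ 2 * s / 2)) : ℂ)
  set D1 := E1 - (1 + ((x * (1 - q) : ℝ) : ℂ) * Complex.I - ((x * (1 - q) : ℝ) : ℂ) ^ 2 / 2)
    with hD1
  set D2 := E2 - (1 + ((x * (0 - q) : ℝ) : ℂ) * Complex.I - ((x * (0 - q) : ℝ) : ℂ) ^ 2 / 2)
    with hD2
  set D3 := E3 - 1 - (-((x : ℂ) ^ 2 * s / 2)) with hD3
  -- The linear Taylor terms cancel because the variable is centred, and the quadratic ones combine
  -- to `-x² q (1 - q) / 2`, matching the Gaussian; only third order remainders are left.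
  have hid : (q * E1 + (1 - q) * E2) - E3 = q * D1 + (1 - q) * D2 - D3 := by
    rw [hD1, hD2, hD3, hsc]
    push_cast
    ring
  rw [hid]
  have hn1 : ‖(q : ℂ) * D1‖ ≤ q * |x| ^ 3 := by
    rw [norm_mul, Complex.norm_real, Real.norm_eq_abs, abs_of_nonneg hq0]
    exact mul_le_mul_of_nonneg_left (h1.trans h1') hq0
  have hn2 : ‖(1 - q : ℂ) * D2‖ ≤ (1 - q) * |x| ^ 3 := by
    rw [norm_mul, show (1 - q : ℂ) = ((1 - q : ℝ) : ℂ) by push_cast; ring, Complex.norm_real,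
      Real.norm_eq_abs, abs_of_nonneg (by linarith)]
    exact mul_le_mul_of_nonneg_left (h2.trans h2') (by linarith)
  calc ‖q * D1 + (1 - q) * D2 - D3‖ ≤ ‖q * D1‖ + ‖(1 - q) * D2‖ + ‖D3‖ :=
        (norm_sub_le _ _).trans (by gcongr; exact norm_add_le _ _)
    _ ≤ q * |x| ^ 3 + (1 - q) * |x| ^ 3 + |x| ^ 3 := by gcongr
    _ = 2 * |x| ^ 3 := by ring

section

variable {n : ℕ} {p : Sym2 (Fin n) → ℝ}

theorem sum_possibleEdges {M : Type*} [AddCommMonoid M] (f : Sym2 (Fin n) → M) :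
    ∑ e ∈ possibleEdges (Fin n), f e = ∑ i, ∑ j ∈ Finset.Ioi i, f s(i, j) := by
  have h := Finset.sum_sym2_filter_not_isDiag (Finset.univ : Finset (Fin n)) f
  rw [Finset.sym2_univ] at h
  have h1 : ∀ i : Fin n, ∑ j ∈ Finset.Ioi i, f s(i, j) = ∑ j, if i < j then f s(i, j) else 0 :=
    fun i => by
    rw [← Finset.sum_filter]
    refine Finset.sum_congr ?_ fun _ _ => rfl
    ext j; simp
  simp_rw [h1]
  rw [possibleEdges, ← Finset.sum_product', Finset.univ_product_univ, ← Finset.sum_filter]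
  refine Eq.trans ?_ (h.trans ?_)
  · exact Finset.sum_congr (Finset.filter_congr_decidable ..) fun _ _ => rfl
  · refine Finset.sum_congr ?_ fun _ _ => rfl
    ext q; simp; exact fun h => h.ne

theorem prod_possibleEdges {M : Type*} [CommMonoid M] (f : Sym2 (Fin n) → M) :
    ∏ e ∈ possibleEdges (Fin n), f e = ∏ i, ∏ j ∈ Finset.Ioi i, f s(i, j) :=
  sum_possibleEdges (M := Additive M) f

theorem sum_sum_ne_eq_two_mul_sum_possibleEdges (f : Sym2 (Fin n) → ℝ) :
    ∑ i, ∑ j, (if i = j then 0 else f s(i, j)) = 2 * ∑ e ∈ possibleEdges (Fin n), f e := by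
  have h1 : ∑ e ∈ possibleEdges (Fin n), f e =
      ∑ i, ∑ j, if i < j then f s(i, j) else 0 := by
    rw [sum_possibleEdges]
    refine Finset.sum_congr rfl fun i _ => ?_
    rw [← Finset.sum_filter]
    refine Finset.sum_congr ?_ fun _ _ => rfl
    ext j; simp
  have h2 : ∑ i, ∑ j, (if i < j then f s(i, j) else 0) =
      ∑ i, ∑ j, if j < i then f s(i, j) else 0 := by
    rw [Finset.sum_comm]
    refine Finset.sum_congr rfl fun i _ => Finset.sum_congr rfl fun j _ => ?_
    rw [Sym2.eq_swap]
  rw [two_mul]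
  nth_rw 2 [h1]
  rw [h1, h2]
  nth_rw 1 [← h2]
  rw [← Finset.sum_add_distrib]
  refine Finset.sum_congr rfl fun i _ => ?_
  rw [← Finset.sum_add_distrib]
  refine Finset.sum_congr rfl fun j _ => ?_
  rcases lt_trichotomy i j with h | h | h
  · simp [h, h.ne, h.asymm]
  · simp [h]
  · simp [h, h.ne', h.asymm]

/-- The variance of the quadratic form `∑ vᵢ vⱼ Nᵢⱼ`. -/
def quadraticFormVariance (p : Sym2 (Fin n) → ℝ) (v : Fin n → ℝ) : ℝ :=
  2 * ∑ i, ∑ j, if i = j then 0 else v i ^ 2 * v j ^ 2 * (p s(i, j) * (1 - p s(i, j)))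

/-- The coefficients of the quadratic form `∑ vᵢ vⱼ Nᵢⱼ` as a linear form in the edges. -/
def edgeCoeff (v : Fin n → ℝ) : Sym2 (Fin n) → ℝ :=
  Sym2.lift ⟨fun i j => 2 * (v i * v j), fun i j => by ring⟩

theorem sum_mul_noiseMatrix_eq (v : Fin n → ℝ) (H : SimpleGraph (Fin n)) :
    ∑ i, ∑ j, v i * v j * noiseMatrix p H i j =
      ∑ e ∈ possibleEdges (Fin n), edgeCoeff v e * edgeNoise p H e := by
  have h := sum_sum_ne_eq_two_mul_sum_possibleEdges
    fun e => edgeCoeff v e * edgeNoise p H e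
  have h2 : ∑ i, ∑ j, v i * v j * noiseMatrix p H i j = (1 / 2) * ∑ i, ∑ j,
      (if i = j then 0 else edgeCoeff v s(i, j) * edgeNoise p H s(i, j)) := by
    rw [Finset.mul_sum]
    refine Finset.sum_congr rfl fun i _ => ?_
    rw [Finset.mul_sum]
    refine Finset.sum_congr rfl fun j _ => ?_
    rw [noiseMatrix_apply]
    split_ifs
    · simp
    · simp [edgeCoeff]; ring
  rw [h2, h]; ring

theorem quadraticFormVariance_eq (v : Fin n → ℝ) :
    quadraticFormVariance p v =
      ∑ e ∈ possibleEdges (Fin n), edgeCoeff v e ^ 2 * (p e * (1 - p e)) := by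
  have h := sum_sum_ne_eq_two_mul_sum_possibleEdges
    fun e => edgeCoeff v e ^ 2 * (p e * (1 - p e))
  have h2 : quadraticFormVariance p v = (1 / 2) * ∑ i, ∑ j,
      (if i = j then 0 else edgeCoeff v s(i, j) ^ 2 * (p s(i, j) * (1 - p s(i, j)))) := by
    rw [quadraticFormVariance, Finset.mul_sum, Finset.mul_sum]
    refine Finset.sum_congr rfl fun i _ => ?_
    rw [Finset.mul_sum, Finset.mul_sum]
    refine Finset.sum_congr rfl fun j _ => ?_
    split_ifs
    · simp
    · simp [edgeCoeff]; ring
  rw [h2, h]; ring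

/-- The sum runs over unordered pairs, hence is half of an off-diagonal double sum bounded by `4 (∑
v_i²)² = 4`. -/
theorem sum_edgeCoeff_sq_le {v : Fin n → ℝ} (hv : ∑ i, v i ^ 2 = 1) :
    ∑ e ∈ possibleEdges (Fin n), edgeCoeff v e ^ 2 ≤ 2 := by
  have h := sum_sum_ne_eq_two_mul_sum_possibleEdges fun e => edgeCoeff v e ^ 2
  have h2 : ∑ i, ∑ j, (if i = j then 0 else edgeCoeff v s(i, j) ^ 2) ≤
      ∑ i, ∑ j, 4 * (v i ^ 2 * v j ^ 2) := by
    refine Finset.sum_le_sum fun i _ => Finset.sum_le_sum fun j _ => ?_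
    split_ifs
    · positivity
    · simp [edgeCoeff]; apply le_of_eq; ring
  have h3 : ∑ i, ∑ j, 4 * (v i ^ 2 * v j ^ 2) = 4 := by
    simp only [← Finset.mul_sum, hv]; norm_num
    simpa using hv
  linarith

/-- Lindeberg-type bound for the characteristic function of the quadratic form. -/
theorem norm_quadraticForm_charFun_sub_le (hp : ∀ e, p e ∈ Set.Icc (0 : ℝ) 1) {v : Fin n → ℝ}
    (hv : ∑ i, v i ^ 2 = 1) {b t : ℝ} (hb : ∀ i j, |t| * |2 * (v i * v j)| ≤ b) (hb1 : b ≤ 1) :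
    ‖∑ H, (bernoulliWeight p H : ℂ) *
        Complex.exp (((t * ∑ i, ∑ j, v i * v j * noiseMatrix p H i j : ℝ) : ℂ) * Complex.I) -
      (Real.exp (-(t ^ 2 * quadraticFormVariance p v / 2)) : ℂ)‖ ≤ 4 * b * t ^ 2 := by
  classical
  have hce : ∀ e, |t * edgeCoeff v e| ≤ b := fun e => by
    rw [abs_mul]
    induction e with
    | _ i j => simpa [edgeCoeff] using hb i j
  have h1 : ∑ H, (bernoulliWeight p H : ℂ) *
      Complex.exp (((t * ∑ i, ∑ j, v i * v j * noiseMatrix p H i j : ℝ) : ℂ) * Complex.I) =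
      ∏ e ∈ possibleEdges (Fin n),
        (p e * Complex.exp (((t * edgeCoeff v e * (1 - p e) : ℝ) : ℂ) * Complex.I) +
        (1 - p e) * Complex.exp (((t * edgeCoeff v e * (0 - p e) : ℝ) : ℂ) * Complex.I)) := by
    rw [← sum_simpleGraph_prod]
    refine Finset.sum_congr rfl fun H _ => ?_
    rw [sum_mul_noiseMatrix_eq, bernoulliWeight, Finset.mul_sum]
    push_cast
    rw [Finset.sum_mul, Complex.exp_sum, ← Finset.prod_mul_distrib]
    refine Finset.prod_congr rfl fun e _ => ?_
    unfold edgeNoise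
    split_ifs
    · push_cast; ring_nf
    · push_cast; ring_nf
  have h2 : (Real.exp (-(t ^ 2 * quadraticFormVariance p v / 2)) : ℂ) =
      ∏ e ∈ possibleEdges (Fin n),
        (Real.exp (-((t * edgeCoeff v e) ^ 2 * (p e * (1 - p e)) / 2)) : ℂ) := by
    rw [← Complex.ofReal_prod, ← Real.exp_sum, quadraticFormVariance_eq]
    congr 2
    rw [Finset.sum_neg_distrib, ← Finset.sum_div, Finset.mul_sum]
    congr 2
    exact Finset.sum_congr rfl fun e _ => by ring
  rw [h1, h2]
  refine (norm_prod_sub_prod_le_sum _ _ _ (fun e _ => ?_) fun e _ => ?_).trans ?_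
  · refine (norm_add_le _ _).trans ?_
    rw [norm_mul, norm_mul, Complex.norm_exp_ofReal_mul_I, Complex.norm_exp_ofReal_mul_I,
      show (1 - p e : ℂ) = ((1 - p e : ℝ) : ℂ) by push_cast; ring, Complex.norm_real,
      Complex.norm_real, Real.norm_eq_abs, Real.norm_eq_abs, abs_of_nonneg (hp e).1,
      abs_of_nonneg (by linarith [(hp e).2])]
    linarith
  · rw [Complex.norm_real, Real.norm_eq_abs, abs_of_pos (Real.exp_pos _), Real.exp_le_one_iff]
    have := mul_nonneg (hp e).1 (sub_nonneg.2 (hp e).2)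
    have := mul_nonneg (sq_nonneg (t * edgeCoeff v e)) this
    linarith
  -- In each cubic error one factor is at most `b`, and the other two sum to at most `2 t²`;
  -- together with the prefactor `2` this gives `4 b t²`.
  · have h3 : ∀ e ∈ possibleEdges (Fin n), _ ≤ 2 * b * t ^ 2 * edgeCoeff v e ^ 2 := fun e _ =>
      (norm_bernoulli_charFun_sub_le (hp e) ((hce e).trans hb1)).trans (by
        have : |t * edgeCoeff v e| ^ 3 = |t * edgeCoeff v e| * (t ^ 2 * edgeCoeff v e ^ 2) := by
          rw [pow_succ', sq_abs]; ring
        rw [this]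
        nlinarith [mul_le_mul_of_nonneg_right (hce e)
          (by positivity : 0 ≤ t ^ 2 * edgeCoeff v e ^ 2)])
    refine (Finset.sum_le_sum h3).trans ?_
    rw [← Finset.mul_sum]
    rcases isEmpty_or_nonempty (Fin n) with hn | ⟨⟨i⟩⟩
    · simp at hv
    · have hb0 : 0 ≤ b := (by positivity : 0 ≤ |t| * |2 * (v i * v i)|).trans (hb i i)
      nlinarith [mul_le_mul_of_nonneg_left (sum_edgeCoeff_sq_le hv)
        (by positivity : 0 ≤ 2 * b * t ^ 2)]

end

/-! ### Expansion of the eigenvalue difference at a fixed size. -/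

section Graphon

variable {n : ℕ}

/-- The edge probabilities of the `W`-random graph. -/
def Graphon.edgeProb (W : Graphon) (x : Fin n → I) : Sym2 (Fin n) → ℝ :=
  Sym2.lift ⟨fun i j => W (x i) (x j), fun _ _ => W.symm' _ _⟩

theorem Graphon.edgeProb_mk (W : Graphon) (x : Fin n → I) (i j : Fin n) :
    W.edgeProb x s(i, j) = W (x i) (x j) := rfl

theorem Graphon.edgeProb_mem (W : Graphon) (x : Fin n → I) (e : Sym2 (Fin n)) :
    W.edgeProb x e ∈ Set.Icc (0 : ℝ) 1 := by
  induction e with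
  | _ i j => exact ⟨W.nonneg' _ _, W.le_one' _ _⟩

theorem Graphon.graphProb_eq (W : Graphon) (x : Fin n → I) (H : SimpleGraph (Fin n)) :
    W.graphProb x H = bernoulliWeight (W.edgeProb x) H := by
  rw [bernoulliWeight, prod_possibleEdges]
  rfl

theorem adjacencyMatrix_eq_add (W : Graphon) (x : Fin n → I) (H : SimpleGraph (Fin n)) :
    adjacencyMatrix H = W.connectivityMatrix x + noiseMatrix (W.edgeProb x) H := by
  ext i j
  rw [Matrix.add_apply, noiseMatrix_apply, adjacencyMatrix, SimpleGraph.adjMatrix_apply]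
  simp only [Graphon.connectivityMatrix, Matrix.of_apply, edgeNoise, Graphon.edgeProb_mk,
    SimpleGraph.mem_edgeSet]
  by_cases h : i = j
  · subst h; simp
  · by_cases hA : H.Adj i j <;> simp [h, hA]

end Graphon

section EuclideanMatrix

variable {n : ℕ}

theorem toEuclideanLin_coord (M : Matrix (Fin n) (Fin n) ℝ) (y : EuclideanSpace ℝ (Fin n))
    (i : Fin n) : M.toEuclideanLin y i = ∑ j, M i j * y j := by
  simp [Matrix.toLpLin_apply, Matrix.mulVec, dotProduct]

theorem norm_sq_toEuclideanLin (M : Matrix (Fin n) (Fin n) ℝ) (y : EuclideanSpace ℝ (Fin n)) :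
    ‖M.toEuclideanLin y‖ ^ 2 = ∑ i, (∑ j, M i j * y j) ^ 2 := by
  simp only [EuclideanSpace.real_norm_sq_eq, toEuclideanLin_coord]

theorem inner_toEuclideanLin (M : Matrix (Fin n) (Fin n) ℝ) (y z : EuclideanSpace ℝ (Fin n)) :
    inner ℝ y (M.toEuclideanLin z) = ∑ i, ∑ j, y i * z j * M i j := by
  rw [PiLp.inner_apply]
  refine Finset.sum_congr rfl fun i _ => ?_
  rw [toEuclideanLin_coord]
  simp only [RCLike.inner_apply, conj_trivial, Finset.sum_mul]
  exact Finset.sum_congr rfl fun j _ => by ring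

theorem norm_sq_toEuclideanLin_le (M : Matrix (Fin n) (Fin n) ℝ) (y : EuclideanSpace ℝ (Fin n)) :
    ‖M.toEuclideanLin y‖ ^ 2 ≤ (∑ i, ∑ j, M i j ^ 2) * ‖y‖ ^ 2 := by
  rw [norm_sq_toEuclideanLin, Finset.sum_mul]
  refine Finset.sum_le_sum fun i _ => ?_
  rw [EuclideanSpace.real_norm_sq_eq]
  exact Finset.sum_mul_sq_le_sq_mul_sq _ _ _

/-- The operator norm is bounded by the fourth root of the Hilbert-Schmidt norm of the square. -/
theorem norm_toEuclideanLin_le_of_sq {N : Matrix (Fin n) (Fin n) ℝ} (hN : N.IsHermitian) {c : ℝ}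
    (hc : 0 ≤ c) (h : ∑ i, ∑ k, (∑ j, N i j * N j k) ^ 2 ≤ c ^ 4)
    (y : EuclideanSpace ℝ (Fin n)) : ‖N.toEuclideanLin y‖ ≤ c * ‖y‖ := by
  have hsymm := Matrix.isSymmetric_toEuclideanLin_iff.2 hN
  have h1 : ‖N.toEuclideanLin y‖ ^ 2 ≤ ‖y‖ * ‖(N * N).toEuclideanLin y‖ := by
    rw [← real_inner_self_eq_norm_sq, hsymm]
    have : N.toEuclideanLin (N.toEuclideanLin y) = (N * N).toEuclideanLin y := by
      ext i
      simp [Matrix.toLpLin_apply]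
    rw [this]
    exact real_inner_le_norm _ _
  have h2 : ‖(N * N).toEuclideanLin y‖ ^ 2 ≤ c ^ 4 * ‖y‖ ^ 2 := by
    refine (norm_sq_toEuclideanLin_le _ _).trans (mul_le_mul_of_nonneg_right ?_ (sq_nonneg _))
    simpa only [Matrix.mul_apply] using h
  have h3 : ‖N.toEuclideanLin y‖ ^ 4 ≤ (c * ‖y‖) ^ 4 := by
    calc ‖N.toEuclideanLin y‖ ^ 4 = (‖N.toEuclideanLin y‖ ^ 2) ^ 2 := by ring
      _ ≤ (‖y‖ * ‖(N * N).toEuclideanLin y‖) ^ 2 := by gcongr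
      _ = ‖y‖ ^ 2 * ‖(N * N).toEuclideanLin y‖ ^ 2 := by ring
      _ ≤ ‖y‖ ^ 2 * (c ^ 4 * ‖y‖ ^ 2) := by gcongr
      _ = _ := by ring
  exact le_of_pow_le_pow_left₀ (by norm_num) (by positivity) h3

end EuclideanMatrix

section FixedSize

variable {n : ℕ}

theorem Graphon.isHermitian_connectivityMatrix (W : Graphon) (x : Fin n → I) :
    (W.connectivityMatrix x).IsHermitian := by
  ext i j
  simp [Graphon.connectivityMatrix, W.symm' (x i) (x j), eq_comm]

theorem isHermitian_noiseMatrix (p : Sym2 (Fin n) → ℝ) (H : SimpleGraph (Fin n)) :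
    (noiseMatrix p H).IsHermitian := by
  ext i j
  simp [noiseMatrix_symm H i j]

theorem Graphon.connectivityMatrix_sq_le (W : Graphon) (x : Fin n → I) (i j : Fin n) :
    W.connectivityMatrix x i j ^ 2 ≤ 1 := by
  rw [Graphon.connectivityMatrix, Matrix.of_apply]
  split_ifs
  · simp
  · exact pow_le_one₀ (W.nonneg' _ _) (W.le_one' _ _)

theorem noiseImageMean_le {p : Sym2 (Fin n) → ℝ} (hp : ∀ e, p e ∈ Set.Icc (0 : ℝ) 1)
    {v : Fin n → ℝ} (hv : ∑ i, v i ^ 2 = 1) : noiseImageMean p v ≤ n := by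
  have : ∀ i, (∑ j, if i = j then 0 else p s(i, j) * (1 - p s(i, j)) * v j ^ 2) ≤ 1 := fun i => by
    refine le_of_le_of_eq (Finset.sum_le_sum fun j _ => ?_) hv
    split_ifs
    · positivity
    · refine mul_le_of_le_one_left (sq_nonneg _) ?_
      have := hp s(i, j)
      nlinarith [this.1, this.2]
  refine (Finset.sum_le_sum fun i _ => this i).trans_eq (by simp)

/-- The eigenvalue difference is, up to a small error, a quadratic form in the noise plus a
constant, as soon as the noise satisfies four moment bounds. -/
theorem abs_topEigenvalue_sub_le (W : Graphon) (hn : 2 ≤ n) (x : Fin n → I)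
    {v : EuclideanSpace ℝ (Fin n)} (hv : ‖v‖ = 1) {l g κ ε : ℝ}
    (hWv : (W.connectivityMatrix x).toEuclideanLin v = l • v)
    (hgap : ∀ y, inner ℝ v y = 0 →
      inner ℝ y ((W.connectivityMatrix x).toEuclideanLin y) ≤ (l - g * n) * ‖y‖ ^ 2)
    (hg : 0 < g) (hκ : 0 < κ) (hl : κ * n ≤ l) (hε : 0 < ε) (hε1 : ε ≤ 1) (hεg : 4 * ε ≤ g)
    (hεκ : 4 * ε ≤ κ) (H : SimpleGraph (Fin n))
    (hQ : ∑ i, ∑ k, (∑ j, noiseMatrix (W.edgeProb x) H i j * noiseMatrix (W.edgeProb x) H j k) ^ 2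
      ≤ (ε * n) ^ 4)
    (hWe : ∑ k, (∑ i, W.connectivityMatrix x k i * ∑ j, noiseMatrix (W.edgeProb x) H i j * v j) ^ 2
      ≤ ε ^ 2 * n ^ 3)
    (he : (noiseImageSq (W.edgeProb x) v H - noiseImageMean (W.edgeProb x) v) ^ 2 ≤ (ε * n) ^ 2)
    (hη : (∑ i, ∑ j, v i * v j * noiseMatrix (W.edgeProb x) H i j) ^ 2 ≤ √n) :
    |topEigenvalue (adjacencyMatrix H) - l -
      (∑ i, ∑ j, v i * v j * noiseMatrix (W.edgeProb x) H i j
        + noiseImageMean (W.edgeProb x) v / l)| ≤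
      24 * ε / (κ * g) + 4 * (√(√n) + 4 / κ) / (κ * √n) + ε / κ := by
  set N := noiseMatrix (W.edgeProb x) H with hN
  set Wn := W.connectivityMatrix x with hWn
  set m := noiseImageMean (W.edgeProb x) v with hm
  set r := √(n : ℝ) with hr
  have hn0 : (0 : ℝ) < n := by positivity
  have hr0 : 0 < r := Real.sqrt_pos.2 hn0
  have hr2 : (n : ℝ) = r ^ 2 := (Real.sq_sqrt hn0.le).symm
  have hl0 : 0 < l := lt_of_lt_of_le (by positivity) hl
  have hNs := Matrix.isSymmetric_toEuclideanLin_iff.2 (isHermitian_noiseMatrix (W.edgeProb x) H)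
  have hWs := Matrix.isSymmetric_toEuclideanLin_iff.2 (W.isHermitian_connectivityMatrix x)
  have hA : (adjacencyMatrix H).toEuclideanLin = Wn.toEuclideanLin + N.toEuclideanLin := by
    rw [adjacencyMatrix_eq_add W x H, map_add]
  have hAh : (adjacencyMatrix H).IsHermitian := by
    rw [adjacencyMatrix_eq_add W x H]
    exact (W.isHermitian_connectivityMatrix x).add (isHermitian_noiseMatrix _ H)
  obtain ⟨z, hz, hAz, hmax⟩ := exists_top_eigenvector hAh hn
  set L := topEigenvalue (adjacencyMatrix H) with hL
  have hvsq : ∑ i, v i ^ 2 = 1 := by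
    rw [← EuclideanSpace.real_norm_sq_eq, hv]; norm_num
  have hop := norm_toEuclideanLin_le_of_sq (isHermitian_noiseMatrix (W.edgeProb x) H)
    (by positivity) hQ
  set e := N.toEuclideanLin v with hedef
  have heta : inner ℝ v e = ∑ i, ∑ j, v i * v j * N i j := inner_toEuclideanLin _ _ _
  have hesq : ‖e‖ ^ 2 = noiseImageSq (W.edgeProb x) v H := norm_sq_toEuclideanLin _ _
  -- The top eigenvalue of the sum dominates its Rayleigh quotient at `v`.
  have hLl : l - ε * n ≤ L := by
    have h1 := hmax v
    rw [hA, LinearMap.add_apply, hWv, inner_add_right, inner_smul_right,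
      real_inner_self_eq_norm_sq, hv] at h1
    have h2 : |inner ℝ v e| ≤ ε * n := by
      refine (abs_real_inner_le_norm _ _).trans ?_
      have := hop v
      rw [hv] at this ⊢
      linarith
    have := (abs_le.1 h2).1
    linarith
  have hmain := abs_eigenvalue_sub_expansion_le hWs hNs hv hz hWv hgap hop
    (by rw [← LinearMap.add_apply, ← hA, hAz]) hLl (by nlinarith) (by positivity) hl0
    (by nlinarith)
  rw [← hedef, heta, hesq] at hmain
  rw [← hesq] at he
  have hdev : |‖e‖ ^ 2 - m| ≤ ε * n := abs_le_of_sq_le_sq he (by positivity)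
  have ha : ‖e‖ ≤ 2 * r := by
    have h1 : m ≤ n := noiseImageMean_le (W.edgeProb_mem x) hvsq
    have h2 := (abs_le.1 hdev).2
    refine abs_le_of_sq_le_sq' ?_ (by positivity) |>.2
    nlinarith
  have hWe' : ‖Wn.toEuclideanLin e‖ ≤ ε * r ^ 3 := by
    refine abs_le_of_sq_le_sq' ?_ (by positivity) |>.2
    rw [norm_sq_toEuclideanLin]
    simp only [hedef, toEuclideanLin_coord]
    refine hWe.trans_eq ?_
    rw [hr2]; ring
  set η := ∑ i, ∑ j, v i * v j * N i j with hηdef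
  -- The linear term has bounded second moment, so any growing threshold would be exceeded only
  -- rarely. The choice `n^{1/4}` still vanishes after multiplication by `‖e‖ / l`, of order
  -- `n^{-1/2}`.
  have hηabs : |η| ≤ √r := Real.abs_le_sqrt hη
  rw [← hesq] at hmain
  have hlr : κ * r ^ 2 ≤ l := by rw [← hr2]; exact hl
  -- Here the sharper bound on `W_n e` is decisive: all powers of `n` cancel and the factor `ε`
  -- remains.
  have b1 : (‖Wn.toEuclideanLin e‖ + ε * n * ‖e‖) / l * (2 * ‖e‖ / (g * n)) ≤
      12 * ε / (κ * g) := by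
    calc (‖Wn.toEuclideanLin e‖ + ε * n * ‖e‖) / l * (2 * ‖e‖ / (g * n))
        ≤ (ε * r ^ 3 + ε * n * (2 * r)) / (κ * r ^ 2) * (2 * (2 * r) / (g * n)) := by gcongr
      _ = _ := by rw [hr2]; field_simp; norm_num
  have b2 : |η + ‖e‖ ^ 2 / l| * (‖e‖ / l) ≤ (√r + 4 / κ) * (2 / (κ * r)) := by
    have c1 : |η + ‖e‖ ^ 2 / l| ≤ √r + 4 / κ := by
      refine (abs_add_le _ _).trans (add_le_add hηabs ?_)
      rw [abs_of_nonneg (by positivity)]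
      calc ‖e‖ ^ 2 / l ≤ (2 * r) ^ 2 / (κ * r ^ 2) := by gcongr
        _ = 4 / κ := by field_simp; norm_num
    have c2 : ‖e‖ / l ≤ 2 / (κ * r) := by
      calc ‖e‖ / l ≤ (2 * r) / (κ * r ^ 2) := by gcongr
        _ = _ := by field_simp
    exact mul_le_mul c1 c2 (by positivity) (by positivity)
  have b3 : |‖e‖ ^ 2 / l - m / l| ≤ ε / κ := by
    rw [← sub_div, abs_div, abs_of_pos hl0]
    calc |‖e‖ ^ 2 - m| / l ≤ ε * n / (κ * n) := by gcongr
      _ = _ := by field_simp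
  have hsplit : L - l - (η + m / l) =
      (L - l - (η + ‖e‖ ^ 2 / l)) + (‖e‖ ^ 2 / l - m / l) := by ring
  rw [hsplit]
  refine (abs_add_le _ _).trans ?_
  have e1 : 24 * ε / (κ * g) = 2 * (12 * ε / (κ * g)) := by ring
  have e2 : 4 * (√r + 4 / κ) / (κ * r) = 2 * ((√r + 4 / κ) * (2 / (κ * r))) := by ring
  rw [e1, e2]
  linarith

end FixedSize

section FixedSize

variable {n : ℕ}

/-- Eigenvectors for eigenvalues of order `n` are delocalized. -/
theorem abs_eigenvector_coord_le (W : Graphon) (x : Fin n → I) {v : EuclideanSpace ℝ (Fin n)}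
    (hv : ‖v‖ = 1) {l : ℝ} (hWv : (W.connectivityMatrix x).toEuclideanLin v = l • v) (hl : 0 ≤ l)
    (i : Fin n) : l * |v i| ≤ √n := by
  have h : l * v i = ∑ j, W.connectivityMatrix x i j * v j := by
    rw [← toEuclideanLin_coord, hWv]; simp
  rw [← abs_of_nonneg hl, ← abs_mul, h]
  refine Real.abs_le_sqrt ((Finset.sum_mul_sq_le_sq_mul_sq _ _ _).trans ?_)
  rw [← EuclideanSpace.real_norm_sq_eq, hv]
  simp only [one_pow, mul_one]
  exact (Finset.sum_le_sum fun j _ => W.connectivityMatrix_sq_le x i j).trans_eq (by simp)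

/-- Comparison of characteristic functions through a nonnegative function bounding the probability
that two variables are not close. -/
theorem norm_sum_weight_cexp_sub_le {p : Sym2 (Fin n) → ℝ} (hp : ∀ e, p e ∈ Set.Icc (0 : ℝ) 1)
    (f h B : SimpleGraph (Fin n) → ℝ) {R t : ℝ} (hB : ∀ H, 0 ≤ B H) (hR : 0 ≤ R)
    (hfh : ∀ H, B H ≤ 1 → |f H - h H| ≤ R) :
    ‖∑ H, (bernoulliWeight p H : ℂ) * Complex.exp (((t * f H : ℝ) : ℂ) * Complex.I) -
      ∑ H, (bernoulliWeight p H : ℂ) * Complex.exp (((t * h H : ℝ) : ℂ) * Complex.I)‖ ≤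
      |t| * R + 2 * graphMean p B := by
  rw [← Finset.sum_sub_distrib, ← graphMean_const_mul, ← graphMean_const (p := p) (|t| * R),
    ← graphMean_add]
  refine (norm_sum_le _ _).trans (Finset.sum_le_sum fun H _ => ?_)
  rw [← mul_sub, norm_mul, Complex.norm_real, Real.norm_eq_abs,
    abs_of_nonneg (bernoulliWeight_nonneg hp H)]
  refine mul_le_mul_of_nonneg_left ?_ (bernoulliWeight_nonneg hp H)
  -- Markov's inequality is built in: where `B > 1`, the two exponentials differ by at most `2 < 2
  -- B`.
  rcases le_or_gt (B H) 1 with hH | hH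
  · have h1 : Complex.exp (((t * f H : ℝ) : ℂ) * Complex.I) -
        Complex.exp (((t * h H : ℝ) : ℂ) * Complex.I) =
        Complex.exp (((t * h H : ℝ) : ℂ) * Complex.I) *
          (Complex.exp (Complex.I * ((t * (f H - h H) : ℝ) : ℂ)) - 1) := by
      rw [mul_sub, ← Complex.exp_add, mul_one]
      congr 2
      push_cast; ring
    rw [h1, norm_mul, Complex.norm_exp_ofReal_mul_I, one_mul]
    refine Real.norm_exp_I_mul_ofReal_sub_one_le.trans ?_
    rw [Real.norm_eq_abs, abs_mul]
    have := mul_le_mul_of_nonneg_left (hfh H hH) (abs_nonneg t)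
    linarith [hB H]
  · refine (norm_sub_le _ _).trans ?_
    rw [Complex.norm_exp_ofReal_mul_I, Complex.norm_exp_ofReal_mul_I]
    have := mul_nonneg (abs_nonneg t) hR
    linarith

/-- The normalized sum of the four quantities controlling the noise. -/
def noiseDefect (W : Graphon) (x : Fin n → I) (v : Fin n → ℝ) (ε : ℝ) (H : SimpleGraph (Fin n)) :
    ℝ :=
  (1 / (ε * n) ^ 4 * ∑ i, ∑ k, (∑ j, noiseMatrix (W.edgeProb x) H i j *
    noiseMatrix (W.edgeProb x) H j k) ^ 2 +
  1 / (ε ^ 2 * n ^ 3) * ∑ k, (∑ i, W.connectivityMatrix x k i *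
    ∑ j, noiseMatrix (W.edgeProb x) H i j * v j) ^ 2) +
  (1 / (ε * n) ^ 2 *
    (noiseImageSq (W.edgeProb x) v H - noiseImageMean (W.edgeProb x) v) ^ 2 +
  1 / √n * (∑ i, ∑ j, v i * v j * noiseMatrix (W.edgeProb x) H i j) ^ 2)

theorem noiseDefect_nonneg (W : Graphon) (x : Fin n → I) (v : Fin n → ℝ) (ε : ℝ)
    (H : SimpleGraph (Fin n)) : 0 ≤ noiseDefect W x v ε H := by
  unfold noiseDefect; positivity

/-- For fixed `ε` each normalizing factor exceeds the order of the matching moment bound, by `n` in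
the first three terms and by `√n` in the last, so the expected defect tends to zero. -/
theorem graphMean_noiseDefect_le (W : Graphon) (x : Fin n → I) {v : Fin n → ℝ}
    (hv : ∑ i, v i ^ 2 = 1) {ε : ℝ} (hε : 0 < ε) (hn : 0 < n) :
    graphMean (W.edgeProb x) (noiseDefect W x v ε) ≤
      3 / ε ^ 4 * (n : ℝ)⁻¹ + 2 / ε ^ 2 * (n : ℝ)⁻¹ + (8 / ε ^ 2 * (n : ℝ)⁻¹ + 2 * (√n)⁻¹) := by
  have hp := W.edgeProb_mem x
  have hn0 : (0 : ℝ) < n := by positivity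
  unfold noiseDefect
  rw [graphMean_add, graphMean_add, graphMean_add, graphMean_const_mul, graphMean_const_mul,
    graphMean_const_mul, graphMean_const_mul]
  gcongr ?_ + ?_ + (?_ + ?_)
  · calc _ ≤ 1 / (ε * n) ^ 4 * (3 * (n : ℝ) ^ 3) := by
          gcongr; exact graphMean_noise_sq_sq_le hp
      _ = _ := by field_simp
  · calc _ ≤ 1 / (ε ^ 2 * n ^ 3) * (2 * (n : ℝ) ^ 2) := by
          gcongr; exact graphMean_mul_noise_sq_le hp hv (W.connectivityMatrix_sq_le x)
      _ = _ := by field_simp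
  · calc _ ≤ 1 / (ε * n) ^ 2 * (8 * (n : ℝ)) := by
          gcongr; exact graphMean_noiseImageSq_sub_le hp hv
      _ = _ := by field_simp
  · calc _ ≤ 1 / √(n : ℝ) * 2 := by
          gcongr; exact graphMean_sq_quadraticForm_le hp hv
      _ = _ := by field_simp

theorem abs_topEigenvalue_sub_le_of_noiseDefect (W : Graphon) (hn : 2 ≤ n) (x : Fin n → I)
    {v : EuclideanSpace ℝ (Fin n)} (hv : ‖v‖ = 1) {l g κ ε : ℝ}
    (hWv : (W.connectivityMatrix x).toEuclideanLin v = l • v)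
    (hgap : ∀ y, inner ℝ v y = 0 →
      inner ℝ y ((W.connectivityMatrix x).toEuclideanLin y) ≤ (l - g * n) * ‖y‖ ^ 2)
    (hg : 0 < g) (hκ : 0 < κ) (hl : κ * n ≤ l) (hε : 0 < ε) (hε1 : ε ≤ 1) (hεg : 4 * ε ≤ g)
    (hεκ : 4 * ε ≤ κ) (H : SimpleGraph (Fin n)) (hB : noiseDefect W x v ε H ≤ 1) :
    |topEigenvalue (adjacencyMatrix H) - l -
      (∑ i, ∑ j, v i * v j * noiseMatrix (W.edgeProb x) H i j
        + noiseImageMean (W.edgeProb x) v / l)| ≤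
      24 * ε / (κ * g) + 4 * (√(√n) + 4 / κ) / (κ * √n) + ε / κ := by
  have hn0 : (0 : ℝ) < n := by positivity
  unfold noiseDefect at hB
  have key : ∀ {a b : ℝ}, 0 < a → 1 / a * b ≤ 1 → b ≤ a := fun {a b} ha h => by
    rwa [one_div, inv_mul_le_iff₀ ha, mul_one] at h
  have h1 : ∀ {a b c d : ℝ}, 0 ≤ a → 0 ≤ b → 0 ≤ c → 0 ≤ d → (a + b) + (c + d) ≤ 1 →
      a ≤ 1 ∧ b ≤ 1 ∧ c ≤ 1 ∧ d ≤ 1 := fun ha hb hc hd h => by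
    refine ⟨?_, ?_, ?_, ?_⟩ <;> linarith
  obtain ⟨a1, a2, a3, a4⟩ := h1 (by positivity) (by positivity) (by positivity) (by positivity) hB
  exact abs_topEigenvalue_sub_le W hn x hv hWv hgap hg hκ hl hε hε1 hεg hεκ H
    (key (by positivity) a1) (key (by positivity) a2) (key (by positivity) a3)
    (key (by positivity) a4)

end FixedSize

/-! ### The limit along a deterministic array of labels. -/

/-- Convergence of the characteristic functions of the eigenvalue differences along a deterministic
array of vertex labels, given the asymptotics of the top eigenvectors. -/
theorem tendsto_charFun_topEigenvalue_sub (W : Graphon) (x : (n : ℕ) → Fin n → I)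
    (v : (n : ℕ) → EuclideanSpace ℝ (Fin n)) (l : ℕ → ℝ) {g κ α s : ℝ} (hg : 0 < g) (hκ : 0 < κ)
    (hv : ∀ᶠ n in atTop, ‖v n‖ = 1)
    (hWv : ∀ᶠ n in atTop, (W.connectivityMatrix (x n)).toEuclideanLin (v n) = l n • v n)
    (hgap : ∀ᶠ n : ℕ in atTop, ∀ y, inner ℝ (v n) y = 0 →
      inner ℝ y ((W.connectivityMatrix (x n)).toEuclideanLin y) ≤ (l n - g * n) * ‖y‖ ^ 2)
    (hl : ∀ᶠ n : ℕ in atTop, κ * n ≤ l n)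
    (hmean : Tendsto (fun n => noiseImageMean (W.edgeProb (x n)) (v n) / l n) atTop (𝓝 α))
    (hvar : Tendsto (fun n => quadraticFormVariance (W.edgeProb (x n)) (v n)) atTop (𝓝 s))
    (t : ℝ) :
    Tendsto (fun n => ∑ H, (W.graphProb (x n) H : ℂ) *
      Complex.exp (((t * (topEigenvalue (adjacencyMatrix H) - l n) : ℝ) : ℂ) * Complex.I)) atTop
      (𝓝 (Complex.exp (t * α * Complex.I - s * t ^ 2 / 2))) := by
  simp only [Graphon.graphProb_eq]
  have hinv : Tendsto (fun n : ℕ => (n : ℝ)⁻¹) atTop (𝓝 0) := tendsto_inv_atTop_nhds_zero_nat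
  have hsqrt : Tendsto (fun n : ℕ => √(n : ℝ)) atTop atTop :=
    Real.tendsto_sqrt_atTop.comp tendsto_natCast_atTop_atTop
  have hsqrtinv : Tendsto (fun n : ℕ => (√(n : ℝ))⁻¹) atTop (𝓝 0) :=
    tendsto_inv_atTop_zero.comp hsqrt
  set η : (n : ℕ) → SimpleGraph (Fin n) → ℝ :=
    fun n H => ∑ i, ∑ j, v n i * v n j * noiseMatrix (W.edgeProb (x n)) H i j with hη
  set m : ℕ → ℝ := fun n => noiseImageMean (W.edgeProb (x n)) (v n) / l n with hm
  have hgauss : Tendsto (fun n => ∑ H, (bernoulliWeight (W.edgeProb (x n)) H : ℂ) *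
      Complex.exp (((t * η n H : ℝ) : ℂ) * Complex.I)) atTop
      (𝓝 ((Real.exp (-(t ^ 2 * s / 2)) : ℝ) : ℂ)) := by
    have h1 : Tendsto (fun n => ((Real.exp (-(t ^ 2 *
        quadraticFormVariance (W.edgeProb (x n)) (v n) / 2)) : ℝ) : ℂ)) atTop
        (𝓝 ((Real.exp (-(t ^ 2 * s / 2)) : ℝ) : ℂ)) :=
      (Complex.continuous_ofReal.tendsto _).comp ((Real.continuous_exp.tendsto _).comp
        (((hvar.const_mul (t ^ 2)).div_const 2).neg))
    -- Delocalization gives `|v_i| ≤ √n / (κ n)`, hence `2 |v_i v_j| ≤ 2 / (κ² n)`: the Lindeberg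
    -- condition.
    have hb0 : Tendsto (fun n : ℕ => |t| * (2 / κ ^ 2 * (n : ℝ)⁻¹)) atTop (𝓝 0) := by
      simpa using (hinv.const_mul (2 / κ ^ 2)).const_mul |t|
    refine (tendsto_iff_of_dist ?_).2 h1
    refine squeeze_zero' (Eventually.of_forall fun _ => dist_nonneg) ?_
      (by simpa using (hb0.const_mul 4).mul_const (t ^ 2) :
        Tendsto (fun n : ℕ => 4 * (|t| * (2 / κ ^ 2 * (n : ℝ)⁻¹)) * t ^ 2) atTop (𝓝 0))
    filter_upwards [hv, hWv, hl, hb0.eventually_le_const zero_lt_one, eventually_gt_atTop 0]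
      with n hv hWv hl hb1 hn
    have hn0 : (0 : ℝ) < n := by positivity
    rw [Complex.dist_eq]
    refine norm_quadraticForm_charFun_sub_le (W.edgeProb_mem (x n)) ?_ (fun i j => ?_) hb1
    · rw [← EuclideanSpace.real_norm_sq_eq, hv]; norm_num
    · refine mul_le_mul_of_nonneg_left ?_ (abs_nonneg t)
      have hc : ∀ i, |v n i| ≤ √n / (κ * n) := fun i => by
        rw [le_div_iff₀ (by positivity)]
        have h := abs_eigenvector_coord_le W (x n) hv hWv (le_trans (by positivity) hl) i
        have := mul_le_mul_of_nonneg_right hl (abs_nonneg (v n i))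
        linarith
      rw [abs_mul, abs_mul, abs_of_pos (zero_lt_two' ℝ)]
      calc 2 * (|v n i| * |v n j|) ≤ 2 * (√n / (κ * n) * (√n / (κ * n))) := by
            gcongr
            exacts [hc i, hc j]
        _ = 2 * (√n * √n) / (κ * n) ^ 2 := by ring
        _ = _ := by rw [Real.mul_self_sqrt hn0.le]; field_simp
  -- The term `m n` does not depend on the graph, so it only multiplies the characteristic function
  -- by a phase.
  have hshift : Tendsto (fun n => ∑ H, (bernoulliWeight (W.edgeProb (x n)) H : ℂ) *
      Complex.exp (((t * (η n H + m n) : ℝ) : ℂ) * Complex.I)) atTop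
      (𝓝 (Complex.exp (t * α * Complex.I - s * t ^ 2 / 2))) := by
    have h2 : Tendsto (fun n => Complex.exp (((t * m n : ℝ) : ℂ) * Complex.I)) atTop
        (𝓝 (Complex.exp (((t * α : ℝ) : ℂ) * Complex.I))) :=
      (Complex.continuous_exp.tendsto _).comp (((Complex.continuous_ofReal.tendsto _).comp
        (hmean.const_mul t)).mul_const _)
    have h3 := hgauss.mul h2
    have h4 : ((Real.exp (-(t ^ 2 * s / 2)) : ℝ) : ℂ) *
        Complex.exp (((t * α : ℝ) : ℂ) * Complex.I) =
        Complex.exp (t * α * Complex.I - s * t ^ 2 / 2) := by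
      rw [Complex.ofReal_exp, ← Complex.exp_add]
      congr 1
      push_cast; ring
    rw [h4] at h3
    refine h3.congr fun n => ?_
    rw [Finset.sum_mul]
    refine Finset.sum_congr rfl fun H _ => ?_
    rw [mul_assoc, ← Complex.exp_add]
    congr 2
    push_cast; ring
  refine (tendsto_iff_of_dist ?_).2 hshift
  rw [Metric.tendsto_nhds]
  intro δ hδ
  -- The terms of order `ε` in the error survive `n → ∞`, so `ε` is fixed before `n`, small relative
  -- to the target accuracy `δ`.
  obtain ⟨ε, hε, hε1, hεg, hεκ, hεδ⟩ : ∃ ε : ℝ, 0 < ε ∧ ε ≤ 1 ∧ 4 * ε ≤ g ∧ 4 * ε ≤ κ ∧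
      |t| * (24 * ε / (κ * g) + ε / κ) < δ := by
    have h : Tendsto (fun ε : ℝ => |t| * (24 * ε / (κ * g) + ε / κ)) (𝓝[>] 0) (𝓝 0) := by
      have : Continuous fun ε : ℝ => |t| * (24 * ε / (κ * g) + ε / κ) := by fun_prop
      simpa using (this.tendsto 0).mono_left nhdsWithin_le_nhds
    have hsmall : ∀ c : ℝ, 0 < c → ∀ᶠ ε : ℝ in 𝓝[>] 0, ε ≤ c := fun c hc =>
      (eventually_le_nhds hc).filter_mono nhdsWithin_le_nhds
    obtain ⟨ε, h1, h2, h3, h4, h5⟩ := ((h.eventually_lt_const hδ).and ((hsmall 1 one_pos).and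
      ((hsmall (g / 4) (by positivity)).and ((hsmall (κ / 4) (by positivity)).and
        self_mem_nhdsWithin)))).exists
    exact ⟨ε, h5, h2, by linarith, by linarith, h1⟩
  have hR : Tendsto (fun n : ℕ => |t| * (24 * ε / (κ * g) +
      4 * (√(√n) + 4 / κ) / (κ * √n) + ε / κ) + 2 * (3 / ε ^ 4 * (n : ℝ)⁻¹ +
      2 / ε ^ 2 * (n : ℝ)⁻¹ + (8 / ε ^ 2 * (n : ℝ)⁻¹ + 2 * (√n)⁻¹))) atTop
      (𝓝 (|t| * (24 * ε / (κ * g) + 0 + ε / κ) + 2 * (3 / ε ^ 4 * 0 + 2 / ε ^ 2 * 0 +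
        (8 / ε ^ 2 * 0 + 2 * 0)))) := by
    have hmid : Tendsto (fun n : ℕ => 4 * (√(√(n : ℝ)) + 4 / κ) / (κ * √n)) atTop (𝓝 0) := by
      have h1 : Tendsto (fun n : ℕ => (√(√(n : ℝ)))⁻¹) atTop (𝓝 0) :=
        tendsto_inv_atTop_zero.comp (Real.tendsto_sqrt_atTop.comp hsqrt)
      have h2 := (h1.add (hsqrtinv.const_mul (4 / κ))).const_mul (4 / κ)
      simp only [mul_zero, add_zero] at h2
      refine h2.congr' ?_
      filter_upwards [eventually_gt_atTop 0] with n hn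
      have hr : 0 < √(n : ℝ) := Real.sqrt_pos.2 (by positivity)
      have hrr : √(n : ℝ) = √(√(n : ℝ)) * √(√(n : ℝ)) := (Real.mul_self_sqrt hr.le).symm
      have hr' : 0 < √(√(n : ℝ)) := Real.sqrt_pos.2 hr
      set q := √(√(n : ℝ))
      rw [hrr]
      field_simp
    exact (((hmid.const_add _).add_const _).const_mul _).add
      ((((hinv.const_mul _).add (hinv.const_mul _)).add
        ((hinv.const_mul _).add (hsqrtinv.const_mul _))).const_mul 2)
  have hR' := hR.eventually_lt_const (u := δ) (by simpa using hεδ)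
  filter_upwards [hv, hWv, hgap, hl, hR', eventually_ge_atTop 2] with n hv hWv hgap hl hR hn
  rw [Real.dist_0_eq_abs, abs_of_nonneg dist_nonneg, Complex.dist_eq]
  refine lt_of_le_of_lt (norm_sum_weight_cexp_sub_le (W.edgeProb_mem (x n))
    (fun H => topEigenvalue (adjacencyMatrix H) - l n) (fun H => η n H + m n)
    (noiseDefect W (x n) (v n) ε) (noiseDefect_nonneg W (x n) (v n) ε) (by positivity)
    fun H hH => abs_topEigenvalue_sub_le_of_noiseDefect W hn (x n) hv hWv hgap hg hκ hl hε hε1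
      hεg hεκ H hH) (lt_of_le_of_lt ?_ hR)
  gcongr
  refine graphMean_noiseDefect_le W (x n) ?_ hε (by omega)
  rw [← EuclideanSpace.real_norm_sq_eq, hv]; norm_num

/-! ### Equidistribution of the labels. -/

section Equidistribution

/-- The empirical measures of the sequence `u` converge weakly to Lebesgue measure. -/
def Equidistributed (u : ℕ → I) : Prop :=
  ∀ f : C(I, ℝ), Tendsto (fun n : ℕ => (n : ℝ)⁻¹ * ∑ i : Fin n, f (u i)) atTop (𝓝 (∫ x, f x))

theorem abs_average_le {n : ℕ} {a : Fin n → ℝ} {C : ℝ} (hC : 0 ≤ C) (h : ∀ i, |a i| ≤ C) :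
    |(n : ℝ)⁻¹ * ∑ i, a i| ≤ C := by
  rcases Nat.eq_zero_or_pos n with rfl | hn
  · simpa using hC
  · have hn0 : (0 : ℝ) < n := by positivity
    rw [abs_mul, abs_of_pos (by positivity), inv_mul_le_iff₀ hn0]
    exact (Finset.abs_sum_le_sum_abs _ _).trans ((Finset.sum_le_sum fun i _ => h i).trans_eq
      (by simp))

theorem abs_average_sub_le {n : ℕ} {a b : Fin n → ℝ} {C : ℝ} (hC : 0 ≤ C)
    (h : ∀ i, |a i - b i| ≤ C) : |(n : ℝ)⁻¹ * ∑ i, a i - (n : ℝ)⁻¹ * ∑ i, b i| ≤ C := by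
  rw [← mul_sub, ← Finset.sum_sub_distrib]
  exact abs_average_le hC h

theorem abs_integral_sub_le (f g : C(I, ℝ)) : |(∫ x, f x) - ∫ x, g x| ≤ ‖f - g‖ := by
  have hi : ∀ f : C(I, ℝ), Integrable (fun x => f x) (volume : Measure I) := fun f =>
    f.continuous.integrable_of_hasCompactSupport (HasCompactSupport.of_compactSpace _)
  rw [← integral_sub (hi f) (hi g), ← Real.norm_eq_abs]
  have := norm_integral_le_of_norm_le_const (μ := (volume : Measure I)) (C := ‖f - g‖)
    (f := fun x => f x - g x) (Eventually.of_forall fun x => (f - g).norm_coe_le_norm x)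
  simpa using this

/-- Averages and the integral are both `1`-Lipschitz in the sup norm. A countable dense family
therefore suffices, for the almost sure statement as well as for measurability. -/
theorem Equidistributed.of_denseRange {ι : Type*} {F : ι → C(I, ℝ)} (hF : DenseRange F)
    {u : ℕ → I} (h : ∀ k, Tendsto (fun n : ℕ => (n : ℝ)⁻¹ * ∑ i : Fin n, F k (u i)) atTop
      (𝓝 (∫ x, F k x))) : Equidistributed u := by
  intro f
  rw [Metric.tendsto_nhds]
  intro ε hε
  obtain ⟨k, hk⟩ := hF.exists_dist_lt f (by positivity : 0 < ε / 3)
  rw [dist_eq_norm] at hk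
  filter_upwards [Metric.tendsto_nhds.1 (h k) (ε / 3) (by positivity)] with n hn
  rw [Real.dist_eq] at hn ⊢
  have h1 : |(n : ℝ)⁻¹ * ∑ i : Fin n, f (u i) - (n : ℝ)⁻¹ * ∑ i : Fin n, F k (u i)| ≤ ε / 3 :=
    abs_average_sub_le (by positivity) fun i => ((f - F k).norm_coe_le_norm (u i)).trans hk.le
  have h2 := (abs_integral_sub_le f (F k)).trans hk.le
  rw [abs_le] at h1 h2
  rw [abs_lt] at hn ⊢
  constructor <;> linarith [h1.1, h1.2, h2.1, h2.2, hn.1, hn.2]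

variable {u : ℕ → I}

/-- By continuity of `F.curry` into the sup norm, one slice controls all nearby ones; compactness
upgrades local uniformity to uniformity. -/
theorem Equidistributed.tendstoUniformly (hu : Equidistributed u) (F : C(I × I, ℝ)) :
    TendstoUniformly (fun (n : ℕ) x => (n : ℝ)⁻¹ * ∑ j : Fin n, F (x, u j))
      (fun x => ∫ y, F (x, y)) atTop := by
  rw [← tendstoLocallyUniformly_iff_tendstoUniformly_of_compactSpace,
    Metric.tendstoLocallyUniformly_iff]
  intro ε hε x
  refine ⟨{x' | dist (F.curry x') (F.curry x) < ε / 3},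
    (F.curry.continuous.tendsto x).eventually (Metric.ball_mem_nhds _ (by positivity)), ?_⟩
  filter_upwards [Metric.tendsto_nhds.1 (hu (F.curry x)) (ε / 3) (by positivity)] with n hn x' hx'
  simp only [dist_eq_norm] at hx'
  rw [dist_comm, Real.dist_eq]
  rw [Real.dist_eq] at hn
  have h1 : |(n : ℝ)⁻¹ * ∑ i : Fin n, F.curry x' (u i) -
      (n : ℝ)⁻¹ * ∑ i : Fin n, F.curry x (u i)| ≤ ε / 3 :=
    abs_average_sub_le (by positivity) fun i =>
      ((F.curry x' - F.curry x).norm_coe_le_norm (u i)).trans hx'.le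
  have h2 := (abs_integral_sub_le (F.curry x') (F.curry x)).trans hx'.le
  simp only [ContinuousMap.curry_apply] at h1 h2 hn
  rw [abs_le] at h1 h2
  rw [abs_lt] at hn ⊢
  constructor <;> linarith [h1.1, h1.2, h2.1, h2.2, hn.1, hn.2]

/-- The inner averages converge uniformly, so their limit is a continuous function, to which
equidistribution applies once more. -/
theorem Equidistributed.tendsto_double (hu : Equidistributed u) (F : C(I × I, ℝ)) :
    Tendsto (fun n : ℕ => (n : ℝ)⁻¹ * ∑ i : Fin n, (n : ℝ)⁻¹ * ∑ j : Fin n, F (u i, u j)) atTop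
      (𝓝 (∫ p : I × I, F p)) := by
  have hcont : Continuous fun x => ∫ y, F (x, y) := by
    refine continuous_of_uniform_approx_of_continuous fun s hs => ?_
    obtain ⟨n, hn⟩ := (hu.tendstoUniformly F s hs).exists
    exact ⟨_, by fun_prop, hn⟩
  have h1 := hu ⟨_, hcont⟩
  have hint : Integrable (fun p => F p) ((volume : Measure I).prod volume) :=
    F.continuous.integrable_of_hasCompactSupport (HasCompactSupport.of_compactSpace _)
  have h2 : ∫ p : I × I, F p = ∫ x, ∫ y, F (x, y) := integral_prod _ hint
  rw [h2]
  simp only [ContinuousMap.coe_mk] at h1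
  refine (tendsto_iff_of_dist ?_).2 h1
  rw [Metric.tendsto_nhds]
  intro ε hε
  filter_upwards [Metric.tendstoUniformly_iff.1 (hu.tendstoUniformly F) (ε / 2) (by positivity)]
    with n hn
  rw [Real.dist_0_eq_abs, abs_of_nonneg dist_nonneg, Real.dist_eq]
  refine lt_of_le_of_lt (abs_average_sub_le (C := ε / 2) (by positivity) fun i => ?_) (by linarith)
  rw [← Real.dist_eq, dist_comm]
  exact (hn (u i)).le

theorem ae_equidistributed {Ω : Type*} [MeasurableSpace Ω] {P : Measure Ω}
    {U : ℕ → Ω → I} (hm : ∀ i, Measurable (U i)) (hunif : ∀ i, P.map (U i) = (volume : Measure I))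
    (hind : iIndepFun U P) : ∀ᵐ ω ∂P, Equidistributed fun i => U i ω := by
  have : IsProbabilityMeasure P := hind.isProbabilityMeasure
  have h : ∀ᵐ ω ∂P, ∀ k : ℕ, Tendsto (fun n : ℕ => (n : ℝ)⁻¹ * ∑ i : Fin n,
      TopologicalSpace.denseSeq C(I, ℝ) k (U i ω)) atTop
      (𝓝 (∫ x, TopologicalSpace.denseSeq C(I, ℝ) k x)) := by
    rw [ae_all_iff]
    intro k
    set f := TopologicalSpace.denseSeq C(I, ℝ) k
    have hfm : Measurable fun x => f x := f.continuous.measurable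
    have h1 := strong_law_ae_real (μ := P) (fun i ω => f (U i ω)) ?_ ?_ ?_
    · have h2 : ∫ ω, f (U 0 ω) ∂P = ∫ x, f x := by
        rw [← hunif 0, integral_map (hm 0).aemeasurable hfm.aestronglyMeasurable]
      rw [h2] at h1
      filter_upwards [h1] with ω hω
      refine hω.congr fun n => ?_
      rw [Finset.sum_range, div_eq_inv_mul]
    · refine Integrable.of_bound (hfm.comp (hm 0)).aestronglyMeasurable ‖f‖
        (Eventually.of_forall fun ω => f.norm_coe_le_norm _)
    · intro i j hij
      exact (hind.indepFun hij).comp hfm hfm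
    · intro i
      refine IdentDistrib.comp ⟨(hm i).aemeasurable, (hm 0).aemeasurable, ?_⟩ hfm
      rw [hunif, hunif]
  filter_upwards [h] with ω hω
  exact Equidistributed.of_denseRange (TopologicalSpace.denseRange_denseSeq _) hω

end Equidistribution

/-! ### Compactness: limits of matrix eigenvectors are eigenfunctions. -/

/-- Uniformly bounded uniformly Lipschitz functions form a compact set. -/
theorem isCompact_lipschitz_bounded {X : Type*} [PseudoMetricSpace X] [CompactSpace X] (K : ℝ≥0)
    (C : ℝ) : IsCompact {f : C(X, ℝ) | LipschitzWith K f ∧ ∀ x, f x ∈ Set.Icc (-C) C} := by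
  refine ArzelaAscoli.isCompact_of_equicontinuous _ ?_ ?_
  · have h : ContinuousMap.toFun '' {f : C(X, ℝ) | LipschitzWith K f ∧ ∀ x, f x ∈ Set.Icc (-C) C} =
        (Set.univ.pi fun _ : X => Set.Icc (-C) C) ∩
          {f | ∀ x y, dist (f x) (f y) ≤ K * dist x y} := by
      ext f
      constructor
      · rintro ⟨g, ⟨h1, h2⟩, rfl⟩
        exact ⟨fun x _ => h2 x, fun x y => h1.dist_le_mul x y⟩
      · rintro ⟨h1, h2⟩
        have hl : LipschitzWith K f := LipschitzWith.of_dist_le_mul h2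
        exact ⟨⟨f, hl.continuous⟩, ⟨hl, fun x => h1 x trivial⟩, rfl⟩
    rw [h]
    refine (isCompact_univ_pi fun _ => isCompact_Icc).inter_right ?_
    simp only [Set.ofPred_forall]
    refine isClosed_iInter fun x => isClosed_iInter fun y => isClosed_le ?_ continuous_const
    exact (continuous_apply x).dist (continuous_apply y)
  · exact (LipschitzWith.uniformEquicontinuous _ K fun f => f.2.1).equicontinuous

section Interpolation

variable {n : ℕ}

theorem Graphon.abs_le_one (W : Graphon) (x y : I) : |W x y| ≤ 1 :=
  abs_le.2 ⟨by linarith [W.nonneg' x y], W.le_one' x y⟩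

theorem sum_abs_le_sqrt {v : EuclideanSpace ℝ (Fin n)} (hv : ‖v‖ = 1) : ∑ j, |v j| ≤ √n := by
  refine Real.le_sqrt_of_sq_le ?_
  have h := Finset.sum_mul_sq_le_sq_mul_sq Finset.univ (fun _ : Fin n => (1 : ℝ)) fun j => |v j|
  simp only [one_mul, sq_abs, one_pow] at h
  rw [← EuclideanSpace.real_norm_sq_eq, hv] at h
  simpa using h

theorem connectivityMatrix_mulVec_coord (W : Graphon) (x : Fin n → I)
    (v : EuclideanSpace ℝ (Fin n)) (i : Fin n) :
    (W.connectivityMatrix x).toEuclideanLin v i =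
      ∑ j, W (x i) (x j) * v j - W (x i) (x i) * v i := by
  rw [toEuclideanLin_coord, eq_sub_iff_add_eq,
    ← Finset.add_sum_erase _ _ (Finset.mem_univ i),
    ← Finset.add_sum_erase Finset.univ (fun j => W (x i) (x j) * v j) (Finset.mem_univ i)]
  have : ∑ j ∈ Finset.univ.erase i, W.connectivityMatrix x i j * v j =
      ∑ j ∈ Finset.univ.erase i, W (x i) (x j) * v j :=
    Finset.sum_congr rfl fun j hj => by
      simp [Graphon.connectivityMatrix, (Finset.ne_of_mem_erase hj).symm]
  rw [this]
  simp [Graphon.connectivityMatrix]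

/-- Eigenvectors of the connectivity matrix extend to Lipschitz functions on the unit interval. -/
theorem exists_interpolation (W : Graphon) {L : ℝ≥0}
    (hL : LipschitzWith L (fun p : I × I => W p.1 p.2)) (x : Fin n → I) (hn : 0 < n)
    {v : EuclideanSpace ℝ (Fin n)} (hv : ‖v‖ = 1) {c μ : ℝ} (hc : 0 < c) (hμ : c * n ≤ μ)
    (hWv : (W.connectivityMatrix x).toEuclideanLin v = μ • v) :
    ∃ f : C(I, ℝ), LipschitzWith (L * (1 / c).toNNReal) f ∧ (∀ t, f t ∈ Set.Icc (-(1 / c)) (1 / c)) ∧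
      (∀ t, f t = (μ / n)⁻¹ * ((n : ℝ)⁻¹ * ∑ j, W t (x j) * (√n * v j))) ∧
      (∀ j, |√n * v j| ≤ 1 / c) ∧ ∀ j, |√n * v j - f (x j)| ≤ 1 / c ^ 2 * (n : ℝ)⁻¹ := by
  have hn0 : (0 : ℝ) < n := by positivity
  have hμ0 : 0 < μ := lt_of_lt_of_le (by positivity) hμ
  have hs : √(n : ℝ) * √(n : ℝ) = n := Real.mul_self_sqrt hn0.le
  -- This estimate is used twice: with `a` a row of `W` it bounds the interpolant, and with `a` a
  -- difference of rows it gives the Lipschitz constant.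
  have hbase : ∀ (a : Fin n → ℝ) (C : ℝ), 0 ≤ C → (∀ j, |a j| ≤ C) →
      |√n / μ * ∑ j, a j * v j| ≤ C * (1 / c) := fun a C hC ha => by
    have h1 : |∑ j, a j * v j| ≤ C * √n := by
      refine (Finset.abs_sum_le_sum_abs _ _).trans ?_
      refine le_trans (Finset.sum_le_sum (g := fun j => C * |v j|) fun j _ => ?_) ?_
      · rw [abs_mul]; exact mul_le_mul_of_nonneg_right (ha j) (abs_nonneg _)
      · rw [← Finset.mul_sum]; exact mul_le_mul_of_nonneg_left (sum_abs_le_sqrt hv) hC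
    rw [abs_mul, abs_of_nonneg (by positivity)]
    calc √n / μ * |∑ j, a j * v j| ≤ √n / (c * n) * (C * √n) := by gcongr
      _ = C * (√n * √n) / (c * n) := by ring
      _ = _ := by rw [hs]; field_simp
  have hlip : LipschitzWith (L * (1 / c).toNNReal) fun t => √n / μ * ∑ j, W t (x j) * v j := by
    refine LipschitzWith.of_dist_le_mul fun t t' => ?_
    rw [Real.dist_eq, ← mul_sub, ← Finset.sum_sub_distrib]
    simp only [← sub_mul]
    refine (hbase (fun j => W t (x j) - W t' (x j)) (L * dist t t') (by positivity)
      fun j => ?_).trans_eq ?_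
    · have := hL.dist_le_mul (t, x j) (t', x j)
      rw [Real.dist_eq] at this
      simpa [Prod.dist_eq] using this
    · rw [NNReal.coe_mul, Real.coe_toNNReal _ (by positivity)]; ring
  have hvj : ∀ j, |√n * v j| ≤ 1 / c := fun j => by
    have h := abs_eigenvector_coord_le W x hv hWv hμ0.le j
    rw [abs_mul, abs_of_nonneg (Real.sqrt_nonneg _), le_div_iff₀ hc]
    have h1 : c * n * |v j| ≤ √n := (mul_le_mul_of_nonneg_right hμ (abs_nonneg _)).trans h
    have hr : 0 < √(n : ℝ) := Real.sqrt_pos.2 hn0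
    refine le_of_mul_le_mul_left ?_ hr
    calc √n * (√n * |v j| * c) = (√n * √n) * c * |v j| := by ring
      _ ≤ √n * 1 := by rw [hs, mul_one]; linarith
  refine ⟨⟨fun t => √n / μ * ∑ j, W t (x j) * v j, hlip.continuous⟩, hlip, fun t => ?_,
    fun t => ?_, hvj, fun j => ?_⟩
  · have := hbase (fun j => W t (x j)) 1 zero_le_one fun j => W.abs_le_one _ _
    rw [one_mul, abs_le] at this
    exact this
  · have : ∑ j, W t (x j) * (√n * v j) = √n * ∑ j, W t (x j) * v j := by
      rw [Finset.mul_sum]; exact Finset.sum_congr rfl fun j _ => by ring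
    rw [this, ContinuousMap.coe_mk]
    field_simp
  -- At the labels the interpolant differs from `√n v` only through the removed diagonal entry,
  -- divided by `μ ≥ c n`.
  · have h1 : μ * v j = ∑ k, W (x j) (x k) * v k - W (x j) (x j) * v j := by
      rw [← connectivityMatrix_mulVec_coord, hWv]; simp
    have h2 : √n * v j - √n / μ * ∑ k, W (x j) (x k) * v k =
        -(W (x j) (x j) * (√n * v j) / μ) := by
      field_simp
      linear_combination h1
    rw [ContinuousMap.coe_mk, h2, abs_neg, abs_div, abs_mul, abs_of_pos hμ0]
    calc |W (x j) (x j)| * |√n * v j| / μ ≤ 1 * (1 / c) / (c * n) := by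
          gcongr
          exacts [W.abs_le_one _ _, hvj j]
      _ = _ := by field_simp

theorem eigenvalue_le_card (W : Graphon) (x : Fin n → I) {v : EuclideanSpace ℝ (Fin n)}
    (hv : ‖v‖ = 1) {μ : ℝ} (hWv : (W.connectivityMatrix x).toEuclideanLin v = μ • v) : μ ≤ n := by
  have h := norm_sq_toEuclideanLin_le (W.connectivityMatrix x) v
  rw [hWv, norm_smul, hv, mul_one, Real.norm_eq_abs, sq_abs, one_pow, mul_one] at h
  have h2 : ∑ i, ∑ j, W.connectivityMatrix x i j ^ 2 ≤ (n : ℝ) ^ 2 := by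
    refine (Finset.sum_le_sum fun i _ => Finset.sum_le_sum fun j _ =>
      W.connectivityMatrix_sq_le x i j).trans_eq ?_
    simp; ring
  exact (abs_le_of_sq_le_sq' (h.trans h2) (Nat.cast_nonneg n)).2

end Interpolation

theorem Graphon.integralOperator_toLp (W : Graphon) (f : C(I, ℝ)) {μ : ℝ}
    (h : ∀ x, ∫ y, W x y * f y = μ * f x) :
    W.integralOperator (ContinuousMap.toLp 2 volume ℝ f) =
      μ • ContinuousMap.toLp 2 volume ℝ f := by
  have hf := ContinuousMap.coeFn_toLp (p := 2) (𝕜 := ℝ) (volume : Measure I) f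
  refine Lp.ext ?_
  refine (MemLp.coeFn_toLp (W.memLp_integral _)).trans ?_
  filter_upwards [hf, Lp.coeFn_smul μ (ContinuousMap.toLp 2 volume ℝ f)] with x hx hs
  rw [hs, Pi.smul_apply, hx, smul_eq_mul, ← h x]
  refine integral_congr_ae ?_
  filter_upwards [hf] with y hy
  rw [hy]

/-- Since `|W| ≤ 1` on a probability space, the sup norm of the image is at most the `L¹` norm,
hence the `L²` norm, of `f`. This bounds the eigenvalues in the supremum defining `posEigenvalue`.
-/
theorem Graphon.norm_integralOperator_le (W : Graphon) (f : Graphon.L2) :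
    ‖W.integralOperator f‖ ≤ ‖f‖ := by
  have h1 : ∀ x, ‖∫ y, W x y * f y‖ ≤ ‖f‖ := fun x => by
    have h2 : ‖∫ y, W x y * f y‖ ≤ ∫ y, ‖f y‖ := by
      refine norm_integral_le_of_norm_le (Graphon.integrable_L2 f).norm
        (Eventually.of_forall fun y => ?_)
      rw [norm_mul]
      exact mul_le_of_le_one_left (norm_nonneg _) (W.abs_le_one x y)
    refine h2.trans ?_
    rw [Lp.norm_def, integral_norm_eq_lintegral_enorm (Lp.aestronglyMeasurable f),
      ← eLpNorm_one_eq_lintegral_enorm]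
    refine ENNReal.toReal_mono (Lp.eLpNorm_ne_top f) ?_
    exact eLpNorm_le_eLpNorm_of_exponent_le (by norm_num) (Lp.aestronglyMeasurable f)
  have h3 := Lp.norm_le_of_ae_bound (f := W.integralOperator f) (C := ‖f‖) (norm_nonneg _) (by
    filter_upwards [MemLp.coeFn_toLp (W.memLp_integral f)] with x hx
    rw [show W.integralOperator f x = _ from hx]
    exact h1 x)
  have h4 : measureUnivNNReal (volume : Measure I) = 1 := by simp [measureUnivNNReal]
  simpa [h4] using h3

theorem Graphon.le_posEigenvalue (W : Graphon) {k : ℕ} (hk : 0 < k) {c : ℝ} (hc : 0 < c)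
    {e : Fin k → Graphon.L2} (he : Orthonormal ℝ e)
    (h : ∀ i, ∃ μ : ℝ, c ≤ μ ∧ W.integralOperator (e i) = μ • e i) : c ≤ W.posEigenvalue k := by
  refine le_csSup ⟨1, ?_⟩ (Or.inr ⟨hc, e, he, h⟩)
  rintro t (rfl | ⟨ht, e, he, h⟩)
  · exact zero_le_one
  · obtain ⟨μ, hμ, h⟩ := h ⟨0, hk⟩
    have h1 := W.norm_integralOperator_le (e ⟨0, hk⟩)
    rw [h, norm_smul, he.1, mul_one] at h1
    exact hμ.trans ((le_abs_self μ).trans h1)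

/-- The set contains `0`. If it is unbounded, as for `k = 0`, its `sSup` is `0` by convention. -/
theorem Graphon.posEigenvalue_nonneg (W : Graphon) (k : ℕ) : 0 ≤ W.posEigenvalue k := by
  by_cases h : BddAbove ({0} ∪ {t : ℝ | 0 < t ∧ ∃ e : Fin k → Graphon.L2, Orthonormal ℝ e ∧
    ∀ i, ∃ μ : ℝ, t ≤ μ ∧ W.integralOperator (e i) = μ • e i})
  · exact le_csSup h (Or.inl rfl)
  · exact (Real.sSup_of_not_bddAbove h).ge

/-- Orthonormal eigenvectors of the connectivity matrices with eigenvalues of order `n` accumulate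
at orthonormal eigenfunctions of the integral operator. -/
theorem exists_orthonormal_eigenfunctions_of_frequently (W : Graphon) (hLip : W.IsLipschitz)
    {u : ℕ → I} (hu : Equidistributed u) {c : ℝ} (hc : 0 < c) {k : ℕ}
    (h : ∃ᶠ n : ℕ in atTop, ∃ (e : Fin k → EuclideanSpace ℝ (Fin n)) (μ : Fin k → ℝ),
      Orthonormal ℝ e ∧ ∀ i, c * n ≤ μ i ∧
        (W.connectivityMatrix (firstTerms n u)).toEuclideanLin (e i) = μ i • e i) :
    ∃ e : Fin k → Graphon.L2, Orthonormal ℝ e ∧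
      ∀ i, ∃ μ : ℝ, c ≤ μ ∧ W.integralOperator (e i) = μ • e i := by
  obtain ⟨L, hL⟩ := hLip
  obtain ⟨ns, hns, hP⟩ := extraction_of_frequently_atTop (h.and_eventually (eventually_gt_atTop 0))
  choose hP hpos using hP
  choose e μ he hμ using hP
  have hint := fun a i => exists_interpolation W hL (firstTerms (ns a) u) (hpos a) ((he a).1 i) hc
    (hμ a i).1 (hμ a i).2
  choose f hf1 hf2 hf3 hf4 hf5 using hint
  -- One subsequence serves all `k` interpolants and all `k` normalized eigenvalues; the latter lie
  -- in `[c, 1]`, the upper end by `eigenvalue_le_card`.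
  have hK : IsCompact ((Set.univ.pi fun _ : Fin k => {f : C(I, ℝ) |
      LipschitzWith (L * (1 / c).toNNReal) f ∧ ∀ x, f x ∈ Set.Icc (-(1 / c)) (1 / c)}) ×ˢ
      (Set.univ.pi fun _ : Fin k => Set.Icc c 1)) :=
    (isCompact_univ_pi fun _ => isCompact_lipschitz_bounded _ _).prod
      (isCompact_univ_pi fun _ => isCompact_Icc)
  obtain ⟨⟨g, m⟩, hgm, ψ, hψ, hlim⟩ := hK.tendsto_subseq
    (x := fun a => (f a, fun i => μ a i / ns a)) (fun a => by
      refine ⟨fun i _ => ⟨hf1 a i, hf2 a i⟩, fun i _ => ?_⟩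
      have hn0 : (0 : ℝ) < ns a := by have := hpos a; positivity
      refine ⟨(le_div_iff₀ hn0).2 (hμ a i).1, (div_le_one hn0).2 ?_⟩
      exact eigenvalue_le_card W _ ((he a).1 i) (hμ a i).2)
  set N : ℕ → ℕ := fun a => ns (ψ a) with hN
  have hNtop : Tendsto N atTop atTop := (hns.comp hψ).tendsto_atTop
  have hglim : ∀ i, Tendsto (fun a => f (ψ a) i) atTop (𝓝 (g i)) := fun i =>
    ((continuous_apply i).tendsto _).comp ((continuous_fst.tendsto _).comp hlim)
  have hmlim : ∀ i, Tendsto (fun a => μ (ψ a) i / N a) atTop (𝓝 (m i)) := fun i =>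
    ((continuous_apply i).tendsto _).comp ((continuous_snd.tendsto _).comp hlim)
  have hm : ∀ i, m i ∈ Set.Icc c 1 := fun i => hgm.2 i trivial
  set ρ : Fin k → ℕ → ℝ := fun i a => 1 / c ^ 2 * (N a : ℝ)⁻¹ + dist (f (ψ a) i) (g i) with hρ
  have hρlim : ∀ i, Tendsto (ρ i) atTop (𝓝 0) := fun i => by
    have h1 : Tendsto (fun a => (N a : ℝ)⁻¹) atTop (𝓝 0) :=
      tendsto_inv_atTop_nhds_zero_nat.comp hNtop
    have h2 := (h1.const_mul (1 / c ^ 2)).add (tendsto_iff_dist_tendsto_zero.1 (hglim i))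
    simpa only [mul_zero, add_zero] using h2
  have hρ0 : ∀ i a, 0 ≤ ρ i a := fun i a => by positivity
  have hclose : ∀ i a (j : Fin (N a)), |√(N a) * e (ψ a) i j - g i (u j)| ≤ ρ i a := fun i a j => by
    have h1 := hf5 (ψ a) i j
    have h2 : |f (ψ a) i (u j) - g i (u j)| ≤ dist (f (ψ a) i) (g i) :=
      ContinuousMap.dist_apply_le_dist (f := f (ψ a) i) (g := g i) (u j)
    exact (abs_sub_le _ (f (ψ a) i (u j)) _).trans (add_le_add h1 h2)
  have hgb : ∀ i x, |g i x| ≤ 1 / c := fun i x => abs_le.2 ((hgm.1 i trivial).2 x)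
  have heig : ∀ i x, ∫ y, W x y * g i y = m i * g i x := by
    intro i x
    have hWc : Continuous fun y => W x y := hL.continuous.comp (by fun_prop : Continuous fun y => (x, y))
    have h1 : Tendsto (fun a => (N a : ℝ)⁻¹ * ∑ j : Fin (N a), W x (u j) * g i (u j)) atTop
        (𝓝 (∫ y, W x y * g i y)) :=
      (hu ⟨fun y => W x y * g i y, hWc.mul (g i).continuous⟩).comp hNtop
    have h2 : Tendsto (fun a => (N a : ℝ)⁻¹ * ∑ j : Fin (N a), W x (u j) *
        (√(N a) * e (ψ a) i j)) atTop (𝓝 (∫ y, W x y * g i y)) := by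
      refine (tendsto_iff_of_dist ?_).2 h1
      refine squeeze_zero (fun _ => dist_nonneg) (fun a => ?_) (hρlim i)
      rw [Real.dist_eq]
      refine abs_average_sub_le (hρ0 i a) fun j => ?_
      rw [← mul_sub, abs_mul]
      exact (mul_le_of_le_one_left (abs_nonneg _) (W.abs_le_one _ _)).trans (hclose i a j)
    -- The limit is taken in the interpolation formula, which holds at every point of the interval
    -- and not only at the labels.
    have h3 : Tendsto (fun a => f (ψ a) i x) atTop (𝓝 (g i x)) :=
      ((continuous_eval_const x).tendsto _).comp (hglim i)
    have h4 := ((hmlim i).inv₀ (by linarith [(hm i).1])).mul h2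
    have h5 := tendsto_nhds_unique h3 (h4.congr fun a => (hf3 (ψ a) i x).symm)
    have hm0 : m i ≠ 0 := by linarith [(hm i).1]
    rw [h5]; field_simp
  have horth : ∀ i j, ∫ y, g i y * g j y = if i = j then 1 else 0 := by
    intro i j
    have h1 : Tendsto (fun a => (N a : ℝ)⁻¹ * ∑ q : Fin (N a), g i (u q) * g j (u q)) atTop
        (𝓝 (∫ y, g i y * g j y)) := (hu (g i * g j)).comp hNtop
    have h2 : Tendsto (fun a => (N a : ℝ)⁻¹ * ∑ q : Fin (N a),
        (√(N a) * e (ψ a) i q) * (√(N a) * e (ψ a) j q)) atTop (𝓝 (∫ y, g i y * g j y)) := by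
      refine (tendsto_iff_of_dist ?_).2 h1
      refine squeeze_zero (fun _ => dist_nonneg) (fun a => ?_)
        (by simpa using ((hρlim j).const_mul (1 / c)).add ((hρlim i).const_mul (1 / c)) :
          Tendsto (fun a => 1 / c * ρ j a + 1 / c * ρ i a) atTop (𝓝 0))
      rw [Real.dist_eq]
      have := hρ0 i a
      have := hρ0 j a
      refine abs_average_sub_le (by positivity) fun q => ?_
      have hsplit : ∀ p q r s : ℝ, p * q - r * s = p * (q - s) + (p - r) * s := by intros; ring
      rw [hsplit]
      refine (abs_add_le _ _).trans (add_le_add ?_ ?_)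
      · rw [abs_mul]
        exact mul_le_mul (hf4 (ψ a) i q) (hclose j a q) (abs_nonneg _) (by positivity)
      · rw [mul_comm, abs_mul]
        exact mul_le_mul (hgb j _) (hclose i a q) (abs_nonneg _) (by positivity)
    -- After the rescaling by `√n` these averages are exactly the inner products of the
    -- eigenvectors, so the sequence is constant.
    refine tendsto_nhds_unique h2 (tendsto_const_nhds.congr fun a => ?_)
    have hn0 : (0 : ℝ) < N a := by have := hpos (ψ a); positivity
    have h3 := orthonormal_iff_ite.1 (he (ψ a)) i j
    rw [← h3, PiLp.inner_apply, Finset.mul_sum]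
    refine Finset.sum_congr rfl fun q _ => ?_
    have hs : √(N a : ℝ) * √(N a : ℝ) = N a := Real.mul_self_sqrt hn0.le
    simp only [RCLike.inner_apply, conj_trivial]
    calc _ = (N a : ℝ)⁻¹ * N a * (e (ψ a) j q * e (ψ a) i q) := by field_simp
      _ = (N a : ℝ)⁻¹ * (√(N a : ℝ) * √(N a : ℝ)) * (e (ψ a) j q * e (ψ a) i q) := by rw [hs]
      _ = _ := by ring
  refine ⟨fun i => ContinuousMap.toLp 2 volume ℝ (g i), ?_, fun i =>
    ⟨m i, (hm i).1, W.integralOperator_toLp (g i) (heig i)⟩⟩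
  rw [orthonormal_iff_ite]
  intro i j
  rw [ContinuousMap.inner_toLp, ← horth i j]
  refine integral_congr_ae (Eventually.of_forall fun y => ?_)
  simp [mul_comm]

/-- Eigenfunctions of the integral operator of a Lipschitz graphon are continuous. -/
theorem Graphon.exists_continuous_eigenfunction (W : Graphon) (hLip : W.IsLipschitz)
    {φ : Graphon.L2} {m : ℝ} (hm : m ≠ 0) (h : W.integralOperator φ = m • φ) :
    ∃ f : C(I, ℝ), φ =ᵐ[volume] f ∧ ∀ x, ∫ y, W x y * f y = m * f x := by
  obtain ⟨L, hL⟩ := hLip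
  have hlip : LipschitzWith (L * (∫ y, ‖φ y‖).toNNReal) fun x => ∫ y, W x y * φ y := by
    refine LipschitzWith.of_dist_le_mul fun x x' => ?_
    rw [Real.dist_eq, ← integral_sub (W.integrable_mul_L2 φ x) (W.integrable_mul_L2 φ x'),
      ← Real.norm_eq_abs, NNReal.coe_mul,
      Real.coe_toNNReal _ (integral_nonneg fun _ => norm_nonneg _)]
    have h1 : ∫ y, (L * dist x x') * ‖φ y‖ = L * (∫ y, ‖φ y‖) * dist x x' := by
      rw [integral_const_mul]; ring
    rw [← h1]
    refine norm_integral_le_of_norm_le ((Graphon.integrable_L2 φ).norm.const_mul _)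
      (Eventually.of_forall fun y => ?_)
    rw [← sub_mul, norm_mul, Real.norm_eq_abs]
    refine mul_le_mul_of_nonneg_right ?_ (norm_nonneg _)
    have := hL.dist_le_mul (x, y) (x', y)
    rw [Real.dist_eq] at this
    simpa [Prod.dist_eq] using this
  -- The integral is defined at every `x` and is Lipschitz because `W` is; dividing by the nonzero
  -- eigenvalue gives a continuous representative of `φ`.
  set f : C(I, ℝ) := ⟨fun x => m⁻¹ * ∫ y, W x y * φ y, hlip.continuous.const_mul _⟩ with hf
  have hae : φ =ᵐ[volume] f := by
    have h1 := MemLp.coeFn_toLp (W.memLp_integral φ)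
    have h2 : (m • φ : Graphon.L2) =ᵐ[volume] fun x => ∫ y, W x y * φ y := by
      rw [← h]; exact h1
    filter_upwards [h2, Lp.coeFn_smul m φ] with x hx hs
    rw [hf, ContinuousMap.coe_mk, ← hx, hs, Pi.smul_apply, smul_eq_mul, inv_mul_cancel_left₀ hm]
  refine ⟨f, hae, fun x => ?_⟩
  have : ∫ y, W x y * f y = ∫ y, W x y * φ y := by
    refine integral_congr_ae ?_
    filter_upwards [hae] with y hy
    rw [hy]
  rw [this, hf, ContinuousMap.coe_mk, mul_inv_cancel_left₀ hm]

/-! ### Alignment of the top eigenvector with the sampled eigenfunction. -/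

section Alignment

variable {F : Type*} [NormedAddCommGroup F] [InnerProductSpace ℝ F]

/-- An approximate eigenvector above the spectral gap is close to the top eigenvector. -/
theorem alignment_of_gap {T : F →ₗ[ℝ] F} (hT : T.IsSymmetric) {v w : F} (hv : ‖v‖ = 1)
    {l c k δ : ℝ} (hTv : T v = l • v) (hgap : ∀ y, inner ℝ v y = 0 → inner ℝ y (T y) ≤ c * ‖y‖ ^ 2)
    (hδ : ‖T w - k • w‖ ≤ δ) :
    (k - c) * ‖w - (inner ℝ v w : ℝ) • v‖ ≤ δ ∧ |inner ℝ v w| * |l - k| ≤ δ := by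
  set s : ℝ := inner ℝ v w with hs
  set y := w - s • v with hy
  have hvv : inner ℝ v v = (1 : ℝ) := by rw [real_inner_self_eq_norm_sq, hv]; norm_num
  have hvy : inner ℝ v y = (0 : ℝ) := by
    rw [hy, inner_sub_right, inner_smul_right, hvv, ← hs]; ring
  have hwy : w = s • v + y := by rw [hy]; abel
  have hTw : T w = (s * l) • v + T y := by
    conv_lhs => rw [hwy]
    rw [map_add, map_smul, hTv, smul_smul]
  -- Pairing the residual with `y`, where the gap acts, bounds the orthogonal part; pairing it with
  -- `v` bounds the eigenvalue difference.
  constructor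
  · have hyw : inner ℝ y w = ‖y‖ ^ 2 := by
      conv_lhs => rw [hwy]
      rw [inner_add_right, inner_smul_right, real_inner_comm v y, hvy, real_inner_self_eq_norm_sq]
      ring
    have h1 : inner ℝ y (T w - k • w) = inner ℝ y (T y) - k * ‖y‖ ^ 2 := by
      rw [inner_sub_right, hTw, inner_add_right, inner_smul_right, inner_smul_right,
        real_inner_comm v y, hvy, hyw]
      ring
    have h2 : -(‖y‖ * ‖T w - k • w‖) ≤ inner ℝ y (T w - k • w) :=
      (abs_le.1 (abs_real_inner_le_norm _ _)).1
    have h3 := hgap y hvy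
    rcases (norm_nonneg y).eq_or_lt with h0 | h0
    · rw [← h0, mul_zero]; exact (norm_nonneg _).trans hδ
    · refine le_of_mul_le_mul_right ?_ h0
      nlinarith
  · have h1 : inner ℝ v (T w - k • w) = s * (l - k) := by
      rw [inner_sub_right, ← hT v w, hTv, inner_smul_left, inner_smul_right, ← hs]
      simp; ring
    rw [← abs_mul, ← h1]
    refine (abs_real_inner_le_norm _ _).trans ?_
    rwa [hv, one_mul]

end Alignment

/-- The sum of the differences of squared coordinates is controlled by the alignment. -/
theorem sum_abs_sq_sub_sq_le {n : ℕ} {v w : EuclideanSpace ℝ (Fin n)} (hv : ‖v‖ = 1) (s : ℝ) :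
    ∑ i, |v i ^ 2 - w i ^ 2| ≤ ‖w - s • v‖ * (‖w‖ + |s|) + |s ^ 2 - 1| := by
  have hcs : ∀ a b : EuclideanSpace ℝ (Fin n), ∑ i, |a i| * |b i| ≤ ‖a‖ * ‖b‖ := fun a b => by
    refine (Real.sum_mul_le_sqrt_mul_sqrt _ _ _).trans_eq ?_
    simp only [sq_abs, ← EuclideanSpace.real_norm_sq_eq, Real.sqrt_sq (norm_nonneg _)]
  have h1 : ∀ i, |v i ^ 2 - w i ^ 2| ≤
      |(w - s • v) i| * |w i| + |s| * (|(w - s • v) i| * |v i|) + |s ^ 2 - 1| * v i ^ 2 :=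
    fun i => by
    -- Substitute `w = s v + (w - s v)` twice in `w²`. Only `s²` has to be close to `1`, so the
    -- arbitrary sign of `v` is harmless.
    have h : v i ^ 2 - w i ^ 2 =
        -((w - s • v) i * w i) + -(s * ((w - s • v) i * v i)) + -((s ^ 2 - 1) * v i ^ 2) := by
      simp; ring
    rw [h]
    refine (abs_add_le _ _).trans (add_le_add ((abs_add_le _ _).trans_eq ?_) ?_)
    · simp only [abs_neg, abs_mul]
    · rw [abs_neg, abs_mul, abs_of_nonneg (sq_nonneg (v i))]
  refine (Finset.sum_le_sum fun i _ => h1 i).trans ?_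
  rw [Finset.sum_add_distrib, Finset.sum_add_distrib, ← Finset.mul_sum, ← Finset.mul_sum,
    ← EuclideanSpace.real_norm_sq_eq, hv]
  have h2 := hcs (w - s • v) w
  have h3 := mul_le_mul_of_nonneg_left (hcs (w - s • v) v) (abs_nonneg s)
  rw [hv] at h3
  linarith

section Asymptotics

variable {W : Graphon} {u : ℕ → I}

/-- The values of `f` at the first `n` labels, as a vector normalized by `1 / √n`. -/
def sampleVector (f : C(I, ℝ)) (u : ℕ → I) (n : ℕ) : EuclideanSpace ℝ (Fin n) :=
  WithLp.toLp 2 fun i => f (u i) / √n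

theorem sampleVector_sq (f : C(I, ℝ)) (u : ℕ → I) (n : ℕ) (i : Fin n) :
    sampleVector f u n i ^ 2 = (n : ℝ)⁻¹ * f (u i) ^ 2 := by
  simp [sampleVector, div_pow]; ring

theorem tendsto_norm_sq_sampleVector (hu : Equidistributed u) {f : C(I, ℝ)}
    (hf : ∫ x, f x ^ 2 = 1) : Tendsto (fun n => ‖sampleVector f u n‖ ^ 2) atTop (𝓝 1) := by
  have h := hu (f ^ 2)
  simp only [ContinuousMap.pow_apply, hf] at h
  refine h.congr fun n => ?_
  rw [EuclideanSpace.real_norm_sq_eq, Finset.mul_sum]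
  exact Finset.sum_congr rfl fun i _ => (sampleVector_sq f u n i).symm

theorem Graphon.IsLipschitz.continuous (hLip : W.IsLipschitz) :
    Continuous fun p : I × I => W p.1 p.2 :=
  hLip.choose_spec.continuous

/-- The eigenvalue equation passes to label averages with an error uniform in `x`, and the missing
diagonal costs a further `O(1/n)`. Each coordinate of the residual is thus `o(√n)`, and its norm is
`o(n)`. -/
theorem tendsto_residual (hLip : W.IsLipschitz) (hu : Equidistributed u) {f : C(I, ℝ)} {m : ℝ}
    (hf : ∀ x, ∫ y, W x y * f y = m * f x) :
    Tendsto (fun n : ℕ => (n : ℝ)⁻¹ * ‖(W.connectivityMatrix (firstTerms n u)).toEuclideanLin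
      (sampleVector f u n) - (m * n) • sampleVector f u n‖) atTop (𝓝 0) := by
  have hWc := hLip.continuous
  have hunif := hu.tendstoUniformly ⟨fun p : I × I => W p.1 p.2 * f p.2, by fun_prop⟩
  simp only [ContinuousMap.coe_mk, hf] at hunif
  rw [Metric.tendsto_nhds]
  intro ε hε
  have h0 : Tendsto (fun n : ℕ => (n : ℝ)⁻¹ * ‖f‖) atTop (𝓝 0) := by
    simpa using tendsto_inv_atTop_nhds_zero_nat.mul_const ‖f‖
  filter_upwards [Metric.tendstoUniformly_iff.1 hunif (ε / 4) (by positivity),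
    h0.eventually_le_const (by positivity : 0 < ε / 4), eventually_gt_atTop 0] with n hn hn2 hn1
  have hn0 : (0 : ℝ) < n := by positivity
  have hr : 0 < √(n : ℝ) := Real.sqrt_pos.2 hn0
  have hs : √(n : ℝ) ^ 2 = n := Real.sq_sqrt hn0.le
  rw [Real.dist_0_eq_abs, abs_of_nonneg (by positivity), inv_mul_lt_iff₀ hn0]
  set r := (W.connectivityMatrix (firstTerms n u)).toEuclideanLin
      (sampleVector f u n) - (m * n) • sampleVector f u n with hrdef
  have hcoord : ∀ i, |r i| ≤ √n * (ε / 2) := fun i => by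
    have h1 : r i = √n * ((n : ℝ)⁻¹ * ∑ j : Fin n, W (u i) (u j) * f (u j) - m * f (u i)) -
        √n * (W (u i) (u i) * ((n : ℝ)⁻¹ * f (u i))) := by
      rw [hrdef, PiLp.sub_apply, connectivityMatrix_mulVec_coord]
      simp only [sampleVector, firstTerms, PiLp.smul_apply, smul_eq_mul]
      have h2 : ∑ j : Fin n, W (u i) (u j) * (f (u j) / √n) =
          (∑ j : Fin n, W (u i) (u j) * f (u j)) / √n := by
        rw [Finset.sum_div]; exact Finset.sum_congr rfl fun j _ => by ring
      rw [h2]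
      set S := ∑ j : Fin n, W (u i) (u j) * f (u j)
      set q := √(n : ℝ)
      rw [← hs]
      field_simp
      ring
    rw [h1]
    refine (abs_sub _ _).trans ?_
    rw [abs_mul, abs_mul √(n : ℝ), abs_of_pos hr, ← mul_add]
    refine mul_le_mul_of_nonneg_left ?_ hr.le
    have h3 := (hn (u i)).le
    rw [dist_comm, Real.dist_eq] at h3
    have h4 : |W (u i) (u i) * ((n : ℝ)⁻¹ * f (u i))| ≤ ε / 4 := by
      rw [abs_mul, abs_mul, abs_of_pos (inv_pos.2 hn0)]
      refine (mul_le_of_le_one_left (by positivity) (W.abs_le_one _ _)).trans (le_trans ?_ hn2)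
      gcongr
      exact f.norm_coe_le_norm _
    linarith
  have hsq : ‖r‖ ^ 2 ≤ (n * (ε / 2)) ^ 2 := by
    rw [EuclideanSpace.real_norm_sq_eq]
    have : ∀ i, r i ^ 2 ≤ n * (ε / 2) ^ 2 := fun i => by
      rw [← sq_abs]
      calc |r i| ^ 2 ≤ (√n * (ε / 2)) ^ 2 := by gcongr; exact hcoord i
        _ = _ := by rw [mul_pow, hs]
    refine (Finset.sum_le_sum fun i _ => this i).trans_eq ?_
    simp; ring
  have := (abs_le_of_sq_le_sq' hsq (by positivity)).2
  nlinarith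

end Asymptotics

theorem Filter.Eventually.exists_dependent_choice {ι : Type*} {β : ι → Type*} [∀ i, Nonempty (β i)]
    {l : Filter ι} {Q : (i : ι) → β i → Prop} (h : ∀ᶠ i in l, ∃ y, Q i y) :
    ∃ v : (i : ι) → β i, ∀ᶠ i in l, Q i (v i) :=
  ⟨fun i => Classical.epsilon (Q i), h.mono fun _ h => Classical.epsilon_spec h⟩

section TopEigenvector

variable {W : Graphon} {u : ℕ → I}

/-- Above `posEigenvalue 2`, the connectivity matrices have at most one eigenvalue. -/
theorem eventually_exists_gap (hLip : W.IsLipschitz) (hu : Equidistributed u) {c : ℝ}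
    (hc : W.posEigenvalue 2 < c) :
    ∀ᶠ n : ℕ in atTop, ∃ v : EuclideanSpace ℝ (Fin n), ‖v‖ = 1 ∧
      (W.connectivityMatrix (firstTerms n u)).toEuclideanLin v =
        topEigenvalue (W.connectivityMatrix (firstTerms n u)) • v ∧
      ∀ y, inner ℝ v y = 0 →
        inner ℝ y ((W.connectivityMatrix (firstTerms n u)).toEuclideanLin y) ≤ c * n * ‖y‖ ^ 2 := by
  have hc0 : 0 < c := (W.posEigenvalue_nonneg 2).trans_lt hc
  -- Otherwise the second matrix eigenvalue is at least `c n` for infinitely many `n`, and the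
  -- compactness theorem produces two orthonormal eigenfunctions with eigenvalues at least `c >
  -- λ_2(W)`.
  by_contra hcon
  rw [not_eventually] at hcon
  have hfreq := hcon.and_eventually (eventually_ge_atTop 2)
  obtain ⟨e, he, heig⟩ := exists_orthonormal_eigenfunctions_of_frequently W hLip hu hc0 (k := 2)
    (hfreq.mono fun n hn => by
      obtain ⟨hn, hn2⟩ := hn
      obtain ⟨e, m, he, hem, hle, htop, hgap⟩ := (Matrix.isSymmetric_toEuclideanLin_iff.2
        (W.isHermitian_connectivityMatrix (firstTerms n u))).exists_two_top_eigenvectors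
        (by simpa using hn2)
      have h1 : c * n ≤ m 1 := by
        by_contra hlt
        refine hn ⟨e 0, he.1 0, ?_, fun y hy => (hgap y hy).trans
          (mul_le_mul_of_nonneg_right (not_le.1 hlt).le (sq_nonneg _))⟩
        rw [topEigenvalue_eq (he.ne_zero 0) (hem 0) htop, hem 0]
      refine ⟨e, m, he, fun i => ⟨?_, hem i⟩⟩
      fin_cases i
      exacts [h1.trans hle, h1])
  exact absurd (W.le_posEigenvalue two_pos hc0 he heig) (not_le.2 hc)

/-- Asymptotics of the top eigenvalues and eigenvectors of the connectivity matrices. -/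
theorem exists_top_eigenvectors_asymptotics (hLip : W.IsLipschitz) (hu : Equidistributed u)
    {c m : ℝ} (hc : W.posEigenvalue 2 < c) (hcm : c < m) {f : C(I, ℝ)}
    (hf : ∀ x, ∫ y, W x y * f y = m * f x) (hf1 : ∫ x, f x ^ 2 = 1) :
    ∃ v : (n : ℕ) → EuclideanSpace ℝ (Fin n),
      (∀ᶠ n in atTop, ‖v n‖ = 1) ∧
      (∀ᶠ n in atTop, (W.connectivityMatrix (firstTerms n u)).toEuclideanLin (v n) =
        topEigenvalue (W.connectivityMatrix (firstTerms n u)) • v n) ∧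
      (∀ᶠ n : ℕ in atTop, ∀ y, inner ℝ (v n) y = 0 →
        inner ℝ y ((W.connectivityMatrix (firstTerms n u)).toEuclideanLin y) ≤
          c * n * ‖y‖ ^ 2) ∧
      Tendsto (fun n : ℕ => (n : ℝ)⁻¹ * topEigenvalue (W.connectivityMatrix (firstTerms n u)))
        atTop (𝓝 m) ∧
      Tendsto (fun n => ∑ i, |v n i ^ 2 - sampleVector f u n i ^ 2|) atTop (𝓝 0) := by
  have hgap := eventually_exists_gap hLip hu hc
  obtain ⟨v, hv⟩ := hgap.exists_dependent_choice
  have hv1 := hv.mono fun n h => h.1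
  have hv2 := hv.mono fun n h => h.2.1
  have hv3 := hv.mono fun n h => h.2.2
  set l : ℕ → ℝ := fun n => topEigenvalue (W.connectivityMatrix (firstTerms n u)) with hl
  set w : (n : ℕ) → EuclideanSpace ℝ (Fin n) := fun n => sampleVector f u n with hw
  set s : ℕ → ℝ := fun n => inner ℝ (v n) (w n) with hs
  set δ : ℕ → ℝ := fun n => (n : ℝ)⁻¹ * ‖(W.connectivityMatrix (firstTerms n u)).toEuclideanLin
      (w n) - (m * n) • w n‖ with hδ
  have hδ0 : Tendsto δ atTop (𝓝 0) := tendsto_residual hLip hu hf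
  have hw1 : Tendsto (fun n => ‖w n‖ ^ 2) atTop (𝓝 1) := tendsto_norm_sq_sampleVector hu hf1
  have hboth : ∀ᶠ n : ℕ in atTop, ‖w n - s n • v n‖ ≤ δ n / (m - c) ∧
      |s n| * |(n : ℝ)⁻¹ * l n - m| ≤ δ n := by
    filter_upwards [hv, eventually_gt_atTop 0] with n ⟨h1, h2, h3⟩ hn
    have hn0 : (0 : ℝ) < n := by positivity
    have hsymm := Matrix.isSymmetric_toEuclideanLin_iff.2
      (W.isHermitian_connectivityMatrix (firstTerms n u))
    obtain ⟨a1, a2⟩ := alignment_of_gap hsymm h1 h2 h3 (w := w n) (k := m * n) le_rfl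
    have hδn : ‖(W.connectivityMatrix (firstTerms n u)).toEuclideanLin (w n) - (m * n) • w n‖ =
        n * δ n := by rw [hδ]; field_simp
    rw [hδn] at a1 a2
    constructor
    · rw [le_div_iff₀ (by linarith)]
      refine le_of_mul_le_mul_left ?_ hn0
      linarith
    · refine le_of_mul_le_mul_left ?_ hn0
      have : (n : ℝ)⁻¹ * l n - m = (n : ℝ)⁻¹ * (l n - m * n) := by field_simp
      rw [this, abs_mul, abs_of_pos (inv_pos.2 hn0)]
      calc (n : ℝ) * (|s n| * ((n : ℝ)⁻¹ * |l n - m * n|)) = |s n| * |l n - m * n| := by field_simp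
        _ ≤ _ := a2
  have hy0 : Tendsto (fun n => ‖w n - s n • v n‖) atTop (𝓝 0) :=
    squeeze_zero' (Eventually.of_forall fun _ => norm_nonneg _) (hboth.mono fun n h => h.1)
      (by simpa using hδ0.div_const (m - c))
  -- By Pythagoras, `s² = ‖w‖² - ‖w - s v‖²`.
  have hs2 : Tendsto (fun n => s n ^ 2) atTop (𝓝 1) := by
    have h1 := hw1.sub (hy0.pow 2)
    simp only [ne_eq, OfNat.ofNat_ne_zero, not_false_eq_true, zero_pow, sub_zero] at h1
    refine h1.congr' (hv1.mono fun n h => ?_)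
    have hsn : inner ℝ (v n) (w n) = s n := rfl
    rw [norm_sub_sq_real, norm_smul, inner_smul_right, h, real_inner_comm, hsn, mul_one,
      Real.norm_eq_abs, sq_abs]
    ring
  have hsabs : Tendsto (fun n => |s n|) atTop (𝓝 1) := by
    have := hs2.sqrt
    simpa only [Real.sqrt_sq_eq_abs, Real.sqrt_one] using this
  have hwn : Tendsto (fun n => ‖w n‖) atTop (𝓝 1) := by
    have := hw1.sqrt
    simpa only [Real.sqrt_sq (norm_nonneg _), Real.sqrt_one] using this
  refine ⟨v, hv1, hv2, hv3, ?_, ?_⟩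
  · rw [tendsto_iff_dist_tendsto_zero]
    refine squeeze_zero' (Eventually.of_forall fun _ => dist_nonneg) ?_
      (by simpa using hδ0.const_mul 2 : Tendsto (fun n => 2 * δ n) atTop (𝓝 0))
    filter_upwards [hboth, hsabs.eventually_const_le (by norm_num : (1 / 2 : ℝ) < 1)] with n h1 h2
    rw [Real.dist_eq]
    nlinarith [h1.2, abs_nonneg ((n : ℝ)⁻¹ * l n - m)]
  · have hlim : Tendsto (fun n => ‖w n - s n • v n‖ * (‖w n‖ + |s n|) + |s n ^ 2 - 1|) atTop
        (𝓝 0) := by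
      have := (hy0.mul (hwn.add hsabs)).add (hs2.sub_const 1).abs
      simpa using this
    exact squeeze_zero' (Eventually.of_forall fun _ => Finset.sum_nonneg fun _ _ => abs_nonneg _)
      (hv1.mono fun n h => sum_abs_sq_sub_sq_le h (s n)) hlim

end TopEigenvector

/-! ### Convergence of the mean and the variance. -/

section Parameters

variable {W : Graphon} {u : ℕ → I}

theorem Graphon.variance_nonneg (W : Graphon) (x y : I) : 0 ≤ W x y * (1 - W x y) :=
  mul_nonneg (W.nonneg' x y) (sub_nonneg.2 (W.le_one' x y))

theorem Graphon.variance_le_one (W : Graphon) (x y : I) : W x y * (1 - W x y) ≤ 1 := by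
  nlinarith [W.nonneg' x y, W.le_one' x y]

/-- Replacing `v_j²` by `f(u_j)² / n` costs the `ℓ¹` distance of the squares, and restoring the
diagonal costs `1/n`; what remains is a double average. -/
theorem tendsto_noiseImageMean (hLip : W.IsLipschitz) (hu : Equidistributed u) {f : C(I, ℝ)}
    {v : (n : ℕ) → EuclideanSpace ℝ (Fin n)} (hv : ∀ᶠ n in atTop, ‖v n‖ = 1)
    (hvf : Tendsto (fun n => ∑ i, |v n i ^ 2 - sampleVector f u n i ^ 2|) atTop (𝓝 0)) :
    Tendsto (fun n : ℕ => (n : ℝ)⁻¹ * noiseImageMean (W.edgeProb (firstTerms n u)) (v n)) atTop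
      (𝓝 (∫ p : I × I, f p.2 ^ 2 * (W p.1 p.2 * (1 - W p.1 p.2)))) := by
  have hWc := hLip.continuous
  have h1 := hu.tendsto_double
    ⟨fun p : I × I => f p.2 ^ 2 * (W p.1 p.2 * (1 - W p.1 p.2)), by fun_prop⟩
  simp only [ContinuousMap.coe_mk] at h1
  refine (tendsto_iff_of_dist ?_).2 h1
  refine squeeze_zero' (Eventually.of_forall fun _ => dist_nonneg) ?_
    (by simpa using hvf.add tendsto_inv_atTop_nhds_zero_nat :
      Tendsto (fun n : ℕ => ∑ i, |v n i ^ 2 - sampleVector f u n i ^ 2| + (n : ℝ)⁻¹) atTop (𝓝 0))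
  filter_upwards [hv, eventually_gt_atTop 0] with n hv hn
  have hn0 : (0 : ℝ) < n := by positivity
  have hsplit : (n : ℝ)⁻¹ * noiseImageMean (W.edgeProb (firstTerms n u)) (v n) =
      (n : ℝ)⁻¹ * ∑ i : Fin n, ∑ j : Fin n, W (u i) (u j) * (1 - W (u i) (u j)) * v n j ^ 2 -
      (n : ℝ)⁻¹ * ∑ i : Fin n, W (u i) (u i) * (1 - W (u i) (u i)) * v n i ^ 2 := by
    rw [← mul_sub, ← Finset.sum_sub_distrib, noiseImageMean]
    congr 1
    refine Finset.sum_congr rfl fun i _ => ?_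
    rw [eq_sub_iff_add_eq, ← Finset.add_sum_erase _ _ (Finset.mem_univ i), if_pos rfl, zero_add,
      add_comm, ← Finset.add_sum_erase Finset.univ
        (fun j : Fin n => W (u i) (u j) * (1 - W (u i) (u j)) * v n j ^ 2) (Finset.mem_univ i)]
    congr 1
    exact Finset.sum_congr rfl fun j hj => if_neg (Finset.ne_of_mem_erase hj).symm
  have hA : |(n : ℝ)⁻¹ * ∑ i : Fin n, ∑ j : Fin n,
        W (u i) (u j) * (1 - W (u i) (u j)) * v n j ^ 2 -
      (n : ℝ)⁻¹ * ∑ i : Fin n, (n : ℝ)⁻¹ * ∑ j : Fin n,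
        f (u j) ^ 2 * (W (u i) (u j) * (1 - W (u i) (u j)))| ≤
      ∑ i, |v n i ^ 2 - sampleVector f u n i ^ 2| := by
    refine abs_average_sub_le (Finset.sum_nonneg fun _ _ => abs_nonneg _) fun i => ?_
    rw [Finset.mul_sum, ← Finset.sum_sub_distrib]
    refine (Finset.abs_sum_le_sum_abs _ _).trans (Finset.sum_le_sum fun j _ => ?_)
    have : W (u i) (u j) * (1 - W (u i) (u j)) * v n j ^ 2 -
        (n : ℝ)⁻¹ * (f (u j) ^ 2 * (W (u i) (u j) * (1 - W (u i) (u j)))) =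
        W (u i) (u j) * (1 - W (u i) (u j)) * (v n j ^ 2 - sampleVector f u n j ^ 2) := by
      rw [sampleVector_sq]; ring
    rw [this, abs_mul, abs_of_nonneg (W.variance_nonneg _ _)]
    exact mul_le_of_le_one_left (abs_nonneg _) (W.variance_le_one _ _)
  have hB : |(n : ℝ)⁻¹ * ∑ i : Fin n, W (u i) (u i) * (1 - W (u i) (u i)) * v n i ^ 2| ≤
      (n : ℝ)⁻¹ := by
    rw [abs_of_nonneg (mul_nonneg (by positivity) (Finset.sum_nonneg fun i _ =>
      mul_nonneg (W.variance_nonneg _ _) (sq_nonneg _)))]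
    refine mul_le_of_le_one_right (by positivity) ?_
    have : ∑ i, v n i ^ 2 = 1 := by rw [← EuclideanSpace.real_norm_sq_eq, hv]; norm_num
    exact le_of_le_of_eq (Finset.sum_le_sum fun i _ =>
      mul_le_of_le_one_left (sq_nonneg _) (W.variance_le_one _ _)) this
  rw [Real.dist_eq, hsplit, sub_right_comm]
  exact (abs_sub _ _).trans (add_le_add hA hB)

/-- As for the mean, but the diagonal is now `∑ v_i⁴` up to bounded weights, and it vanishes only
because `max v_i²` is `O(1/n)`. -/
theorem tendsto_quadraticFormVariance (hLip : W.IsLipschitz) (hu : Equidistributed u)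
    {f : C(I, ℝ)} (hf1 : ∫ x, f x ^ 2 = 1)
    {v : (n : ℕ) → EuclideanSpace ℝ (Fin n)} (hv : ∀ᶠ n in atTop, ‖v n‖ = 1)
    {C : ℝ} (hmax : ∀ᶠ n : ℕ in atTop, ∀ i, v n i ^ 2 ≤ C * (n : ℝ)⁻¹)
    (hvf : Tendsto (fun n => ∑ i, |v n i ^ 2 - sampleVector f u n i ^ 2|) atTop (𝓝 0)) :
    Tendsto (fun n : ℕ => quadraticFormVariance (W.edgeProb (firstTerms n u)) (v n)) atTop
      (𝓝 (2 * ∫ p : I × I, f p.1 ^ 2 * f p.2 ^ 2 * (W p.1 p.2 * (1 - W p.1 p.2)))) := by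
  have hWc := hLip.continuous
  have h1 := (hu.tendsto_double
    ⟨fun p : I × I => f p.1 ^ 2 * f p.2 ^ 2 * (W p.1 p.2 * (1 - W p.1 p.2)), by fun_prop⟩).const_mul
    2
  simp only [ContinuousMap.coe_mk] at h1
  refine (tendsto_iff_of_dist ?_).2 h1
  have hw1 := tendsto_norm_sq_sampleVector hu hf1
  refine squeeze_zero' (Eventually.of_forall fun _ => dist_nonneg) ?_
    (by simpa using ((hvf.mul (hw1.const_add 1)).add
        (tendsto_inv_atTop_nhds_zero_nat.const_mul C)).const_mul 2 :
      Tendsto (fun n : ℕ => 2 * ((∑ i, |v n i ^ 2 - sampleVector f u n i ^ 2|) *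
        (1 + ‖sampleVector f u n‖ ^ 2) + C * (n : ℝ)⁻¹)) atTop (𝓝 0))
  filter_upwards [hv, hmax, eventually_gt_atTop 0] with n hv hmax hn
  have hn0 : (0 : ℝ) < n := by positivity
  have hvs : ∑ i, v n i ^ 2 = 1 := by rw [← EuclideanSpace.real_norm_sq_eq, hv]; norm_num
  set w := sampleVector f u n with hw
  have hsplit : quadraticFormVariance (W.edgeProb (firstTerms n u)) (v n) =
      2 * (∑ i : Fin n, ∑ j : Fin n, v n i ^ 2 * v n j ^ 2 * (W (u i) (u j) * (1 - W (u i) (u j))) -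
      ∑ i : Fin n, v n i ^ 2 * v n i ^ 2 * (W (u i) (u i) * (1 - W (u i) (u i)))) := by
    rw [← Finset.sum_sub_distrib, quadraticFormVariance]
    congr 1
    refine Finset.sum_congr rfl fun i _ => ?_
    rw [eq_sub_iff_add_eq, ← Finset.add_sum_erase _ _ (Finset.mem_univ i), if_pos rfl, zero_add,
      add_comm, ← Finset.add_sum_erase Finset.univ
        (fun j : Fin n => v n i ^ 2 * v n j ^ 2 * (W (u i) (u j) * (1 - W (u i) (u j))))
        (Finset.mem_univ i)]
    congr 1
    exact Finset.sum_congr rfl fun j hj => if_neg (Finset.ne_of_mem_erase hj).symm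
  have hdouble : (n : ℝ)⁻¹ * ∑ i : Fin n, (n : ℝ)⁻¹ * ∑ j : Fin n,
        f (u i) ^ 2 * f (u j) ^ 2 * (W (u i) (u j) * (1 - W (u i) (u j))) =
      ∑ i : Fin n, ∑ j : Fin n, w i ^ 2 * w j ^ 2 * (W (u i) (u j) * (1 - W (u i) (u j))) := by
    rw [Finset.mul_sum]
    refine Finset.sum_congr rfl fun i _ => ?_
    rw [Finset.mul_sum, Finset.mul_sum]
    refine Finset.sum_congr rfl fun j _ => ?_
    rw [hw, sampleVector_sq, sampleVector_sq]; ring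
  have hA : |∑ i : Fin n, ∑ j : Fin n, v n i ^ 2 * v n j ^ 2 *
        (W (u i) (u j) * (1 - W (u i) (u j))) -
      ∑ i : Fin n, ∑ j : Fin n, w i ^ 2 * w j ^ 2 * (W (u i) (u j) * (1 - W (u i) (u j)))| ≤
      (∑ i, |v n i ^ 2 - w i ^ 2|) * (1 + ‖w‖ ^ 2) := by
    have hb : (∑ i, |v n i ^ 2 - w i ^ 2|) * (1 + ‖w‖ ^ 2) =
        ∑ i, ∑ j, (|v n i ^ 2 - w i ^ 2| * v n j ^ 2 + w i ^ 2 * |v n j ^ 2 - w j ^ 2|) := by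
      simp only [Finset.sum_add_distrib]
      rw [← Finset.sum_mul_sum, ← Finset.sum_mul_sum, hvs, EuclideanSpace.real_norm_sq_eq]; ring
    rw [hb, ← Finset.sum_sub_distrib]
    refine (Finset.abs_sum_le_sum_abs _ _).trans (Finset.sum_le_sum fun i _ => ?_)
    rw [← Finset.sum_sub_distrib]
    refine (Finset.abs_sum_le_sum_abs _ _).trans (Finset.sum_le_sum fun j _ => ?_)
    rw [← sub_mul, abs_mul, abs_of_nonneg (W.variance_nonneg _ _)]
    refine (mul_le_of_le_one_right (abs_nonneg _) (W.variance_le_one _ _)).trans ?_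
    have : v n i ^ 2 * v n j ^ 2 - w i ^ 2 * w j ^ 2 =
        (v n i ^ 2 - w i ^ 2) * v n j ^ 2 + w i ^ 2 * (v n j ^ 2 - w j ^ 2) := by ring
    rw [this]
    refine (abs_add_le _ _).trans_eq ?_
    rw [abs_mul, abs_mul, abs_of_nonneg (sq_nonneg (v n j)), abs_of_nonneg (sq_nonneg (w i))]
  have hB : |∑ i : Fin n, v n i ^ 2 * v n i ^ 2 * (W (u i) (u i) * (1 - W (u i) (u i)))| ≤
      C * (n : ℝ)⁻¹ := by
    rw [abs_of_nonneg (Finset.sum_nonneg fun i _ => mul_nonneg (by positivity)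
      (W.variance_nonneg _ _))]
    calc _ ≤ ∑ i : Fin n, C * (n : ℝ)⁻¹ * v n i ^ 2 := by
          refine Finset.sum_le_sum fun i _ => ?_
          refine (mul_le_of_le_one_right (by positivity) (W.variance_le_one _ _)).trans ?_
          exact mul_le_mul_of_nonneg_right (hmax i) (sq_nonneg _)
      _ = _ := by rw [← Finset.mul_sum, hvs, mul_one]
  rw [Real.dist_eq, hsplit, hdouble, ← mul_sub, abs_mul, abs_of_pos (zero_lt_two' ℝ),
    sub_right_comm]
  exact mul_le_mul_of_nonneg_left ((abs_sub _ _).trans (add_le_add hA hB)) zero_le_two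

end Parameters

/-! ### Measurability and identification of the conditional laws. -/

section Continuity

variable {n : ℕ}

theorem topEigenvalue_le_add {M M' : Matrix (Fin n) (Fin n) ℝ} (hM : M.IsHermitian)
    (hM' : M'.IsHermitian) (hn : 2 ≤ n) :
    topEigenvalue M ≤ topEigenvalue M' + √(∑ i, ∑ j, (M i j - M' i j) ^ 2) := by
  obtain ⟨v, hv, hMv, -⟩ := exists_top_eigenvector hM hn
  obtain ⟨-, -, -, hmax⟩ := exists_top_eigenvector hM' hn
  have h1 : inner ℝ v (M.toEuclideanLin v) = topEigenvalue M := by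
    rw [hMv, inner_smul_right, real_inner_self_eq_norm_sq, hv]; norm_num
  have h2 := hmax v
  have h3 : ‖(M - M').toEuclideanLin v‖ ≤ √(∑ i, ∑ j, (M i j - M' i j) ^ 2) := by
    refine Real.le_sqrt_of_sq_le ((norm_sq_toEuclideanLin_le _ _).trans_eq ?_)
    simp [hv]
  have h4 := real_inner_le_norm v ((M - M').toEuclideanLin v)
  rw [hv, one_mul, map_sub, LinearMap.sub_apply, inner_sub_right, h1, ← LinearMap.sub_apply,
    ← map_sub] at h4
  rw [hv] at h2
  linarith

theorem abs_topEigenvalue_sub_topEigenvalue_le {M M' : Matrix (Fin n) (Fin n) ℝ}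
    (hM : M.IsHermitian) (hM' : M'.IsHermitian) (hn : 2 ≤ n) :
    |topEigenvalue M - topEigenvalue M'| ≤ √(∑ i, ∑ j, (M i j - M' i j) ^ 2) := by
  have h1 := topEigenvalue_le_add hM hM' hn
  have h2 := topEigenvalue_le_add hM' hM hn
  have h3 : ∑ i, ∑ j, (M' i j - M i j) ^ 2 = ∑ i, ∑ j, (M i j - M' i j) ^ 2 :=
    Finset.sum_congr rfl fun i _ => Finset.sum_congr rfl fun j _ => by ring
  rw [h3] at h2
  rw [abs_le]
  constructor <;> linarith

/-- The top eigenvalue is `1`-Lipschitz in the Hilbert-Schmidt norm. Continuity serves to make the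
eigenvalue difference a measurable function of the labels. -/
theorem continuous_topEigenvalue_connectivityMatrix {W : Graphon} (hLip : W.IsLipschitz)
    (hn : 2 ≤ n) : Continuous fun x : Fin n → I => topEigenvalue (W.connectivityMatrix x) := by
  have hWc := hLip.continuous
  have hent : ∀ i j, Continuous fun x : Fin n → I => W.connectivityMatrix x i j := fun i j => by
    simp only [Graphon.connectivityMatrix, Matrix.of_apply]
    split_ifs
    · exact continuous_const
    · exact hWc.comp (by fun_prop : Continuous fun x : Fin n → I => (x i, x j))
  rw [continuous_iff_continuousAt]
  intro x0
  rw [ContinuousAt, tendsto_iff_dist_tendsto_zero]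
  have hc : Continuous fun x : Fin n → I =>
      √(∑ i, ∑ j, (W.connectivityMatrix x i j - W.connectivityMatrix x0 i j) ^ 2) := by
    refine Real.continuous_sqrt.comp (continuous_finsetSum _ fun i _ =>
      continuous_finsetSum _ fun j _ => ((hent i j).sub continuous_const).pow 2)
  refine squeeze_zero (fun _ => dist_nonneg) (fun x => ?_) (by simpa using hc.tendsto x0)
  exact abs_topEigenvalue_sub_topEigenvalue_le (W.isHermitian_connectivityMatrix x)
    (W.isHermitian_connectivityMatrix x0) hn

end Continuity

section ConditionalLaw

variable {n : ℕ} {W : Graphon}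

theorem Graphon.graphProb_nonneg (W : Graphon) (x : Fin n → I) (H : SimpleGraph (Fin n)) :
    0 ≤ W.graphProb x H := by
  rw [W.graphProb_eq]; exact bernoulliWeight_nonneg (W.edgeProb_mem x) H

theorem Graphon.sum_graphProb (W : Graphon) (x : Fin n → I) : ∑ H, W.graphProb x H = 1 := by
  simp only [W.graphProb_eq, sum_bernoulliWeight]

theorem Graphon.measurable_graphProb (W : Graphon) (H : SimpleGraph (Fin n)) :
    Measurable fun x : Fin n → I => W.graphProb x H := by
  unfold Graphon.graphProb
  refine Finset.measurable_prod _ fun i _ => Finset.measurable_prod _ fun j _ => ?_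
  have h : Measurable fun x : Fin n → I => W (x i) (x j) :=
    W.measurable'.comp (f := fun x : Fin n → I => (x i, x j))
      ((measurable_pi_apply i).prodMk (measurable_pi_apply j))
  split_ifs
  · exact h
  · exact measurable_const.sub h

/-- The law of a measurable statistic of the `W`-random graph with given vertex labels. -/
def Graphon.statisticKernel (W : Graphon) (d : SimpleGraph (Fin n) → (Fin n → I) → ℝ)
    (hd : ∀ H, Measurable (d H)) : Kernel (Fin n → I) ℝ where
  toFun x := ∑ H, ENNReal.ofReal (W.graphProb x H) • Measure.dirac (d H x)
  measurable' := by
    refine Measure.measurable_of_measurable_coe _ fun s hs => ?_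
    simp only [Measure.coe_finsetSum, Finset.sum_apply, Measure.smul_apply, smul_eq_mul,
      Measure.dirac_apply' _ hs]
    refine Finset.measurable_sum _ fun H _ => ?_
    exact (W.measurable_graphProb H).ennreal_ofReal.mul
      ((measurable_one.indicator hs).comp (hd H))

variable {d : SimpleGraph (Fin n) → (Fin n → I) → ℝ} {hd : ∀ H, Measurable (d H)}

theorem Graphon.statisticKernel_apply (W : Graphon) (x : Fin n → I) :
    W.statisticKernel d hd x = ∑ H, ENNReal.ofReal (W.graphProb x H) • Measure.dirac (d H x) :=
  rfl

instance : IsMarkovKernel (W.statisticKernel d hd) := by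
  refine ⟨fun x => ⟨?_⟩⟩
  simp only [Graphon.statisticKernel_apply, Measure.coe_finsetSum, Finset.sum_apply,
    Measure.smul_apply, smul_eq_mul, measure_univ, mul_one]
  rw [← ENNReal.ofReal_sum_of_nonneg fun H _ => W.graphProb_nonneg x H, W.sum_graphProb,
    ENNReal.ofReal_one]

theorem Graphon.charFun_statisticKernel (W : Graphon) (x : Fin n → I) (t : ℝ) :
    charFun (W.statisticKernel d hd x) t =
      ∑ H, (W.graphProb x H : ℂ) * Complex.exp (((t * d H x : ℝ) : ℂ) * Complex.I) := by
  rw [charFun_apply_real, W.statisticKernel_apply, integral_finsetSum_measure]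
  · refine Finset.sum_congr rfl fun H _ => ?_
    rw [integral_smul_measure, integral_dirac, ENNReal.toReal_ofReal (W.graphProb_nonneg x H),
      Complex.real_smul]
    push_cast; rfl
  · intro H _
    exact (integrable_dirac (by simp)).smul_measure ENNReal.ofReal_ne_top

variable {Ω : Type*} [MeasurableSpace Ω] {P : Measure Ω} [IsProbabilityMeasure P]
  {U : ℕ → Ω → I} {G : (n : ℕ) → Ω → SimpleGraph (Fin n)}

theorem IsWRandomGraph.measurable_firstTerms (hG : IsWRandomGraph P W U G) (n : ℕ) :
    Measurable fun ω => firstTerms n fun i => U i ω :=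
  measurable_pi_lambda _ fun i => hG.measurable_U i

theorem measurableSet_singleton_simpleGraph (H : SimpleGraph (Fin n)) :
    MeasurableSet ({H} : Set (SimpleGraph (Fin n))) := by
  have h : ({H} : Set (SimpleGraph (Fin n))) =
      ⋂ i, ⋂ j, (fun H' : SimpleGraph (Fin n) => H'.Adj i j) ⁻¹' {H.Adj i j} := by
    ext H'
    simp only [Set.mem_singleton_iff, Set.mem_iInter, Set.mem_preimage, SimpleGraph.ext_iff,
      funext_iff]
  rw [h]
  refine MeasurableSet.iInter fun i => MeasurableSet.iInter fun j => ?_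
  exact ((measurable_pi_apply j).comp ((measurable_pi_apply i).comp SimpleGraph.measurable_adj))
    (MeasurableSet.of_discrete)

/-- The defining property of conditional expectation, integrated over an event of the labels and
moved from real integrals to `lintegral`. -/
theorem IsWRandomGraph.measure_inter (hG : IsWRandomGraph P W U G) (n : ℕ)
    (H : SimpleGraph (Fin n)) {B : Set (Fin n → I)} (hB : MeasurableSet B) :
    P (G n ⁻¹' {H} ∩ (fun ω => firstTerms n fun i => U i ω) ⁻¹' B) =
      ∫⁻ ω in (fun ω => firstTerms n fun i => U i ω) ⁻¹' B,
        ENNReal.ofReal (W.graphProb (firstTerms n fun i => U i ω) H) ∂P := by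
  set X : Ω → Fin n → I := fun ω => firstTerms n fun i => U i ω with hX
  have hXm : Measurable X := hG.measurable_firstTerms n
  have hGm : MeasurableSet (G n ⁻¹' {H}) :=
    hG.measurable_G n (measurableSet_singleton_simpleGraph H)
  have h1 := setIntegral_condExp (μ := P) hXm.comap_le
    (f := (G n ⁻¹' {H}).indicator fun _ => (1 : ℝ)) (s := X ⁻¹' B)
    ((integrable_const 1).indicator hGm) ⟨B, hB, rfl⟩
  have h2 := setIntegral_congr_ae (s := X ⁻¹' B) (hXm hB)
    ((hG.condLaw_G n H).mono fun ω h _ => h)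
  rw [h2, setIntegral_indicator hGm] at h1
  simp only [integral_const, smul_eq_mul, mul_one, measureReal_restrict_apply_univ] at h1
  have hint : Integrable (fun ω => W.graphProb (X ω) H) (P.restrict (X ⁻¹' B)) := by
    refine Integrable.of_bound ((W.measurable_graphProb H).comp hXm).aestronglyMeasurable 1
      (Eventually.of_forall fun ω => ?_)
    rw [Real.norm_eq_abs, abs_of_nonneg (W.graphProb_nonneg _ _), ← W.sum_graphProb (X ω)]
    exact Finset.single_le_sum (f := fun H => W.graphProb (X ω) H)
      (fun H _ => W.graphProb_nonneg _ _) (Finset.mem_univ H)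
  rw [← ofReal_integral_eq_lintegral_ofReal hint
    (Eventually.of_forall fun ω => W.graphProb_nonneg _ _), h1, measureReal_def,
    ENNReal.ofReal_toReal (measure_ne_top _ _), Set.inter_comm]

/-- A conditional distribution is determined almost everywhere by the joint law, which is compared
on rectangles after splitting over the finitely many values of the graph; on each piece the
statistic depends on the labels alone. -/
theorem IsWRandomGraph.condDistrib_statistic (hG : IsWRandomGraph P W U G) (n : ℕ)
    (d : SimpleGraph (Fin n) → (Fin n → I) → ℝ) (hd : ∀ H, Measurable (d H)) :
    condDistrib (fun ω => d (G n ω) (firstTerms n fun i => U i ω))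
      (fun ω => firstTerms n fun i => U i ω) P
      =ᵐ[P.map fun ω => firstTerms n fun i => U i ω] W.statisticKernel d hd := by
  set X : Ω → Fin n → I := fun ω => firstTerms n fun i => U i ω with hX
  have hXm : Measurable X := hG.measurable_firstTerms n
  have hGm : ∀ H, MeasurableSet (G n ⁻¹' {H}) := fun H =>
    hG.measurable_G n (measurableSet_singleton_simpleGraph H)
  have hunion : ∀ s : Set Ω, s = ⋃ H, G n ⁻¹' {H} ∩ s := fun s => by
    ext ω; simp
  have hYm : Measurable fun ω => d (G n ω) (X ω) := by
    intro t ht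
    rw [hunion ((fun ω => d (G n ω) (X ω)) ⁻¹' t)]
    refine MeasurableSet.iUnion fun H => ?_
    have : G n ⁻¹' {H} ∩ (fun ω => d (G n ω) (X ω)) ⁻¹' t =
        G n ⁻¹' {H} ∩ X ⁻¹' (d H ⁻¹' t) := by
      ext ω
      simp only [Set.mem_inter_iff, Set.mem_preimage, Set.mem_singleton_iff]
      exact and_congr_right fun h => by rw [h]
    rw [this]
    exact (hGm H).inter (hXm (hd H ht))
  refine condDistrib_ae_eq_of_measure_eq_compProd_of_measurable hXm hYm ?_
  have : IsProbabilityMeasure (P.map X) := Measure.isProbabilityMeasure_map hXm.aemeasurable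
  have : IsProbabilityMeasure (P.map fun ω => (X ω, d (G n ω) (X ω))) :=
    Measure.isProbabilityMeasure_map (hXm.prodMk hYm).aemeasurable
  refine Measure.ext_prod fun {a t} ha ht => ?_
  rw [Measure.compProd_apply_prod ha ht, Measure.map_apply (hXm.prodMk hYm) (ha.prod ht)]
  have hL : (fun ω => (X ω, d (G n ω) (X ω))) ⁻¹' a ×ˢ t =
      ⋃ H, G n ⁻¹' {H} ∩ X ⁻¹' (a ∩ d H ⁻¹' t) := by
    rw [hunion ((fun ω => (X ω, d (G n ω) (X ω))) ⁻¹' a ×ˢ t)]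
    refine Set.iUnion_congr fun H => ?_
    ext ω
    simp only [Set.mem_inter_iff, Set.mem_preimage, Set.mem_singleton_iff, Set.mem_prod]
    exact and_congr_right fun h => by rw [h]
  rw [hL, measure_iUnion, tsum_fintype]
  · simp only [Graphon.statisticKernel_apply, Measure.coe_finsetSum, Finset.sum_apply,
      Measure.smul_apply, smul_eq_mul, Measure.dirac_apply' _ ht]
    rw [lintegral_finsetSum]
    · refine Finset.sum_congr rfl fun H _ => ?_
      rw [hG.measure_inter n H (ha.inter (hd H ht))]
      have h1 : ∀ x, ENNReal.ofReal (W.graphProb x H) * t.indicator 1 (d H x) =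
          (d H ⁻¹' t).indicator (fun x => ENNReal.ofReal (W.graphProb x H)) x := fun x => by
        by_cases hx : d H x ∈ t
        · rw [Set.indicator_of_mem hx, Set.indicator_of_mem (s := d H ⁻¹' t) hx]; simp
        · rw [Set.indicator_of_notMem hx, Set.indicator_of_notMem (s := d H ⁻¹' t) hx]; simp
      simp_rw [h1]
      rw [setLIntegral_indicator (hd H ht), Set.inter_comm,
        setLIntegral_map ((hd H ht).inter ha) (W.measurable_graphProb H).ennreal_ofReal hXm,
        Set.inter_comm]
    · intro H _
      exact (W.measurable_graphProb H).ennreal_ofReal.mul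
        ((measurable_one.indicator ht).comp (hd H))
  · intro H H' hne
    refine Disjoint.mono Set.inter_subset_left Set.inter_subset_left ?_
    exact Disjoint.preimage _ (Set.disjoint_singleton.2 hne)
  · exact fun H => (hGm H).inter (hXm (ha.inter (hd H ht)))

end ConditionalLaw

theorem measurableSet_equidistributed : MeasurableSet {u : ℕ → I | Equidistributed u} := by
  have h : {u : ℕ → I | Equidistributed u} = ⋂ k : ℕ, {u | Tendsto (fun n : ℕ => (n : ℝ)⁻¹ *
      ∑ i : Fin n, TopologicalSpace.denseSeq C(I, ℝ) k (u i)) atTop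
      (𝓝 (∫ x, TopologicalSpace.denseSeq C(I, ℝ) k x))} := by
    ext u
    simp only [Set.mem_iInter, Set.mem_ofPred_eq]
    exact ⟨fun h k => h _, fun h =>
      Equidistributed.of_denseRange (TopologicalSpace.denseRange_denseSeq _) h⟩
  rw [h]
  refine MeasurableSet.iInter fun k => measurableSet_tendsto _ fun n => ?_
  refine Measurable.const_mul (Finset.measurable_sum _ fun i _ => ?_) _
  exact (ContinuousMap.continuous _).measurable.comp (measurable_pi_apply _)

/-! ### The limiting parameters and the quenched limit. -/

section Limits

variable {W : Graphon} {φ : Graphon.L2} {f : C(I, ℝ)}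

theorem integral_sq_eq_one (hφ : ‖φ‖ = 1) (hf : φ =ᵐ[volume] f) : ∫ x, f x ^ 2 = 1 := by
  have h : inner ℝ φ φ = (1 : ℝ) := by rw [real_inner_self_eq_norm_sq, hφ]; norm_num
  rw [← h, L2.inner_def]
  refine integral_congr_ae ?_
  filter_upwards [hf] with x hx
  simp only [RCLike.inner_apply, conj_trivial]
  rw [hx]; ring

theorem ae_prod_eq (hf : φ =ᵐ[volume] f) :
    ∀ᵐ p : I × I, φ p.1 = f p.1 ∧ φ p.2 = f p.2 := by
  have h1 : (fun p : I × I => φ p.1) =ᵐ[volume.prod volume] fun p => f p.1 :=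
    Measure.quasiMeasurePreserving_fst.ae_eq_comp hf
  have h2 : (fun p : I × I => φ p.2) =ᵐ[volume.prod volume] fun p => f p.2 :=
    Measure.quasiMeasurePreserving_snd.ae_eq_comp hf
  filter_upwards [h1, h2] with p a b using ⟨a, b⟩

/-- Swapping the variables and using the symmetry of `W` shows that the two halves of the
symmetrized integrand have equal integrals. -/
theorem limitMean_eq (hLip : W.IsLipschitz) (hf : φ =ᵐ[volume] f) :
    W.limitMean φ =
      (∫ p : I × I, f p.2 ^ 2 * (W p.1 p.2 * (1 - W p.1 p.2))) / W.posEigenvalue 1 := by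
  have hWc := hLip.continuous
  have hint : ∀ g : I × I → ℝ, Continuous g → Integrable g (volume : Measure (I × I)) :=
    fun g hg => hg.integrable_of_hasCompactSupport (HasCompactSupport.of_compactSpace _)
  have h1 : ∫ p : I × I, ((φ p.1) ^ 2 + (φ p.2) ^ 2) / 2 * (W p.1 p.2 * (1 - W p.1 p.2)) =
      ∫ p : I × I, (1 / 2 * (f p.1 ^ 2 * (W p.1 p.2 * (1 - W p.1 p.2))) +
        1 / 2 * (f p.2 ^ 2 * (W p.1 p.2 * (1 - W p.1 p.2)))) := by
    refine integral_congr_ae ?_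
    filter_upwards [ae_prod_eq hf] with p hp
    rw [hp.1, hp.2]; ring
  have h2 : ∫ p : I × I, f p.1 ^ 2 * (W p.1 p.2 * (1 - W p.1 p.2)) =
      ∫ p : I × I, f p.2 ^ 2 * (W p.1 p.2 * (1 - W p.1 p.2)) := by
    have h := integral_prod_swap (μ := (volume : Measure I)) (ν := (volume : Measure I))
      fun p : I × I => f p.2 ^ 2 * (W p.1 p.2 * (1 - W p.1 p.2))
    refine Eq.trans ?_ h
    refine integral_congr_ae (Eventually.of_forall fun p => ?_)
    simp only [Prod.fst_swap, Prod.snd_swap]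
    rw [W.symm' p.2 p.1]
  rw [Graphon.limitMean, h1, integral_add (hint _ (by fun_prop)) (hint _ (by fun_prop)),
    integral_const_mul, integral_const_mul, h2]
  ring

theorem limitVariance_eq (hf : φ =ᵐ[volume] f) :
    W.limitVariance φ =
      2 * ∫ p : I × I, f p.1 ^ 2 * f p.2 ^ 2 * (W p.1 p.2 * (1 - W p.1 p.2)) := by
  rw [Graphon.limitVariance]
  congr 1
  refine integral_congr_ae ?_
  filter_upwards [ae_prod_eq hf] with p hp
  rw [hp.1, hp.2]

/-- The quenched central limit theorem for the largest eigenvalue, on the level of characteristic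
functions and for equidistributed vertex labels. -/
theorem tendsto_charFun_of_equidistributed (hLip : W.IsLipschitz) (hgap : W.HasSpectralGap)
    (hφ : W.IsTopEigenfunction φ) {u : ℕ → I} (hu : Equidistributed u) (t : ℝ) :
    Tendsto (fun n => ∑ H, (W.graphProb (firstTerms n u) H : ℂ) *
      Complex.exp (((t * (topEigenvalue (adjacencyMatrix H) -
        topEigenvalue (W.connectivityMatrix (firstTerms n u))) : ℝ) : ℂ) * Complex.I)) atTop
      (𝓝 (Complex.exp (t * W.limitMean φ * Complex.I - W.limitVariance φ * t ^ 2 / 2))) := by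
  set m := W.posEigenvalue 1 with hm
  obtain ⟨c, hc2, hcm⟩ := exists_between hgap
  have hc0 : 0 < c := (W.posEigenvalue_nonneg 2).trans_lt hc2
  have hm0 : 0 < m := hc0.trans hcm
  obtain ⟨f, hφf, hf⟩ := W.exists_continuous_eigenfunction hLip hm0.ne' hφ.2
  have hf1 := integral_sq_eq_one hφ.1 hφf
  obtain ⟨v, hv, hWv, hvgap, hl, hvf⟩ := exists_top_eigenvectors_asymptotics hLip hu hc2 hcm hf hf1
  set l : ℕ → ℝ := fun n => topEigenvalue (W.connectivityMatrix (firstTerms n u)) with hldef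
  have hlow : ∀ᶠ n : ℕ in atTop, m / 2 * n ≤ l n := by
    filter_upwards [hl.eventually_const_le (half_lt_self hm0), eventually_gt_atTop 0] with n h hn
    have hn0 : (0 : ℝ) < n := by positivity
    rw [← div_eq_inv_mul, le_div_iff₀ hn0] at h
    exact h
  -- Eventually `l n ≥ (m + c) / 2 * n`, so the bound `c n` on the complement lies at least `(m - c)
  -- / 2 * n` below `l n`.
  refine tendsto_charFun_topEigenvalue_sub W (fun n => firstTerms n u) v l (g := (m - c) / 2)
    (κ := m / 2) (by linarith) (by positivity) hv hWv ?_ hlow ?_ ?_ t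
  · filter_upwards [hvgap, hl.eventually_const_le (by linarith : (m + c) / 2 < m),
      eventually_gt_atTop 0] with n h1 h2 hn y hy
    have hn0 : (0 : ℝ) < n := by positivity
    rw [← div_eq_inv_mul, le_div_iff₀ hn0] at h2
    refine (h1 y hy).trans (mul_le_mul_of_nonneg_right ?_ (sq_nonneg _))
    have h3 : (m + c) / 2 * n ≤ l n := h2
    linarith
  · rw [limitMean_eq hLip hφf]
    have h := (tendsto_noiseImageMean hLip hu hv hvf).div hl hm0.ne'
    refine h.congr' ?_
    filter_upwards [eventually_gt_atTop 0] with n hn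
    have hn0 : (n : ℝ)⁻¹ ≠ 0 := by positivity
    exact mul_div_mul_left _ _ hn0
  · rw [limitVariance_eq hφf]
    -- The constant comes from delocalization with `l ≥ (m / 2) n`: `(m / 2 * n * |v_i|)² ≤ n`.
    refine tendsto_quadraticFormVariance hLip hu hf1 hv (C := 4 / m ^ 2) ?_ hvf
    filter_upwards [hv, hWv, hlow, eventually_gt_atTop 0] with n hv hWv hl hn i
    have hn0 : (0 : ℝ) < n := by positivity
    have h1 := abs_eigenvector_coord_le W (firstTerms n u) hv hWv (le_trans (by positivity) hl) i
    have h2 : m / 2 * n * |v n i| ≤ √n :=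
      (mul_le_mul_of_nonneg_right hl (abs_nonneg _)).trans h1
    have h3 : (m / 2 * n * |v n i|) ^ 2 ≤ n :=
      (pow_le_pow_left₀ (by positivity) h2 2).trans_eq (Real.sq_sqrt hn0.le)
    rw [mul_pow, sq_abs] at h3
    rw [← div_eq_mul_inv, le_div_iff₀ hn0, le_div_iff₀ (by positivity)]
    refine le_of_mul_le_mul_right ?_ hn0
    linarith

end Limits

end

theorem proposition4p9 (W : Graphon) (hLip : W.IsLipschitz) (hgap : W.HasSpectralGap)
    (φ : Graphon.L2) (hφ : W.IsTopEigenfunction φ)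
    {Ω : Type*} [MeasurableSpace Ω] (P : Measure Ω) [IsProbabilityMeasure P]
    (U : ℕ → Ω → unitInterval) (G : (n : ℕ) → Ω → SimpleGraph (Fin n))
    (hG : IsWRandomGraph P W U G) :
    ∃ 𝒜 : Set (ℕ → unitInterval), MeasurableSet 𝒜 ∧ P {ω | (fun i => U i ω) ∈ 𝒜} = 1 ∧
      ∀ u ∈ 𝒜, Tendsto (fun n => conditionalLaw P W U G n (firstTerms n u)) atTop
        (𝓝 (normalLaw (W.limitMean φ) (W.limitVariance φ) (W.limitVariance_nonneg φ))) := by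
  have hd : ∀ n : {n : ℕ // 2 ≤ n}, ∀ H : SimpleGraph (Fin n), Measurable fun x : Fin n → I =>
      topEigenvalue (adjacencyMatrix H) - topEigenvalue (W.connectivityMatrix x) := fun n H =>
    measurable_const.sub (continuous_topEigenvalue_connectivityMatrix hLip n.2).measurable
  have hcond := fun n : {n : ℕ // 2 ≤ n} => hG.condDistrib_statistic n _ (hd n)
  -- The conditional law is known only up to null sets of labels, so for each `n` a measurable set
  -- of full measure is chosen on which it equals the explicit kernel. Sizes below `2` do not affect
  -- the limit.
  choose S hSmem hSmeas hS using fun n => (hcond n).exists_measurable_mem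
  have hfirst : ∀ n, Measurable (firstTerms n : (ℕ → I) → Fin n → I) := fun n =>
    measurable_pi_lambda _ fun i => measurable_pi_apply _
  have hUm : Measurable fun ω i => U i ω := measurable_pi_lambda _ hG.measurable_U
  -- A countable intersection of measurable events of full probability; it serves all `t` at once.
  set 𝒜 : Set (ℕ → I) := {u | Equidistributed u} ∩ ⋂ n : {n : ℕ // 2 ≤ n}, firstTerms n ⁻¹' S n
  have h𝒜m : MeasurableSet 𝒜 :=
    measurableSet_equidistributed.inter (MeasurableSet.iInter fun n => hfirst n (hSmeas n))
  refine ⟨𝒜, h𝒜m, ?_, fun u hu => ?_⟩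
  · refine (mem_ae_iff_prob_eq_one (hUm h𝒜m)).1 ?_
    have h1 := ae_equidistributed hG.measurable_U hG.uniform_U hG.indep_U
    have h2 : ∀ᵐ ω ∂P, ∀ n : {n : ℕ // 2 ≤ n}, (firstTerms n fun i => U i ω) ∈ S n :=
      ae_all_iff.2 fun n => ae_of_ae_map (hG.measurable_firstTerms n).aemeasurable (hSmem n)
    filter_upwards [h1, h2] with ω a b
    exact ⟨a, Set.mem_iInter.2 b⟩
  · refine ProbabilityMeasure.tendsto_iff_tendsto_charFun.2 fun t => ?_
    have hlim : charFun (normalLaw (W.limitMean φ) (W.limitVariance φ)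
        (W.limitVariance_nonneg φ) : Measure ℝ) t =
        Complex.exp (t * W.limitMean φ * Complex.I - W.limitVariance φ * t ^ 2 / 2) :=
      charFun_gaussianReal t
    rw [hlim]
    refine (tendsto_charFun_of_equidistributed hLip hgap hφ hu.1 t).congr' ?_
    filter_upwards [eventually_ge_atTop 2] with n hn
    have h1 := hS ⟨n, hn⟩ _ (Set.mem_iInter.1 hu.2 ⟨n, hn⟩)
    have h2 := (W.charFun_statisticKernel (hd := hd ⟨n, hn⟩) (firstTerms n u) t).symm
    refine h2.trans ?_
    rw [← h1]
    rfl
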